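/- Identify the circle $\mathbb T^1=\mathbb R/\mathbb Z$ with $[0,1)$; intervals, closed-interval extensions and distances $|x-y|$ are taken in this coordinate, and $1$ is identified with $0$ when a closure is taken in $\mathbb T^1$. Fix $\alpha\in(0,1)$, $f:\mathbb T^1\to\mathbb T^1$ and $\tau:\mathbb T^1\to\mathbb R$. Suppose that there is a partition of $(0,1)$, modulo a closed countable set, into countably many open intervals on each of which $f$ is monotone and extends to a $C^{1+\alpha}$ function on the closed interval. For $n\ge 0$ let $\{O_h\}_{h\in\mathcal H^n}$ be the induced partition for $f^n$ (the maximal open intervals of points whose first $n$ iterates $x,f(x),\dots,f^{n-1}(x)$ stay in the partition intervals), where $h:f^n(O_h)\to O_h$ is the corresponding inverse branch of $f^n$. Suppose that $\tau$ is piecewise $C^1$, i.e. $C^1$ on $(0,1)$ off a closed countable set, and put $\tau_n=\sum_{j=0}^{n-1}\tau\circ f^j$. Assume: 1. (expansion) there is $\lambda>\ln 2$ with $|(f^n)'|\ge e^{\lambda n}$ on every $O_h$, $h\in\mathcal H^n$, for all $n$; 2. (distortion) there is $D\ge 0$ with $|h'(x)|/|h'(y)|\le e^{D|x-y|^\alpha}$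 for all $n$, $h\in\mathcal H^n$, $x,y\in f^n(O_h)$; 3. (summability) $\sum_{h\in\mathcal H^n}\sup_{f^n(O_h)}|h'|<\infty$ for all $n$; 4. (covering) for every $n$ there is $N(n)$ with $f^{N(n)}(\overline{O_h})=\mathbb T^1$ for all $h\in\mathcal H^n$; 5. there is no $\phi:[0,1)\to\mathbb R$, Lipschitz with respect to $|x-y|$ on $[0,1)$, such that $\tau=\phi\circ f-\phi+\psi$ with $\psi$ constant on each interval of the joint partition of $f$ and $\tau$; 6. there is $C_\tau$ such that for all $n$ and $h\in\mathcal H^n$, $\tau_n\circ h$ is differentiable on $f^n(O_h)$ and $|(\tau_n\circ h)'|\le C_\tau$ there. For $b\in\mathbb R$ let $$\mathcal L_b^n g=\sum_{h\in\mathcal H^n}e^{ib\,\tau_n\circ h}\cdot g\circ h\cdot|h'|\cdot \mathbf 1_{f^n(O_h)} .$$ Let $\|g\|_{C^\alpha}=|g|_\alpha+\sup|g|$ for $g:[0,1)\to\mathbb C$, with $|g|_\alpha$ the $\alpha$-Hölder seminorm with respect to $|x-y|$. Then there exist $b_0>1$, $\gamma_2>0$ and $C$ (depending only on $f,\tau,\alpha$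 and the partitions) such that for every real $b$ with $|b|\ge b_0$ and every $n\ge 0$, $\mathcal L_b^n$ maps $C^\alpha$ into $L^1([0,1))$ and $$\|\mathcal L_b^n\|_{C^\alpha\to L^1}\le C\,e^{-\frac{\gamma_2}{\ln|b|}\,n}.$$ -/

import Mathlib

open Set MeasureTheory
open scoped NNReal ENNReal

noncomputable section

namespace SkewProduct

/-! The circle is identified with `[0,1)`. Maps of the circle are functions `ℝ → ℝ` of which only
the values on `Set.Ico 0 1` matter; `|x - y|` is the distance of the coordinates. A partition of the
circle into countably many open intervals modulo a countable set is recorded by the exceptional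
closed countable set `S` (the point `0` is always exceptional). -/

/-- The maximal open intervals that make up an open set `U ⊆ ℝ`. -/
def intervalsOf (U : Set ℝ) : Set (Set ℝ) :=
  {O | ∃ x ∈ U, O = ordConnectedComponent U x}

/-- The points of `(0,1)` whose first `n` iterates `x, f x, …, f^{n-1} x` avoid the endpoints of
the partition of `f`. -/
def regularSet (f : ℝ → ℝ) (S : Set ℝ) (n : ℕ) : Set ℝ :=
  {x | x ∈ Ioo (0 : ℝ) 1 ∧ ∀ j < n, f^[j] x ∈ Ioo (0 : ℝ) 1 \ S}

/-- The partition `{O_h}` of `f^n`. It also serves as the index set `H^n` of the inverse branches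
of `f^n`: the branch `h` is indexed by the interval `O = O_h`. -/
def pieces (f : ℝ → ℝ) (S : Set ℝ) (n : ℕ) : Set (Set ℝ) :=
  intervalsOf (regularSet f S n)

/-- The inverse branch `h : f^n(O) → O` of `f^n` (meaningful on `f^n(O)`). -/
def branch (f : ℝ → ℝ) (n : ℕ) (O : Set ℝ) : ℝ → ℝ :=
  Function.invFunOn (f^[n]) O

/-- `f` is piecewise `C^{1+α}` for the partition with exceptional set `S`: on each open interval of
the partition `f` is monotone and extends to a `C^{1+α}` function on the closed interval. -/
def PiecewiseC1Holder (α : ℝ≥0) (f : ℝ → ℝ) (S : Set ℝ) : Prop :=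
  IsClosed S ∧ S.Countable ∧
    ∀ O ∈ intervalsOf (Ioo (0 : ℝ) 1 \ S),
      (MonotoneOn f O ∨ AntitoneOn f O) ∧
      ∃ F : ℝ → ℝ, EqOn f F O ∧ ContDiffOn ℝ 1 F (closure O) ∧
        ∃ K : ℝ≥0, HolderOnWith K α (derivWithin F (closure O)) (closure O)

/-- `τ` is piecewise `C^1` for the partition with exceptional set `R`. -/
def PiecewiseC1 (τ : ℝ → ℝ) (R : Set ℝ) : Prop :=
  IsClosed R ∧ R.Countable ∧ ∀ x ∈ Ioo (0 : ℝ) 1 \ R, ContDiffAt ℝ 1 τ x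

/-- There is `λ > ln 2` with `|(f^n)'| ≥ e^{λ n}` for all `n`. -/
def Expanding (f : ℝ → ℝ) (S : Set ℝ) : Prop :=
  ∃ l : ℝ, Real.log 2 < l ∧
    ∀ n : ℕ, ∀ x ∈ regularSet f S n, Real.exp (l * n) ≤ |deriv (f^[n]) x|

/-- Bounded distortion: `|h'(x)| / |h'(y)| ≤ e^{D |x - y|^α}` for all inverse branches `h`. -/
def BoundedDistortion (α : ℝ≥0) (f : ℝ → ℝ) (S : Set ℝ) : Prop :=
  ∃ D : ℝ, 0 ≤ D ∧ ∀ n : ℕ, ∀ O ∈ pieces f S n, ∀ x ∈ f^[n] '' O, ∀ y ∈ f^[n] '' O,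
    |deriv (branch f n O) x| / |deriv (branch f n O) y| ≤ Real.exp (D * |x - y| ^ (α : ℝ))

/-- `∑_{h ∈ H^n} sup_{f^n(O_h)} |h'| < ∞` for every `n`. -/
def BranchSummable (f : ℝ → ℝ) (S : Set ℝ) : Prop :=
  ∀ n : ℕ, Summable fun O : pieces f S n =>
    sSup ((fun x => |deriv (branch f n O) x|) '' (f^[n] '' (O : Set ℝ)))

/-- For every `n` there is `N` such that `f^N` maps the closure (in the circle) of every element of
the partition of `f^n` onto the circle. `Int.fract` identifies the endpoint `1` with `0`. -/
def Covering (f : ℝ → ℝ) (S : Set ℝ) : Prop :=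
  ∀ n : ℕ, ∃ N : ℕ, ∀ O ∈ pieces f S n, f^[N] '' (Int.fract '' closure O) = Ico (0 : ℝ) 1

/-- `τ = φ ∘ f - φ + ψ` with `φ` Lipschitz and `ψ` constant on each interval of the joint partition
of `f` and `τ`. -/
def CohomologousToPiecewiseConstant (f τ : ℝ → ℝ) (S R : Set ℝ) : Prop :=
  ∃ φ ψ : ℝ → ℝ, (∃ K : ℝ≥0, LipschitzOnWith K φ (Ico (0 : ℝ) 1)) ∧
    (∀ O ∈ intervalsOf (Ioo (0 : ℝ) 1 \ (S ∪ R)), ∃ c : ℝ, ∀ x ∈ O, ψ x = c) ∧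
    ∀ x ∈ Ioo (0 : ℝ) 1 \ (S ∪ R), τ x = φ (f x) - φ x + ψ x

/-- `|(τ_n ∘ h)'| ≤ C_τ` for all `n` and all `h ∈ H^n`, where `τ_n = ∑_{j<n} τ ∘ f^j`. -/
def BranchRegular (f τ : ℝ → ℝ) (S : Set ℝ) : Prop :=
  ∃ Cτ : ℝ, ∀ n : ℕ, ∀ O ∈ pieces f S n, ∀ x ∈ f^[n] '' O,
    DifferentiableAt ℝ (birkhoffSum f τ n ∘ branch f n O) x ∧
      |deriv (birkhoffSum f τ n ∘ branch f n O) x| ≤ Cτ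

/-- The standing assumptions on the skew product `F(x,y) = (f x, y + τ x)`; `S` and `R` are the
exceptional sets of the partitions of `f` and of `τ`. -/
structure Setting (α : ℝ≥0) (f τ : ℝ → ℝ) (S R : Set ℝ) : Prop where
  mapsTo : MapsTo f (Ico (0 : ℝ) 1) (Ico (0 : ℝ) 1)
  piecewise_f : PiecewiseC1Holder α f S
  expanding : Expanding f S
  distortion : BoundedDistortion α f S
  summable : BranchSummable f S
  covering : Covering f S
  piecewise_τ : PiecewiseC1 τ R
  not_cohomologous : ¬ CohomologousToPiecewiseConstant f τ S R
  regular : BranchRegular f τ S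

/-- The `n`-th power of the twisted transfer operator,
`L_b^n g = ∑_{h ∈ H^n} e^{i b τ_n ∘ h} · g ∘ h · |h'| · 1_{f^n(O_h)}`. -/
def transfer (f τ : ℝ → ℝ) (S : Set ℝ) (b : ℝ) (n : ℕ) (g : ℝ → ℂ) (x : ℝ) : ℂ :=
  ∑' O : pieces f S n, (f^[n] '' (O : Set ℝ)).indicator
    (fun x => Complex.exp (Complex.I * b * birkhoffSum f τ n (branch f n O x)) *
      g (branch f n O x) * (|deriv (branch f n O) x| : ℝ)) x

/-- The norm `‖g‖_{C^α} = |g|_α + sup |g|` on `[0,1)`, with value `∞` if `g` is not in `C^α`. -/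
def holderNorm (α : ℝ≥0) (g : ℝ → ℂ) : ℝ≥0∞ :=
  eHolderNorm α ((Ico (0 : ℝ) 1).domRestrict g) + ⨆ x ∈ Ico (0 : ℝ) 1, ‖g x‖ₑ

/-- The operator norm from `C^α` to `L^1`, with values in `[0, ∞]`. -/
def mixedNorm (α : ℝ≥0) (T : (ℝ → ℂ) → ℝ → ℂ) : ℝ≥0∞ :=
  ⨆ (g : ℝ → ℂ) (_ : holderNorm α g ≤ 1), eLpNorm (T g) 1 (volume.restrict (Ico (0 : ℝ) 1))

end SkewProduct

end

/-! Integrating `L_b^n g` against a bounded `φ` gives the integral of `g` against `e^{ibτ_n} φ ∘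
f^n` (`twist`), so the `L^1` norm is attained by testing with measurable `φ` into the unit disc. The
complex density `g dx` is pushed forward as a countable family of atoms: a positive log-Hölder
density on an interval times a phase in the unit disc whose Hölder constant is of order `|b|^α`. Two
numbers are followed: the total mass `m`, which bounds the functional, and the sum `z` of the
suprema of the densities. Since an atom has mass at most length times supremum, `z ≤ Z m` forces at
least half of the mass onto atoms longer than a constant depending on `Z`.

Without any cancellation `m` does not grow, and `z` becomes at most `σ z + c m` with `σ < 1`
(`UniformBounds.exists_tsum_atomSup_push_le`). Indeed an interval is cut into pieces contained in
it, whose suprema are controlled by mass, at most two boundary pieces, contracted by `e^{-l}` each,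
and a summable tail; `l > ln 2` is exactly `2 e^{-l} < 1`. The Hölder constants of the phases
contract up to an error of order `|b|^α`.

Cancellation comes from `Setting.exists_transversal`. If the derivatives of `τ_n ∘ h` over a common
point became uniformly close as `n` grows, they would converge to a bounded `χ` with `τ' = (χ ∘ f)
f' - χ` off a countable set. A primitive `φ` of `χ` would be Lipschitz with `τ - φ ∘ f + φ`
piecewise constant, which is excluded. Covering carries one transversal pair of branches into every
interval of a given length (`Setting.exists_hasTransversalPair`). Hence a long atom has, after a
fixed number of steps, two images over a common interval whose relative phase turns at speed at
least `c |b|`. On a block of length of order `1 / |b|` this makes half a turn while the inherited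
phases hardly move, so the two images cannot be aligned throughout; near a bad point they are merged
into one atom of smaller mass. The proportion lost does not depend on `b`
(`UniformBounds.exists_cancellation`).

The price is of order `|b|` blocks, which raises `z` to order `|b| m`. About `log |b|` further steps
restore `z ≤ Z m` (`UniformBounds.exists_log_contraction`). Thus `m` shrinks by a fixed `θ < 1`
every `O(log |b|)` steps, which is the rate `γ / ln |b|`. -/

namespace SkewProduct

open Filter Topology

variable {α : ℝ≥0} {f τ : ℝ → ℝ} {S R : Set ℝ}

/-! ### Components of open subsets of the line. -/

section IntervalsOf

variable {U O O₁ O₂ : Set ℝ}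

lemma isOpen_of_mem_intervalsOf (hU : IsOpen U) (hO : O ∈ intervalsOf U) : IsOpen O := by
  obtain ⟨x, -, rfl⟩ := hO
  refine isOpen_iff_mem_nhds.2 fun y hy => ?_
  rw [ordConnectedComponent_eq (mem_ordConnectedComponent.1 hy)]
  exact ordConnectedComponent_mem_nhds.2 (hU.mem_nhds (ordConnectedComponent_subset hy))

lemma ordConnected_of_mem_intervalsOf (hO : O ∈ intervalsOf U) : O.OrdConnected := by
  obtain ⟨x, -, rfl⟩ := hO
  infer_instance

lemma subset_of_mem_intervalsOf (hO : O ∈ intervalsOf U) : O ⊆ U := by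
  obtain ⟨x, -, rfl⟩ := hO
  exact ordConnectedComponent_subset

lemma nonempty_of_mem_intervalsOf (hO : O ∈ intervalsOf U) : O.Nonempty := by
  obtain ⟨x, hx, rfl⟩ := hO
  exact ⟨x, self_mem_ordConnectedComponent.2 hx⟩

lemma exists_mem_intervalsOf {x : ℝ} (hx : x ∈ U) : ∃ O ∈ intervalsOf U, x ∈ O :=
  ⟨_, ⟨x, hx, rfl⟩, self_mem_ordConnectedComponent.2 hx⟩

lemma eq_of_mem_intervalsOf (h₁ : O₁ ∈ intervalsOf U) (h₂ : O₂ ∈ intervalsOf U) {y : ℝ}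
    (hy₁ : y ∈ O₁) (hy₂ : y ∈ O₂) : O₁ = O₂ := by
  obtain ⟨x₁, -, rfl⟩ := h₁
  obtain ⟨x₂, -, rfl⟩ := h₂
  rw [ordConnectedComponent_eq (mem_ordConnectedComponent.1 hy₁),
    ordConnectedComponent_eq (mem_ordConnectedComponent.1 hy₂)]

lemma pairwiseDisjoint_intervalsOf : (intervalsOf U).PairwiseDisjoint id := by
  intro O₁ h₁ O₂ h₂ hne
  refine Set.disjoint_left.2 fun y hy₁ hy₂ => hne ?_
  exact eq_of_mem_intervalsOf h₁ h₂ hy₁ hy₂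

lemma countable_intervalsOf (hU : IsOpen U) : (intervalsOf U).Countable :=
  pairwiseDisjoint_intervalsOf.countable_of_isOpen
    (fun _ hO => isOpen_of_mem_intervalsOf hU hO) (fun _ hO => nonempty_of_mem_intervalsOf hO)

lemma sUnion_intervalsOf : ⋃₀ intervalsOf U = U := by
  ext x
  constructor
  · rintro ⟨O, hO, hx⟩
    exact subset_of_mem_intervalsOf hO hx
  · intro hx
    obtain ⟨O, hO, hxO⟩ := exists_mem_intervalsOf hx
    exact ⟨O, hO, hxO⟩

/-- The component of `y` is an open neighbourhood of a closure point of `O`, so it meets `O` and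
equals it. This removes the closures that occur in the covering assumption. -/
lemma mem_of_mem_closure_of_mem_intervalsOf (hU : IsOpen U) (hO : O ∈ intervalsOf U) {y : ℝ}
    (hy : y ∈ closure O) (hyU : y ∈ U) : y ∈ O := by
  obtain ⟨O', hO', hyO'⟩ := exists_mem_intervalsOf hyU
  obtain ⟨z, hz', hz⟩ := mem_closure_iff.1 hy O' (isOpen_of_mem_intervalsOf hU hO') hyO'
  rwa [eq_of_mem_intervalsOf hO hO' hz hz']

end IntervalsOf

/-! ### Regular points and inverse branches. -/

lemma Setting.isOpen_base (h : Setting α f τ S R) : IsOpen (Ioo (0 : ℝ) 1 \ S) :=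
  isOpen_Ioo.sdiff h.piecewise_f.1

lemma Setting.contDiffAt (h : Setting α f τ S R) {x : ℝ} (hx : x ∈ Ioo (0 : ℝ) 1 \ S) :
    ContDiffAt ℝ 1 f x := by
  obtain ⟨O, hO, hxO⟩ := exists_mem_intervalsOf hx
  obtain ⟨-, F, hF, hFc, -⟩ := h.piecewise_f.2.2 O hO
  have hmem : O ∈ 𝓝 x := (isOpen_of_mem_intervalsOf h.isOpen_base hO).mem_nhds hxO
  have h1 : ContDiffAt ℝ 1 F x := hFc.contDiffAt (mem_of_superset hmem subset_closure)
  exact h1.congr_of_eventuallyEq (Filter.eventuallyEq_of_mem hmem hF)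

lemma regularSet_succ (n : ℕ) :
    regularSet f S (n + 1) = regularSet f S n ∩ f^[n] ⁻¹' (Ioo (0 : ℝ) 1 \ S) := by
  ext x
  constructor
  · rintro ⟨hx, hj⟩
    exact ⟨⟨hx, fun j hjn => hj j (by omega)⟩, hj n (by omega)⟩
  · rintro ⟨⟨hx, hj⟩, hn⟩
    refine ⟨hx, fun j hjn => ?_⟩
    rcases Nat.lt_succ_iff_lt_or_eq.1 hjn with h1 | rfl
    · exact hj j h1
    · exact hn

lemma regularSet_subset (n : ℕ) : regularSet f S n ⊆ Ioo (0 : ℝ) 1 := fun _ hx => hx.1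

lemma regularSet_zero : regularSet f S 0 = Ioo (0 : ℝ) 1 := by
  ext x; simp [regularSet]

/-- The two claims need one induction: openness at order `n + 1` uses continuity of `f^[n]` on the
regular set of order `n`. -/
lemma Setting.isOpen_regularSet_and_contDiffAt (h : Setting α f τ S R) (n : ℕ) :
    IsOpen (regularSet f S n) ∧ ∀ x ∈ regularSet f S n, ContDiffAt ℝ 1 f^[n] x := by
  induction n with
  | zero =>
    rw [regularSet_zero]
    exact ⟨isOpen_Ioo, fun x _ => contDiffAt_id⟩
  | succ n ih =>
    rw [regularSet_succ]
    refine ⟨?_, fun x hx => ?_⟩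
    · exact ContinuousOn.isOpen_inter_preimage
        (fun x hx => (ih.2 x hx).continuousAt.continuousWithinAt) ih.1 h.isOpen_base
    · rw [Function.iterate_succ']
      exact (h.contDiffAt hx.2).comp x (ih.2 x hx.1)

lemma Setting.isOpen_regularSet (h : Setting α f τ S R) (n : ℕ) : IsOpen (regularSet f S n) :=
  (h.isOpen_regularSet_and_contDiffAt n).1

lemma Setting.contDiffAt_iterate (h : Setting α f τ S R) {n : ℕ} {x : ℝ}
    (hx : x ∈ regularSet f S n) : ContDiffAt ℝ 1 f^[n] x :=
  (h.isOpen_regularSet_and_contDiffAt n).2 x hx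

lemma Setting.hasDerivAt_iterate (h : Setting α f τ S R) {n : ℕ} {x : ℝ}
    (hx : x ∈ regularSet f S n) : HasDerivAt f^[n] (deriv f^[n] x) x :=
  ((h.contDiffAt_iterate hx).differentiableAt (by simp)).hasDerivAt

lemma Setting.hasStrictDerivAt_iterate (h : Setting α f τ S R) {n : ℕ} {x : ℝ}
    (hx : x ∈ regularSet f S n) : HasStrictDerivAt f^[n] (deriv f^[n] x) x :=
  (h.contDiffAt_iterate hx).hasStrictDerivAt (by simp)

lemma Setting.deriv_iterate_ne_zero (h : Setting α f τ S R) {n : ℕ} {x : ℝ}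
    (hx : x ∈ regularSet f S n) : deriv f^[n] x ≠ 0 := by
  obtain ⟨l, -, hl⟩ := h.expanding
  intro h0
  have := hl n x hx
  rw [h0, abs_zero] at this
  exact absurd this (not_le.2 (Real.exp_pos _))

lemma Setting.mapsTo_iterate (h : Setting α f τ S R) (n : ℕ) :
    MapsTo f^[n] (Ico (0 : ℝ) 1) (Ico (0 : ℝ) 1) := h.mapsTo.iterate n

lemma Setting.countable_pieces (h : Setting α f τ S R) (n : ℕ) : (pieces f S n).Countable :=
  countable_intervalsOf (h.isOpen_regularSet n)

section Pieces

variable {n : ℕ} {O : Set ℝ}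

lemma subset_of_mem_pieces (hO : O ∈ pieces f S n) : O ⊆ regularSet f S n :=
  subset_of_mem_intervalsOf hO

lemma Setting.isOpen_of_mem_pieces (h : Setting α f τ S R) (hO : O ∈ pieces f S n) : IsOpen O :=
  isOpen_of_mem_intervalsOf (h.isOpen_regularSet n) hO

lemma ordConnected_of_mem_pieces (hO : O ∈ pieces f S n) : O.OrdConnected :=
  ordConnected_of_mem_intervalsOf hO

/-- By Rolle, two points with the same image would enclose a zero of the derivative, which expansion
forbids. -/
lemma Setting.injOn_iterate (h : Setting α f τ S R) (hO : O ∈ pieces f S n) : InjOn f^[n] O := by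
  have key : ∀ x ∈ O, ∀ y ∈ O, x < y → f^[n] x ≠ f^[n] y := by
    intro x hx y hy hxy heq
    have hsub : Icc x y ⊆ O := (ordConnected_of_mem_pieces hO).out hx hy
    obtain ⟨c, hc, hc0⟩ := exists_deriv_eq_zero hxy
      (fun z hz => (h.hasDerivAt_iterate
        (subset_of_mem_pieces hO (hsub hz))).continuousAt.continuousWithinAt) heq
    exact h.deriv_iterate_ne_zero (subset_of_mem_pieces hO (hsub (Ioo_subset_Icc_self hc))) hc0
  intro x hx y hy heq
  rcases lt_trichotomy x y with hlt | heq' | hlt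
  · exact absurd heq (key x hx y hy hlt)
  · exact heq'
  · exact absurd heq.symm (key y hy x hx hlt)

lemma Setting.continuousOn_iterate (h : Setting α f τ S R) (hO : O ∈ pieces f S n) :
    ContinuousOn f^[n] O := fun _ hx =>
  (h.hasDerivAt_iterate (subset_of_mem_pieces hO hx)).continuousAt.continuousWithinAt

lemma Setting.ordConnected_image (h : Setting α f τ S R) (hO : O ∈ pieces f S n) {I : Set ℝ}
    (hI : I.OrdConnected) : (f^[n] '' (O ∩ I)).OrdConnected := by
  have h1 : (O ∩ I).OrdConnected := (ordConnected_of_mem_pieces hO).inter hI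
  exact ((h1.isPreconnected).image _
    ((h.continuousOn_iterate hO).mono inter_subset_left)).ordConnected

lemma Setting.isOpen_image (h : Setting α f τ S R) (hO : O ∈ pieces f S n) {V : Set ℝ}
    (hV : IsOpen V) : IsOpen (f^[n] '' (O ∩ V)) := by
  refine isOpen_iff_mem_nhds.2 ?_
  rintro _ ⟨x, hx, rfl⟩
  have hxr := subset_of_mem_pieces hO hx.1
  rw [← (h.hasStrictDerivAt_iterate hxr).map_nhds_eq (h.deriv_iterate_ne_zero hxr)]
  exact image_mem_map (((h.isOpen_of_mem_pieces hO).inter hV).mem_nhds hx)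

lemma Setting.isOpen_image_piece (h : Setting α f τ S R) (hO : O ∈ pieces f S n) :
    IsOpen (f^[n] '' O) := by
  simpa using h.isOpen_image hO isOpen_univ

lemma Setting.ordConnected_image_piece (h : Setting α f τ S R) (hO : O ∈ pieces f S n) :
    (f^[n] '' O).OrdConnected := by
  simpa using h.ordConnected_image hO ordConnected_univ

/-- The image is open and contained in `[0,1)`, hence in the interior; in particular it misses `0`.
-/
lemma Setting.image_subset (h : Setting α f τ S R) (hO : O ∈ pieces f S n) :
    f^[n] '' O ⊆ Ioo (0 : ℝ) 1 := by
  rw [← interior_Ico]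
  refine interior_maximal ?_ (h.isOpen_image_piece hO)
  rintro _ ⟨x, hx, rfl⟩
  exact h.mapsTo_iterate n (Ioo_subset_Ico_self (regularSet_subset n (subset_of_mem_pieces hO hx)))

lemma branch_mem {y : ℝ} (hy : y ∈ f^[n] '' O) : branch f n O y ∈ O :=
  Function.invFunOn_mem hy

lemma iterate_branch {y : ℝ} (hy : y ∈ f^[n] '' O) : f^[n] (branch f n O y) = y :=
  Function.invFunOn_eq hy

lemma Setting.branch_iterate (h : Setting α f τ S R) (hO : O ∈ pieces f S n) {x : ℝ}
    (hx : x ∈ O) : branch f n O (f^[n] x) = x :=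
  (h.injOn_iterate hO).leftInvOn_invFunOn hx

lemma Setting.continuousAt_branch (h : Setting α f τ S R) (hO : O ∈ pieces f S n) {y : ℝ}
    (hy : y ∈ f^[n] '' O) : ContinuousAt (branch f n O) y := by
  intro V hV
  obtain ⟨V', hV'V, hV', hyV'⟩ := mem_nhds_iff.1 hV
  have hmem : f^[n] '' (O ∩ V') ∈ 𝓝 y :=
    (h.isOpen_image hO hV').mem_nhds ⟨_, ⟨branch_mem hy, hyV'⟩, iterate_branch hy⟩
  refine mem_map.2 (mem_of_superset hmem ?_)
  rintro _ ⟨x, hx, rfl⟩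
  rw [mem_preimage, h.branch_iterate hO hx.1]
  exact hV'V hx.2

lemma Setting.hasDerivAt_branch (h : Setting α f τ S R) (hO : O ∈ pieces f S n) {y : ℝ}
    (hy : y ∈ f^[n] '' O) :
    HasDerivAt (branch f n O) (deriv f^[n] (branch f n O y))⁻¹ y := by
  have hr := subset_of_mem_pieces hO (branch_mem hy)
  refine HasDerivAt.of_local_left_inverse (h.continuousAt_branch hO hy) (h.hasDerivAt_iterate hr)
    (h.deriv_iterate_ne_zero hr) ?_
  filter_upwards [(h.isOpen_image_piece hO).mem_nhds hy] with z hz using iterate_branch hz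

lemma Setting.deriv_branch (h : Setting α f τ S R) (hO : O ∈ pieces f S n) {y : ℝ}
    (hy : y ∈ f^[n] '' O) : deriv (branch f n O) y = (deriv f^[n] (branch f n O y))⁻¹ :=
  (h.hasDerivAt_branch hO hy).deriv

lemma Setting.deriv_branch_iterate (h : Setting α f τ S R) (hO : O ∈ pieces f S n) {x : ℝ}
    (hx : x ∈ O) : deriv (branch f n O) (f^[n] x) = (deriv f^[n] x)⁻¹ := by
  rw [h.deriv_branch hO (mem_image_of_mem _ hx), h.branch_iterate hO hx]

lemma Setting.abs_deriv_branch_pos (h : Setting α f τ S R) (hO : O ∈ pieces f S n) {y : ℝ}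
    (hy : y ∈ f^[n] '' O) : 0 < |deriv (branch f n O) y| := by
  rw [h.deriv_branch hO hy]
  exact abs_pos.2 (inv_ne_zero (h.deriv_iterate_ne_zero (subset_of_mem_pieces hO (branch_mem hy))))

lemma Setting.abs_deriv_branch_le (h : Setting α f τ S R) {l : ℝ}
    (hl : ∀ n : ℕ, ∀ x ∈ regularSet f S n, Real.exp (l * n) ≤ |deriv (f^[n]) x|)
    (hO : O ∈ pieces f S n) {y : ℝ} (hy : y ∈ f^[n] '' O) :
    |deriv (branch f n O) y| ≤ Real.exp (-(l * n)) := by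
  rw [h.deriv_branch hO hy, abs_inv, Real.exp_neg]
  exact inv_anti₀ (Real.exp_pos _) (hl n _ (subset_of_mem_pieces hO (branch_mem hy)))

lemma Setting.abs_branch_sub_le (h : Setting α f τ S R) {l : ℝ}
    (hl : ∀ n : ℕ, ∀ x ∈ regularSet f S n, Real.exp (l * n) ≤ |deriv (f^[n]) x|)
    (hO : O ∈ pieces f S n) {x y : ℝ} (hx : x ∈ f^[n] '' O) (hy : y ∈ f^[n] '' O) :
    |branch f n O x - branch f n O y| ≤ Real.exp (-(l * n)) * |x - y| := by
  simpa [Real.norm_eq_abs] using Convex.norm_image_sub_le_of_norm_deriv_le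
    (f := branch f n O) (C := Real.exp (-(l * n)))
    (fun z hz => (h.hasDerivAt_branch hO hz).differentiableAt)
    (fun z hz => h.abs_deriv_branch_le hl hO hz) (h.ordConnected_image_piece hO).convex hy hx

lemma Setting.abs_birkhoffSum_branch_sub_le (h : Setting α f τ S R) {C : ℝ}
    (hC : ∀ n : ℕ, ∀ O ∈ pieces f S n, ∀ x ∈ f^[n] '' O,
      DifferentiableAt ℝ (birkhoffSum f τ n ∘ branch f n O) x ∧
      |deriv (birkhoffSum f τ n ∘ branch f n O) x| ≤ C)
    (hO : O ∈ pieces f S n) {x y : ℝ} (hx : x ∈ f^[n] '' O) (hy : y ∈ f^[n] '' O) :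
    |birkhoffSum f τ n (branch f n O x) - birkhoffSum f τ n (branch f n O y)| ≤ C * |x - y| := by
  simpa [Real.norm_eq_abs] using Convex.norm_image_sub_le_of_norm_deriv_le
    (f := birkhoffSum f τ n ∘ branch f n O) (C := C)
    (fun z hz => (hC n O hO z hz).1)
    (fun z hz => (hC n O hO z hz).2) (h.ordConnected_image_piece hO).convex hy hx

/-- Piecewise regularity of `τ` says nothing at orbit points in `R`. Differentiability there comes
from the assumption on `τ_n ∘ h`, composed with `f^n`. -/
lemma Setting.differentiableAt_birkhoffSum (h : Setting α f τ S R) {x : ℝ}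
    (hx : x ∈ regularSet f S n) : DifferentiableAt ℝ (birkhoffSum f τ n) x := by
  obtain ⟨C, hC⟩ := h.regular
  obtain ⟨O, hO, hxO⟩ := exists_mem_intervalsOf hx
  have h1 := (hC n O hO _ (mem_image_of_mem _ hxO)).1.comp x
    (h.hasDerivAt_iterate hx).differentiableAt
  refine h1.congr_of_eventuallyEq ?_
  filter_upwards [(h.isOpen_of_mem_pieces hO).mem_nhds hxO] with z hz
  simp [h.branch_iterate hO hz]

lemma Setting.deriv_birkhoffSum_branch (h : Setting α f τ S R) (hO : O ∈ pieces f S n) {x : ℝ}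
    (hx : x ∈ O) : HasDerivAt (birkhoffSum f τ n ∘ branch f n O)
      (deriv (birkhoffSum f τ n) x / deriv f^[n] x) (f^[n] x) := by
  have h1 : HasDerivAt (birkhoffSum f τ n) (deriv (birkhoffSum f τ n) x)
      (branch f n O (f^[n] x)) := by
    rw [h.branch_iterate hO hx]
    exact (h.differentiableAt_birkhoffSum (subset_of_mem_pieces hO hx)).hasDerivAt
  have h2 := h.hasDerivAt_branch hO (mem_image_of_mem f^[n] hx)
  rw [h.branch_iterate hO hx] at h2
  simpa [div_eq_mul_inv] using h1.comp _ h2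

end Pieces

lemma Setting.countable_regularSet_inter_preimage (h : Setting α f τ S R) (n : ℕ) {C : Set ℝ}
    (hC : C.Countable) : (regularSet f S n ∩ f^[n] ⁻¹' C).Countable := by
  have : regularSet f S n ∩ f^[n] ⁻¹' C ⊆ ⋃ O ∈ pieces f S n, O ∩ f^[n] ⁻¹' C := by
    rintro x ⟨hx, hxC⟩
    obtain ⟨O, hO, hxO⟩ := exists_mem_intervalsOf hx
    exact mem_biUnion hO ⟨hxO, hxC⟩
  refine Countable.mono this ((h.countable_pieces n).biUnion fun O hO => ?_)
  exact MapsTo.countable_of_injOn (f := f^[n]) (fun x hx => hx.2)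
    ((h.injOn_iterate hO).mono inter_subset_left) hC

end SkewProduct

/-! ### Fibre slopes, and transversality from the absence of a coboundary. -/

namespace SkewProduct

open Filter Topology

variable {α : ℝ≥0} {f τ : ℝ → ℝ} {S R : Set ℝ}

/-- The points whose whole orbit avoids the exceptional sets of `f` and of `τ`. -/
def goodSet (f : ℝ → ℝ) (S R : Set ℝ) : Set ℝ :=
  {p | ∀ j : ℕ, f^[j] p ∈ Ioo (0 : ℝ) 1 \ (S ∪ R)}

/-- The good points all of whose preimages are good. -/
def coreSet (f : ℝ → ℝ) (S R : Set ℝ) : Set ℝ :=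
  {x | x ∈ goodSet f S R ∧ ∀ n : ℕ, x ∉ f^[n] '' (Ico (0 : ℝ) 1 \ goodSet f S R)}

/-- The derivative of `τ_n ∘ h` at `f^n p`, where `h` is the inverse branch through `p`. -/
noncomputable def fiberSlope (f τ : ℝ → ℝ) (n : ℕ) (p : ℝ) : ℝ :=
  deriv (birkhoffSum f τ n) p / deriv f^[n] p

lemma goodSet_subset_Ioo : goodSet f S R ⊆ Ioo (0 : ℝ) 1 := fun _ hp => (hp 0).1

lemma goodSet_subset_regularSet (n : ℕ) : goodSet f S R ⊆ regularSet f S n := fun _ hp =>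
  ⟨(hp 0).1, fun j _ => ⟨(hp j).1, fun hS => (hp j).2 (Or.inl hS)⟩⟩

lemma iterate_mem_goodSet {p : ℝ} (hp : p ∈ goodSet f S R) (n : ℕ) : f^[n] p ∈ goodSet f S R := by
  intro j
  rw [← Function.iterate_add_apply]
  exact hp _

lemma coreSet_subset_goodSet : coreSet f S R ⊆ goodSet f S R := fun _ hx => hx.1

lemma Setting.countable_diff_goodSet (h : Setting α f τ S R) :
    (Ico (0 : ℝ) 1 \ goodSet f S R).Countable := by
  have hbad : (insert 0 (S ∪ R)).Countable := (h.piecewise_f.2.1.union h.piecewise_τ.2.1).insert 0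
  have hsub : Ico (0 : ℝ) 1 \ goodSet f S R ⊆
      insert 0 (⋃ n : ℕ, regularSet f S n ∩ f^[n] ⁻¹' (insert 0 (S ∪ R))) := by
    classical
    rintro x ⟨hx, hxg⟩
    by_cases hx0 : x = 0
    · exact Or.inl hx0
    right
    have hex : ∃ j : ℕ, f^[j] x ∉ Ioo (0 : ℝ) 1 \ (S ∪ R) := by
      by_contra! hcon
      exact hxg hcon
    -- Bad points are sorted by the first bad time: up to then the point is regular, and its image
    -- at that time lies in a countable set.
    refine mem_iUnion.2 ⟨Nat.find hex, ⟨⟨lt_of_le_of_ne hx.1 (Ne.symm hx0), hx.2⟩, ?_⟩, ?_⟩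
    · intro j hj
      have := not_not.1 (Nat.find_min hex hj)
      exact ⟨this.1, fun hS => this.2 (Or.inl hS)⟩
    · have h1 := Nat.find_spec hex
      have h2 := h.mapsTo_iterate (Nat.find hex) hx
      by_contra hcon
      rw [mem_preimage, mem_insert_iff, not_or] at hcon
      exact h1 ⟨⟨lt_of_le_of_ne h2.1 (Ne.symm hcon.1), h2.2⟩, hcon.2⟩
  exact ((countable_iUnion fun n =>
    h.countable_regularSet_inter_preimage n hbad).insert 0).mono hsub

lemma Setting.countable_diff_coreSet (h : Setting α f τ S R) :
    (Ico (0 : ℝ) 1 \ coreSet f S R).Countable := by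
  have hsub : Ico (0 : ℝ) 1 \ coreSet f S R ⊆ (Ico (0 : ℝ) 1 \ goodSet f S R) ∪
      ⋃ n : ℕ, f^[n] '' (Ico (0 : ℝ) 1 \ goodSet f S R) := by
    rintro x ⟨hx, hxc⟩
    by_cases hg : x ∈ goodSet f S R
    · right
      by_contra hcon
      rw [mem_iUnion, not_exists] at hcon
      exact hxc ⟨hg, hcon⟩
    · exact Or.inl ⟨hx, hg⟩
  exact (h.countable_diff_goodSet.union
    (countable_iUnion fun n => h.countable_diff_goodSet.image _)).mono hsub

/-- The reason for the core: it is backward invariant, so every preimage of a core point can be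
used. It need not be forward invariant, whence the separate hypotheses on `f^[n] p` below. -/
lemma mem_coreSet_of_iterate_mem {p : ℝ} (hp : p ∈ Ico (0 : ℝ) 1) {n : ℕ}
    (hn : f^[n] p ∈ coreSet f S R) : p ∈ coreSet f S R := by
  refine ⟨?_, ?_⟩
  · by_contra hg
    exact hn.2 n ⟨p, ⟨hp, hg⟩, rfl⟩
  · rintro m ⟨q, hq, rfl⟩
    refine hn.2 (n + m) ⟨q, hq, ?_⟩
    rw [Function.iterate_add_apply]

lemma exists_mem_Ioo_of_countable_diff {G : Set ℝ} (hG : (Ico (0 : ℝ) 1 \ G).Countable) {p q : ℝ}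
    (hp : 0 ≤ p) (hpq : p < q) (hq : q ≤ 1) : ∃ x ∈ Ioo p q, x ∈ G := by
  by_contra! hcon
  have hsub : Ioo p q ⊆ Ico (0 : ℝ) 1 \ G := fun x hx =>
    ⟨⟨hp.trans hx.1.le, hx.2.trans_le hq⟩, hcon x hx⟩
  have h0 := (hG.mono hsub).measure_zero volume
  rw [Real.volume_Ioo, ENNReal.ofReal_eq_zero] at h0
  linarith

lemma Setting.abs_sub_le_of_mem_pieces (h : Setting α f τ S R) {l : ℝ}
    (hl : ∀ n : ℕ, ∀ x ∈ regularSet f S n, Real.exp (l * n) ≤ |deriv (f^[n]) x|)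
    {n : ℕ} {O : Set ℝ} (hO : O ∈ pieces f S n) {x y : ℝ} (hx : x ∈ O) (hy : y ∈ O) :
    |x - y| ≤ Real.exp (-(l * n)) := by
  have h1 := h.abs_branch_sub_le hl hO (mem_image_of_mem _ hx) (mem_image_of_mem _ hy)
  rw [h.branch_iterate hO hx, h.branch_iterate hO hy] at h1
  have h2 := h.image_subset hO (mem_image_of_mem _ hx)
  have h3 := h.image_subset hO (mem_image_of_mem _ hy)
  have h4 : |f^[n] x - f^[n] y| ≤ 1 := by
    rw [abs_le]; constructor <;> linarith [h2.1, h2.2, h3.1, h3.2]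
  calc |x - y| ≤ _ := h1
    _ ≤ Real.exp (-(l * n)) * 1 := by gcongr
    _ = _ := mul_one _

/-- Pieces of order `1` have diameter at most `e^{-l} < 1/2`, so their covering time is not `0`;
every point is then reached by a last application of `f`. -/
lemma Setting.surjOn (h : Setting α f τ S R) : SurjOn f (Ico (0 : ℝ) 1) (Ico (0 : ℝ) 1) := by
  obtain ⟨l, hl2, hl⟩ := h.expanding
  obtain ⟨x, -, hxg⟩ := exists_mem_Ioo_of_countable_diff h.countable_diff_goodSet
    le_rfl zero_lt_one le_rfl
  obtain ⟨O, hO, hxO⟩ := exists_mem_intervalsOf (goodSet_subset_regularSet 1 hxg)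
  obtain ⟨N, hN⟩ := h.covering 1
  have hNO := hN O hO
  have hdiam : ∀ x ∈ O, ∀ y ∈ O, |x - y| ≤ 1 / 2 := by
    intro x hx y hy
    refine (h.abs_sub_le_of_mem_pieces hl hO hx hy).trans ?_
    have : Real.exp (-(l * (1 : ℕ))) ≤ Real.exp (-Real.log 2) := by
      apply Real.exp_le_exp.2
      simp only [Nat.cast_one, mul_one]
      linarith
    refine this.trans_eq ?_
    rw [Real.exp_neg, Real.exp_log (by norm_num)]
    norm_num
  have hcl : ∀ x ∈ closure O, ∀ y ∈ closure O, |x - y| ≤ 1 / 2 := by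
    intro x hx y hy
    have := closure_minimal (s := O ×ˢ O) (t := {z : ℝ × ℝ | |z.1 - z.2| ≤ 1 / 2})
      (fun z hz => hdiam _ hz.1 _ hz.2) (isClosed_le (by fun_prop) (by fun_prop))
    rw [closure_prod_eq] at this
    exact this (mk_mem_prod hx hy)
  have hsub : O ⊆ Icc 0 1 := (subset_of_mem_pieces hO).trans
    ((regularSet_subset 1).trans Ioo_subset_Icc_self)
  have hcsub : closure O ⊆ Icc 0 1 := closure_minimal hsub isClosed_Icc
  have hfr : ∀ y ∈ Ioo (0 : ℝ) 1, y ∈ Int.fract '' closure O → y ∈ closure O := by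
    rintro _ hy ⟨z, hz, rfl⟩
    have hz1 := hcsub hz
    rcases eq_or_lt_of_le hz1.2 with rfl | hz2
    · simp at hy
    · rwa [Int.fract_eq_self.2 ⟨hz1.1, hz2⟩]
  rcases N with _ | N
  · rw [Function.iterate_zero, image_id] at hNO
    have h1 : (1 / 10 : ℝ) ∈ closure O := hfr _ (by norm_num) (hNO ▸ by norm_num)
    have h2 : (9 / 10 : ℝ) ∈ closure O := hfr _ (by norm_num) (hNO ▸ by norm_num)
    have := hcl _ h2 _ h1
    rw [abs_of_pos (by norm_num)] at this
    norm_num at this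
  · intro y hy
    rw [← hNO] at hy
    obtain ⟨_, ⟨w, hw, rfl⟩, rfl⟩ := hy
    refine ⟨f^[N] (Int.fract w), h.mapsTo_iterate N ⟨Int.fract_nonneg w, Int.fract_lt_one w⟩, ?_⟩
    rw [Function.iterate_succ_apply']

lemma Setting.exists_preimage (h : Setting α f τ S R) (n : ℕ) {x : ℝ} (hx : x ∈ coreSet f S R) :
    ∃ p ∈ coreSet f S R, f^[n] p = x := by
  obtain ⟨p, hp, rfl⟩ := (h.surjOn.iterate n) (Ioo_subset_Ico_self (goodSet_subset_Ioo hx.1))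
  exact ⟨p, mem_coreSet_of_iterate_mem hp hx, rfl⟩

lemma Setting.abs_fiberSlope_le (h : Setting α f τ S R) {C : ℝ}
    (hC : ∀ n : ℕ, ∀ O ∈ pieces f S n, ∀ x ∈ f^[n] '' O,
      DifferentiableAt ℝ (birkhoffSum f τ n ∘ branch f n O) x ∧
      |deriv (birkhoffSum f τ n ∘ branch f n O) x| ≤ C)
    {n : ℕ} {p : ℝ} (hp : p ∈ regularSet f S n) : |fiberSlope f τ n p| ≤ C := by
  obtain ⟨O, hO, hpO⟩ := exists_mem_intervalsOf hp
  have := (hC n O hO _ (mem_image_of_mem _ hpO)).2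
  rwa [(h.deriv_birkhoffSum_branch hO hpO).deriv] at this

/-- The chain rule for `τ_{m+n} = τ_m + τ_n ∘ f^m`. Its use is that the first `m` steps are divided
by the derivative of `f^n`: up to an error exponentially small in `n`, a slope is determined by the
last `n` steps. -/
lemma Setting.fiberSlope_add (h : Setting α f τ S R) (m n : ℕ) {p : ℝ}
    (hp : p ∈ goodSet f S R) :
    fiberSlope f τ (m + n) p =
      fiberSlope f τ m p / deriv f^[n] (f^[m] p) + fiberSlope f τ n (f^[m] p) := by
  have hpm := goodSet_subset_regularSet m hp
  have hpn := goodSet_subset_regularSet n (iterate_mem_goodSet hp m)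
  have e1 : deriv f^[m + n] p = deriv f^[n] (f^[m] p) * deriv f^[m] p := by
    rw [add_comm, Function.iterate_add]
    exact ((h.hasDerivAt_iterate hpn).comp p (h.hasDerivAt_iterate hpm)).deriv
  have e2 : deriv (birkhoffSum f τ (m + n)) p = deriv (birkhoffSum f τ m) p +
      deriv (birkhoffSum f τ n) (f^[m] p) * deriv f^[m] p := by
    have : birkhoffSum f τ (m + n) = fun x =>
        birkhoffSum f τ m x + (birkhoffSum f τ n ∘ f^[m]) x := by
      funext x; exact birkhoffSum_add f τ m n x
    rw [this]
    exact ((h.differentiableAt_birkhoffSum hpm).hasDerivAt.add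
      ((h.differentiableAt_birkhoffSum hpn).hasDerivAt.comp p (h.hasDerivAt_iterate hpm))).deriv
  have n1 := h.deriv_iterate_ne_zero hpm
  have n2 := h.deriv_iterate_ne_zero hpn
  rw [fiberSlope, fiberSlope, fiberSlope, e1, e2]
  field_simp

lemma Setting.contDiffAt_birkhoffSum (h : Setting α f τ S R) (n : ℕ) {p : ℝ}
    (hp : p ∈ goodSet f S R) : ContDiffAt ℝ 1 (birkhoffSum f τ n) p := by
  have : birkhoffSum f τ n = fun x => ∑ k ∈ Finset.range n, (τ ∘ f^[k]) x := rfl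
  rw [this]
  refine ContDiffAt.sum fun k _ => ?_
  refine ContDiffAt.comp p ?_ (h.contDiffAt_iterate (goodSet_subset_regularSet k hp))
  exact h.piecewise_τ.2.2 _ ⟨(hp k).1, fun hR => (hp k).2 (Or.inr hR)⟩

lemma continuousAt_deriv_of_contDiffAt {g : ℝ → ℝ} {x : ℝ} (hg : ContDiffAt ℝ 1 g x) :
    ContinuousAt (deriv g) x := by
  have h1 := (hg.continuousAt_fderiv one_ne_zero).clm_apply
    (continuousAt_const (y := (1 : ℝ)))
  simpa using h1

lemma Setting.continuousAt_fiberSlope (h : Setting α f τ S R) (n : ℕ) {p : ℝ}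
    (hp : p ∈ goodSet f S R) : ContinuousAt (fiberSlope f τ n) p :=
  (continuousAt_deriv_of_contDiffAt (h.contDiffAt_birkhoffSum n hp)).div
    (continuousAt_deriv_of_contDiffAt (h.contDiffAt_iterate (goodSet_subset_regularSet n hp)))
    (h.deriv_iterate_ne_zero (goodSet_subset_regularSet n hp))

/-- If fibre slopes over a common point get uniformly close, they converge to a function. -/
lemma Setting.exists_limit_fiberSlope (h : Setting α f τ S R)
    (H : ∀ c > 0, ∃ n₀ : ℕ, ∀ n ≥ n₀, ∀ p₁ ∈ coreSet f S R, ∀ p₂ ∈ coreSet f S R,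
      f^[n] p₁ = f^[n] p₂ → f^[n] p₁ ∈ coreSet f S R →
        |fiberSlope f τ n p₁ - fiberSlope f τ n p₂| < c) :
    ∃ χ : ℝ → ℝ, ∀ ε > 0, ∃ N : ℕ, ∀ n ≥ N, ∀ p ∈ coreSet f S R, f^[n] p ∈ coreSet f S R →
      |χ (f^[n] p) - fiberSlope f τ n p| ≤ ε := by
  obtain ⟨l, hl2, hl⟩ := h.expanding
  have hl0 : 0 < l := (Real.log_pos (by norm_num)).trans hl2
  obtain ⟨C, hC⟩ := h.regular
  -- One arbitrary core preimage of each order is selected; the estimate `key` shows that the limit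
  -- of the slopes does not depend on the selection.
  choose! pre hpre hfpre using fun n x (hx : x ∈ coreSet f S R) => h.exists_preimage n hx
  have key : ∀ ε > 0, ∃ N : ℕ, ∀ n ≥ N, ∀ m ≥ n, ∀ p ∈ coreSet f S R, f^[n] p ∈ coreSet f S R →
      |fiberSlope f τ m (pre m (f^[n] p)) - fiberSlope f τ n p| ≤ ε := by
    intro ε hε
    obtain ⟨n₀, hn₀⟩ := H (ε / 2) (by positivity)
    have hlim : Tendsto (fun n : ℕ => C * Real.exp (-(l * n))) atTop (𝓝 0) := by
      have : Tendsto (fun n : ℕ => l * (n : ℝ)) atTop atTop :=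
        tendsto_natCast_atTop_atTop.const_mul_atTop hl0
      simpa using (Real.tendsto_exp_neg_atTop_nhds_zero.comp this).const_mul C
    obtain ⟨n₁, hn₁⟩ := eventually_atTop.1 (hlim.eventually_lt_const (half_pos hε))
    refine ⟨max n₀ n₁, fun n hn m hm p hp hx => ?_⟩
    obtain ⟨k, rfl⟩ : ∃ k, m = k + n := ⟨m - n, by omega⟩
    set x := f^[n] p with hxdef
    set q := pre (k + n) x with hq
    have hqW : q ∈ coreSet f S R := hpre _ _ hx
    have hqx : f^[n] (f^[k] q) = x := by
      rw [← Function.iterate_add_apply, add_comm]; exact hfpre _ _ hx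
    have hkq : f^[k] q ∈ coreSet f S R := mem_coreSet_of_iterate_mem (n := n)
      (Ioo_subset_Ico_self (goodSet_subset_Ioo (iterate_mem_goodSet hqW.1 k))) (hqx.symm ▸ hx)
    -- The first `k` steps contribute at most `C e^{-ln}`; the last `n` steps start at another
    -- preimage of `x` of order `n`, to which `H` applies.
    rw [h.fiberSlope_add k n hqW.1]
    have a1 := hn₀ n (le_trans (le_max_left _ _) hn) _ hkq p hp hqx (hqx.symm ▸ hx)
    have a2 : |fiberSlope f τ k q / deriv f^[n] (f^[k] q)| ≤ C * Real.exp (-(l * n)) := by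
      have b1 := h.abs_fiberSlope_le hC (goodSet_subset_regularSet k hqW.1)
      have b2 := hl n _ (goodSet_subset_regularSet n hkq.1)
      rw [abs_div, Real.exp_neg, ← div_eq_mul_inv]
      exact div_le_div₀ ((abs_nonneg _).trans b1) b1 (Real.exp_pos _) b2
    have a3 := hn₁ n (le_trans (le_max_right _ _) hn)
    calc _ = |fiberSlope f τ k q / deriv f^[n] (f^[k] q) +
          (fiberSlope f τ n (f^[k] q) - fiberSlope f τ n p)| := by ring_nf
      _ ≤ _ := abs_add_le _ _
      _ ≤ ε := by linarith
  have hlimx : ∀ x ∈ coreSet f S R, ∃ y, Tendsto (fun m => fiberSlope f τ m (pre m x)) atTop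
      (𝓝 y) := by
    intro x hx
    refine cauchySeq_tendsto_of_complete (Metric.cauchySeq_iff'.2 fun ε hε => ?_)
    obtain ⟨N, hN⟩ := key (ε / 2) (by positivity)
    refine ⟨N, fun m hm => ?_⟩
    have := hN N le_rfl m hm (pre N x) (hpre _ _ hx) (by rwa [hfpre _ _ hx])
    rw [hfpre _ _ hx] at this
    rw [Real.dist_eq]
    linarith
  choose! χ hχ using hlimx
  refine ⟨χ, fun ε hε => ?_⟩
  obtain ⟨N, hN⟩ := key ε hε
  refine ⟨N, fun n hn p hp hx => ?_⟩
  refine le_of_tendsto ((hχ _ hx).sub_const (fiberSlope f τ n p)).abs ?_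
  filter_upwards [eventually_ge_atTop n] with m hm using hN n hn m hm p hp hx

/-- Near `f^[N] p`, the function `χ` is uniformly close to the slope along the single branch through
`p`, which is continuous. -/
lemma Setting.continuousOn_limit_fiberSlope (h : Setting α f τ S R) {χ : ℝ → ℝ}
    (hχ : ∀ ε > 0, ∃ N : ℕ, ∀ n ≥ N, ∀ p ∈ coreSet f S R, f^[n] p ∈ coreSet f S R →
      |χ (f^[n] p) - fiberSlope f τ n p| ≤ ε) : ContinuousOn χ (coreSet f S R) := by
  intro x hx
  refine Metric.continuousWithinAt_iff'.2 fun ε hε => ?_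
  obtain ⟨N, hN⟩ := hχ (ε / 4) (by positivity)
  obtain ⟨p, hp, rfl⟩ := h.exists_preimage N hx
  obtain ⟨O, hO, hpO⟩ := exists_mem_intervalsOf (goodSet_subset_regularSet N hp.1)
  have hcont : ContinuousAt (fiberSlope f τ N ∘ branch f N O) (f^[N] p) := by
    refine ContinuousAt.comp ?_ (h.continuousAt_branch hO (mem_image_of_mem _ hpO))
    rw [h.branch_iterate hO hpO]
    exact h.continuousAt_fiberSlope N hp.1
  have hev := Metric.continuousAt_iff'.1 hcont (ε / 4) (by positivity)
  filter_upwards [nhdsWithin_le_nhds hev, self_mem_nhdsWithin, nhdsWithin_le_nhds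
    ((h.isOpen_image_piece hO).mem_nhds (mem_image_of_mem _ hpO))] with y hy hyW hyO
  obtain ⟨q, hq, rfl⟩ := hyO
  have hqW : q ∈ coreSet f S R := mem_coreSet_of_iterate_mem
    (Ioo_subset_Ico_self (subset_of_mem_pieces hO hq).1) hyW
  have a1 := hN N le_rfl q hqW hyW
  have a2 := hN N le_rfl p hp hx
  simp only [Function.comp_apply, h.branch_iterate hO hq, h.branch_iterate hO hpO,
    Real.dist_eq] at hy
  rw [Real.dist_eq]
  rw [abs_lt] at hy ⊢
  rw [abs_le] at a1 a2
  constructor <;> linarith [a1.1, a1.2, a2.1, a2.2, hy.1, hy.2]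

/-- The cocycle rule for one more step, at `x = f^[N] p`, reads `s_{N+1}(p) = (s_N(p) + τ'(x)) /
f'(x)`; the slopes tend to `χ (f x)` and `χ x` respectively. -/
lemma Setting.limit_fiberSlope_apply (h : Setting α f τ S R) {χ : ℝ → ℝ}
    (hχ : ∀ ε > 0, ∃ N : ℕ, ∀ n ≥ N, ∀ p ∈ coreSet f S R, f^[n] p ∈ coreSet f S R →
      |χ (f^[n] p) - fiberSlope f τ n p| ≤ ε) {x : ℝ} (hx : x ∈ coreSet f S R)
    (hfx : f x ∈ coreSet f S R) : deriv τ x - χ (f x) * deriv f x + χ x = 0 := by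
  have hd : deriv f x ≠ 0 := by
    simpa using h.deriv_iterate_ne_zero (n := 1) (goodSet_subset_regularSet 1 hx.1)
  have hbound : ∀ ε > 0, |deriv τ x - χ (f x) * deriv f x + χ x| ≤ (|deriv f x| + 1) * ε := by
    intro ε hε
    obtain ⟨N, hN⟩ := hχ ε hε
    obtain ⟨p, hp, rfl⟩ := h.exists_preimage N hx
    have e : f^[N + 1] p = f (f^[N] p) := Function.iterate_succ_apply' _ _ _
    have a1 := hN N le_rfl p hp hx
    have a2 := hN (N + 1) (by omega) p hp (e ▸ hfx)
    rw [e, h.fiberSlope_add N 1 hp.1] at a2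
    simp only [Function.iterate_one] at a2
    have e1 : fiberSlope f τ 1 (f^[N] p) = deriv τ (f^[N] p) / deriv f (f^[N] p) := by
      simp [fiberSlope]
    rw [e1] at a2
    set d := deriv f (f^[N] p)
    set s := fiberSlope f τ N p
    set x := f^[N] p
    have e3 : deriv τ x - χ (f x) * d + χ x =
        -(d * (χ (f x) - (s / d + deriv τ x / d))) + (χ x - s) := by
      field_simp
      ring
    rw [e3]
    calc _ ≤ |(-(d * (χ (f x) - (s / d + deriv τ x / d))))| + |χ x - s| := abs_add_le _ _
      _ = |d| * |χ (f x) - (s / d + deriv τ x / d)| + |χ x - s| := by rw [abs_neg, abs_mul]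
      _ ≤ |d| * ε + ε := by gcongr
      _ = _ := by ring
  by_contra hne
  have hpos := abs_pos.2 hne
  have h1 := hbound (|deriv τ x - χ (f x) * deriv f x + χ x| / (2 * (|deriv f x| + 1)))
    (by positivity)
  have : (|deriv f x| + 1) * (|deriv τ x - χ (f x) * deriv f x + χ x| / (2 * (|deriv f x| + 1))) =
      |deriv τ x - χ (f x) * deriv f x + χ x| / 2 := by field_simp
  linarith

lemma Setting.measurableSet_coreSet (h : Setting α f τ S R) : MeasurableSet (coreSet f S R) := by
  have : coreSet f S R = Ico (0 : ℝ) 1 \ (Ico (0 : ℝ) 1 \ coreSet f S R) := by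
    rw [sdiff_sdiff_right_self]
    exact (inter_eq_self_of_subset_right (coreSet_subset_goodSet.trans
      (goodSet_subset_Ioo.trans Ioo_subset_Ico_self))).symm
  rw [this]
  exact measurableSet_Ico.diff h.countable_diff_coreSet.measurableSet

/-- With `φ` a primitive of `χ`, the function `τ - φ ∘ f + φ` is continuous on each joint interval
and has derivative zero off a countable set, so it is constant there. Boundedness of `χ` makes `φ`
Lipschitz. -/
lemma Setting.cohomologous_of_limit (h : Setting α f τ S R) {χ : ℝ → ℝ} {C : ℝ}
    (hC : ∀ x ∈ coreSet f S R, |χ x| ≤ C) (hχc : ContinuousOn χ (coreSet f S R))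
    (hχ : ∀ x ∈ coreSet f S R, f x ∈ coreSet f S R →
      deriv τ x - χ (f x) * deriv f x + χ x = 0) :
    CohomologousToPiecewiseConstant f τ S R := by
  obtain ⟨x₀, -, hx₀⟩ := exists_mem_Ioo_of_countable_diff h.countable_diff_coreSet
    le_rfl zero_lt_one le_rfl
  have hC0 : 0 ≤ C := (abs_nonneg _).trans (hC _ hx₀)
  set χ₀ : ℝ → ℝ := (coreSet f S R).indicator χ with hχ₀
  have hbd : ∀ x, ‖χ₀ x‖ ≤ C := by
    intro x
    by_cases hx : x ∈ coreSet f S R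
    · simpa [hχ₀, hx] using hC x hx
    · simpa [hχ₀, hx] using hC0
  have hmeas : AEStronglyMeasurable χ₀ volume :=
    (aestronglyMeasurable_indicator_iff h.measurableSet_coreSet).2
      (hχc.aestronglyMeasurable h.measurableSet_coreSet)
  have hint : ∀ a b, IntervalIntegrable χ₀ volume a b := fun a b =>
    (intervalIntegrable_const (c := C)).mono_fun hmeas.restrict
      (ae_of_all _ fun x => (hbd x).trans (le_abs_self C))
  set φ : ℝ → ℝ := fun x => ∫ t in (0 : ℝ)..x, χ₀ t with hφ
  have hLip : LipschitzWith C.toNNReal φ := by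
    refine LipschitzWith.of_dist_le_mul fun x y => ?_
    rw [dist_eq_norm, hφ, Real.coe_toNNReal C hC0]
    simp only
    rw [intervalIntegral.integral_interval_sub_left (hint _ _) (hint _ _), Real.dist_eq]
    exact intervalIntegral.norm_integral_le_of_norm_le_const fun t _ => hbd t
  have hderiv : ∀ x ∈ coreSet f S R, HasDerivAt φ (χ x) x := by
    intro x hx
    refine intervalIntegral.integral_hasDerivAt_of_tendsto_ae_right (hint _ _)
      ⟨univ, univ_mem, by simpa using hmeas⟩ ?_
    -- Continuity of `χ` within the core is enough to differentiate the integral, because the core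
    -- has full measure in `(0,1)`.
    have hle : 𝓝 x ⊓ ae volume ≤ 𝓝[coreSet f S R] x := by
      refine le_inf inf_le_left (le_principal_iff.2 ?_)
      have h1 : Ioo (0 : ℝ) 1 ∈ 𝓝 x := isOpen_Ioo.mem_nhds (goodSet_subset_Ioo hx.1)
      have h2 : (Ico (0 : ℝ) 1 \ coreSet f S R)ᶜ ∈ ae (volume : Measure ℝ) :=
        compl_mem_ae_iff.2 (h.countable_diff_coreSet.measure_zero volume)
      refine mem_of_superset (inter_mem_inf h1 h2) ?_
      rintro y ⟨hy1, hy2⟩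
      by_contra hcon
      exact hy2 ⟨Ioo_subset_Ico_self hy1, hcon⟩
    refine ((hχc x hx).mono_left hle).congr' ?_
    have : coreSet f S R ∈ 𝓝 x ⊓ ae volume := hle self_mem_nhdsWithin
    filter_upwards [this] with y hy
    simp [hχ₀, hy]
  refine ⟨φ, fun x => τ x - φ (f x) + φ x, ⟨C.toNNReal, hLip.lipschitzOnWith⟩, ?_,
    fun x _ => by ring⟩
  intro O hO
  obtain ⟨y, hy⟩ := nonempty_of_mem_intervalsOf hO
  refine ⟨τ y - φ (f y) + φ y, fun x hx => ?_⟩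
  have hsub : uIcc y x ⊆ O := (ordConnected_of_mem_intervalsOf hO).uIcc_subset hy hx
  have hOsub := subset_of_mem_intervalsOf hO
  have hτ : ∀ z ∈ O, ContDiffAt ℝ 1 τ z := fun z hz =>
    h.piecewise_τ.2.2 _ ⟨(hOsub hz).1, fun hR => (hOsub hz).2 (Or.inr hR)⟩
  have hreg : ∀ z ∈ O, z ∈ Ioo (0 : ℝ) 1 \ S := fun z hz =>
    ⟨(hOsub hz).1, fun hS => (hOsub hz).2 (Or.inl hS)⟩
  have hf : ∀ z ∈ O, ContDiffAt ℝ 1 f z := fun z hz => h.contDiffAt (hreg z hz)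
  have hcount : ((Ico (0 : ℝ) 1 \ coreSet f S R) ∪
      regularSet f S 1 ∩ f^[1] ⁻¹' (Ico (0 : ℝ) 1 \ coreSet f S R)).Countable :=
    h.countable_diff_coreSet.union (h.countable_regularSet_inter_preimage 1
      h.countable_diff_coreSet)
  have hmain := integral_eq_of_hasDerivAt_off_countable
    (fun x => τ x - φ (f x) + φ x) (fun _ => (0 : ℝ)) (a := y) (b := x) hcount
    (fun z hz => (((hτ z (hsub hz)).continuousAt.sub
      (hLip.continuous.continuousAt.comp (hf z (hsub hz)).continuousAt)).add
        hLip.continuous.continuousAt).continuousWithinAt)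
    (fun z hz => by
      have hzO : z ∈ O := hsub (Ioo_subset_Icc_self hz.1)
      have hzI : z ∈ Ico (0 : ℝ) 1 := Ioo_subset_Ico_self (hOsub hzO).1
      have hzW : z ∈ coreSet f S R := by
        by_contra hcon
        exact hz.2 (Or.inl ⟨hzI, hcon⟩)
      have hfzW : f z ∈ coreSet f S R := by
        by_contra hcon
        exact hz.2 (Or.inr ⟨goodSet_subset_regularSet 1 hzW.1, h.mapsTo hzI, hcon⟩)
      rw [← hχ z hzW hfzW]
      exact ((((hτ z hzO).differentiableAt one_ne_zero).hasDerivAt).sub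
        ((hderiv _ hfzW).comp z ((hf z hzO).differentiableAt one_ne_zero).hasDerivAt)).add
          (hderiv z hzW))
    (by simp)
  simp only [intervalIntegral.integral_zero] at hmain
  linarith

/-- There are pairs of inverse branches of arbitrarily large order with transversal fibre slopes. -/
theorem Setting.exists_transversal (h : Setting α f τ S R) :
    ∃ c > 0, ∀ n₀ : ℕ, ∃ n ≥ n₀, ∃ p₁ ∈ coreSet f S R, ∃ p₂ ∈ coreSet f S R,
      f^[n] p₁ = f^[n] p₂ ∧ f^[n] p₁ ∈ coreSet f S R ∧
      c ≤ |fiberSlope f τ n p₁ - fiberSlope f τ n p₂| := by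
  -- The negation is the uniform closeness of slopes required by `exists_limit_fiberSlope`.
  by_contra! hcon
  obtain ⟨χ, hχ⟩ := h.exists_limit_fiberSlope hcon
  obtain ⟨C, hC⟩ := h.regular
  refine h.not_cohomologous (h.cohomologous_of_limit (C := C + 1) (fun x hx => ?_)
    (h.continuousOn_limit_fiberSlope hχ) fun x hx hfx => h.limit_fiberSlope_apply hχ hx hfx)
  obtain ⟨N, hN⟩ := hχ 1 one_pos
  obtain ⟨p, hp, rfl⟩ := h.exists_preimage N hx
  have a1 := hN N le_rfl p hp hx
  have a2 := h.abs_fiberSlope_le hC (goodSet_subset_regularSet N hp.1)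
  calc |χ (f^[N] p)| = |(χ (f^[N] p) - fiberSlope f τ N p) + fiberSlope f τ N p| := by ring_nf
    _ ≤ _ := abs_add_le _ _
    _ ≤ C + 1 := by linarith

end SkewProduct

/-! ### Transversal pairs inside every interval of a given length. -/

namespace SkewProduct

open Filter Topology

variable {α : ℝ≥0} {f τ : ℝ → ℝ} {S R : Set ℝ}

/-- Covering pulls both starting points back into the piece by `N` steps. By the cocycle rule this
changes each slope by less than `c / 4` once `m` is large, so half of the gap survives. The total
order `N + m` is the same for all pieces of order `k`. -/
lemma Setting.exists_transversal_in_pieces (h : Setting α f τ S R) :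
    ∃ c > 0, ∀ n₀ k : ℕ, ∃ n ≥ n₀, ∀ O ∈ pieces f S k, ∃ y₁ ∈ O, ∃ y₂ ∈ O,
      y₁ ∈ goodSet f S R ∧ y₂ ∈ goodSet f S R ∧ f^[n] y₁ = f^[n] y₂ ∧
      c ≤ fiberSlope f τ n y₁ - fiberSlope f τ n y₂ := by
  obtain ⟨c, hc, H⟩ := h.exists_transversal
  obtain ⟨l, hl2, hl⟩ := h.expanding
  have hl0 : 0 < l := (Real.log_pos (by norm_num)).trans hl2
  obtain ⟨C, hC⟩ := h.regular
  have hlim : Tendsto (fun n : ℕ => C * Real.exp (-(l * n))) atTop (𝓝 0) := by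
    have : Tendsto (fun n : ℕ => l * (n : ℝ)) atTop atTop :=
      tendsto_natCast_atTop_atTop.const_mul_atTop hl0
    simpa using (Real.tendsto_exp_neg_atTop_nhds_zero.comp this).const_mul C
  obtain ⟨n₁, hn₁⟩ := eventually_atTop.1 (hlim.eventually_lt_const (show 0 < c / 4 by positivity))
  refine ⟨c / 2, by positivity, fun n₀ k => ?_⟩
  obtain ⟨N, hN⟩ := h.covering k
  obtain ⟨m, hm, p₁, hp₁, p₂, hp₂, hpp, hpc, hcm⟩ := H (max n₀ n₁)
  have hpc₂ : f^[m] p₂ ∈ coreSet f S R := hpp ▸ hpc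
  have pull : ∀ O ∈ pieces f S k, ∀ p ∈ coreSet f S R, ∃ y ∈ O, y ∈ goodSet f S R ∧
      f^[N] y = p := by
    intro O hO p hp
    have hp' : p ∈ f^[N] '' (Int.fract '' closure O) := by
      rw [hN O hO]; exact Ioo_subset_Ico_self (goodSet_subset_Ioo hp.1)
    obtain ⟨_, ⟨z, hz, rfl⟩, hy⟩ := hp'
    have hyI : Int.fract z ∈ Ico (0 : ℝ) 1 := ⟨Int.fract_nonneg z, Int.fract_lt_one z⟩
    have hyW : Int.fract z ∈ coreSet f S R := mem_coreSet_of_iterate_mem hyI (hy ▸ hp)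
    have hsub : closure O ⊆ Icc 0 1 := closure_minimal ((subset_of_mem_pieces hO).trans
      ((regularSet_subset k).trans Ioo_subset_Icc_self)) isClosed_Icc
    have hzy : Int.fract z = z := by
      refine Int.fract_eq_self.2 ⟨(hsub hz).1, lt_of_le_of_ne (hsub hz).2 ?_⟩
      rintro rfl
      have := goodSet_subset_Ioo hyW.1
      simp at this
    refine ⟨Int.fract z, ?_, hyW.1, hy⟩
    exact mem_of_mem_closure_of_mem_intervalsOf (h.isOpen_regularSet k) hO (hzy.symm ▸ hz)
      (goodSet_subset_regularSet k hyW.1)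
  have close : ∀ y ∈ goodSet f S R, |fiberSlope f τ (N + m) y - fiberSlope f τ m (f^[N] y)| <
      c / 4 := by
    intro y hy
    rw [h.fiberSlope_add N m hy, add_sub_cancel_right, abs_div]
    have b1 := h.abs_fiberSlope_le hC (goodSet_subset_regularSet N hy)
    have b2 := hl m _ (goodSet_subset_regularSet m (iterate_mem_goodSet hy N))
    refine lt_of_le_of_lt (div_le_div₀ ((abs_nonneg _).trans b1) b1 (Real.exp_pos _) b2) ?_
    rw [div_eq_mul_inv, ← Real.exp_neg]
    exact hn₁ m ((le_max_right _ _).trans hm)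
  refine ⟨N + m, by have := (le_max_left n₀ n₁).trans hm; omega, fun O hO => ?_⟩
  obtain ⟨y₁, hy₁O, hy₁, e₁⟩ := pull O hO p₁ hp₁
  obtain ⟨y₂, hy₂O, hy₂, e₂⟩ := pull O hO p₂ hp₂
  have it : ∀ y, f^[N + m] y = f^[m] (f^[N] y) := fun y => by
    rw [add_comm, Function.iterate_add_apply]
  have c₁ := abs_lt.1 (close y₁ hy₁)
  have c₂ := abs_lt.1 (close y₂ hy₂)
  rw [e₁] at c₁
  rw [e₂] at c₂
  -- The two points are exchanged if necessary, to give the difference of slopes a sign.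
  rcases le_abs.1 hcm with h1 | h1
  · refine ⟨y₁, hy₁O, y₂, hy₂O, hy₁, hy₂, ?_, ?_⟩
    · rw [it, it, e₁, e₂, hpp]
    · linarith [c₁.1, c₁.2, c₂.1, c₂.2]
  · refine ⟨y₂, hy₂O, y₁, hy₁O, hy₂, hy₁, ?_, ?_⟩
    · rw [it, it, e₁, e₂, hpp]
    · linarith [c₁.1, c₁.2, c₂.1, c₂.2]

/-- Slopes and branch derivatives are continuous at the common image, so the strict gap persists on
a small interval around it; the mean value inequality integrates it. -/
lemma Setting.exists_local_transversal (h : Setting α f τ S R) {c : ℝ} {n : ℕ}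
    {y₁ y₂ : ℝ} (hy₁ : y₁ ∈ goodSet f S R) (hy₂ : y₂ ∈ goodSet f S R) (heq : f^[n] y₁ = f^[n] y₂)
    (hc : c < fiberSlope f τ n y₁ - fiberSlope f τ n y₂) (hc0 : 0 < c) {V : Set ℝ} (hV : IsOpen V)
    (hyV₁ : y₁ ∈ V) (hyV₂ : y₂ ∈ V) :
    ∃ r > 0, ∃ O₁ ∈ pieces f S n, ∃ O₂ ∈ pieces f S n, O₁ ≠ O₂ ∧ ∃ s t, r ≤ t - s ∧
      Icc s t ⊆ f^[n] '' (O₁ ∩ V) ∧ Icc s t ⊆ f^[n] '' (O₂ ∩ V) ∧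
      (∀ x ∈ Icc s t, r ≤ |deriv (branch f n O₁) x| ∧ r ≤ |deriv (branch f n O₂) x|) ∧
      ∀ x ∈ Icc s t, ∀ y ∈ Icc s t, x ≤ y → c * (y - x) ≤
        (birkhoffSum f τ n (branch f n O₁ y) - birkhoffSum f τ n (branch f n O₂ y)) -
        (birkhoffSum f τ n (branch f n O₁ x) - birkhoffSum f τ n (branch f n O₂ x)) := by
  obtain ⟨O₁, hO₁, hyO₁⟩ := exists_mem_intervalsOf (goodSet_subset_regularSet n hy₁)
  obtain ⟨O₂, hO₂, hyO₂⟩ := exists_mem_intervalsOf (goodSet_subset_regularSet n hy₂)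
  have hne : O₁ ≠ O₂ := by
    rintro rfl
    have := h.injOn_iterate hO₁ hyO₁ hyO₂ heq
    rw [this, sub_self] at hc
    linarith
  set x₀ := f^[n] y₁ with hx₀
  have hslope : ∀ {O y}, O ∈ pieces f S n → y ∈ O → y ∈ goodSet f S R →
      ContinuousAt (fun x => fiberSlope f τ n (branch f n O x)) (f^[n] y) := by
    intro O y hO hyO hy
    refine ContinuousAt.comp (g := fiberSlope f τ n) ?_
      (h.continuousAt_branch hO (mem_image_of_mem _ hyO))
    rw [h.branch_iterate hO hyO]
    exact h.continuousAt_fiberSlope n hy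
  have hder : ∀ {O y}, O ∈ pieces f S n → y ∈ O → y ∈ goodSet f S R →
      ∀ᶠ x in 𝓝 (f^[n] y), |deriv (branch f n O) (f^[n] y)| / 2 ≤ |deriv (branch f n O) x| := by
    intro O y hO hyO hy
    have hcont : ContinuousAt (fun x => |(deriv f^[n] (branch f n O x))⁻¹|) (f^[n] y) := by
      refine (ContinuousAt.inv₀ ?_ ?_).abs
      · refine ContinuousAt.comp (g := deriv f^[n]) ?_
          (h.continuousAt_branch hO (mem_image_of_mem _ hyO))
        rw [h.branch_iterate hO hyO]
        exact continuousAt_deriv_of_contDiffAt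
          (h.contDiffAt_iterate (goodSet_subset_regularSet n hy))
      · exact h.deriv_iterate_ne_zero (subset_of_mem_pieces hO
          (branch_mem (mem_image_of_mem _ hyO)))
    have hpos := h.abs_deriv_branch_pos hO (mem_image_of_mem f^[n] hyO)
    rw [h.deriv_branch hO (mem_image_of_mem f^[n] hyO)] at hpos ⊢
    filter_upwards [hcont.eventually_const_lt (half_lt_self hpos),
      (h.isOpen_image_piece hO).mem_nhds (mem_image_of_mem _ hyO)] with x hx hxO
    rw [h.deriv_branch hO hxO]
    exact hx.le
  have s₁ := hslope hO₁ hyO₁ hy₁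
  have s₂ := hslope hO₂ hyO₂ hy₂
  have d₁ := hder hO₁ hyO₁ hy₁
  have d₂ := hder hO₂ hyO₂ hy₂
  have m₁ : f^[n] '' (O₁ ∩ V) ∈ 𝓝 x₀ :=
    (h.isOpen_image hO₁ hV).mem_nhds (mem_image_of_mem _ ⟨hyO₁, hyV₁⟩)
  have m₂ : f^[n] '' (O₂ ∩ V) ∈ 𝓝 x₀ := by
    rw [heq]
    exact (h.isOpen_image hO₂ hV).mem_nhds (mem_image_of_mem _ ⟨hyO₂, hyV₂⟩)
  rw [← heq] at s₂ d₂
  have hc' : c < fiberSlope f τ n (branch f n O₁ x₀) - fiberSlope f τ n (branch f n O₂ x₀) := by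
    rw [hx₀, h.branch_iterate hO₁ hyO₁, ← hx₀, heq, h.branch_iterate hO₂ hyO₂]
    exact hc
  have hev := ((s₁.sub s₂).eventually_const_lt hc').and (d₁.and (d₂.and (inter_mem m₁ m₂)))
  obtain ⟨ε, hε, hball⟩ := Metric.eventually_nhds_iff.1 hev
  have hin : ∀ x ∈ Icc (x₀ - ε / 2) (x₀ + ε / 2), dist x x₀ < ε := by
    intro x hx
    rw [Real.dist_eq, abs_lt]
    constructor <;> linarith [hx.1, hx.2]
  have hp₁ := h.abs_deriv_branch_pos hO₁ (mem_image_of_mem f^[n] hyO₁)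
  have hp₂ := h.abs_deriv_branch_pos hO₂ (mem_image_of_mem f^[n] hyO₂)
  rw [← heq] at hp₂
  set a₁ := |deriv (branch f n O₁) x₀|
  set a₂ := |deriv (branch f n O₂) x₀|
  have im₁ : ∀ x ∈ Icc (x₀ - ε / 2) (x₀ + ε / 2), x ∈ f^[n] '' (O₁ ∩ V) :=
    fun x hx => (hball (hin x hx)).2.2.2.1
  have im₂ : ∀ x ∈ Icc (x₀ - ε / 2) (x₀ + ε / 2), x ∈ f^[n] '' (O₂ ∩ V) :=
    fun x hx => (hball (hin x hx)).2.2.2.2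
  refine ⟨min ε (min (a₁ / 2) (a₂ / 2)), by positivity, O₁, hO₁, O₂, hO₂, hne,
    x₀ - ε / 2, x₀ + ε / 2, ?_, im₁, im₂, fun x hx => ?_, ?_⟩
  · refine (min_le_left _ _).trans ?_
    linarith
  · have := (hball (hin x hx)).2
    exact ⟨((min_le_right _ _).trans (min_le_left _ _)).trans this.1,
      ((min_le_right _ _).trans (min_le_right _ _)).trans this.2.1⟩
  · have hd : ∀ x ∈ Icc (x₀ - ε / 2) (x₀ + ε / 2), HasDerivAt
        (fun x => birkhoffSum f τ n (branch f n O₁ x) - birkhoffSum f τ n (branch f n O₂ x))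
        (fiberSlope f τ n (branch f n O₁ x) - fiberSlope f τ n (branch f n O₂ x)) x := by
      intro x hx
      have i₁ := image_mono inter_subset_left (im₁ x hx)
      have i₂ := image_mono inter_subset_left (im₂ x hx)
      have e₁ := h.deriv_birkhoffSum_branch hO₁ (branch_mem i₁)
      have e₂ := h.deriv_birkhoffSum_branch hO₂ (branch_mem i₂)
      rw [iterate_branch i₁] at e₁
      rw [iterate_branch i₂] at e₂
      exact e₁.sub e₂
    refine (convex_Icc _ _).mul_sub_le_image_sub_of_le_deriv
      (fun x hx => (hd x hx).continuousAt.continuousWithinAt)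
      (fun x hx => (hd x (interior_subset hx)).differentiableAt.differentiableWithinAt)
      fun x hx => ?_
    rw [(hd x (interior_subset hx)).deriv]
    exact (hball (hin x (interior_subset hx))).1.le

lemma exists_pos_forall_lt {P : ℕ → ℝ → Prop} (hP : ∀ i r r', r' ≤ r → P i r → P i r') (L : ℕ)
    (H : ∀ i < L, ∃ r > 0, P i r) : ∃ r > 0, ∀ i < L, P i r := by
  induction L with
  | zero => exact ⟨1, one_pos, by simp⟩
  | succ L ih =>
    obtain ⟨r₁, hr₁, h₁⟩ := ih fun i hi => H i (by omega)
    obtain ⟨r₂, hr₂, h₂⟩ := H L (by omega)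
    refine ⟨min r₁ r₂, lt_min hr₁ hr₂, fun i hi => ?_⟩
    rcases Nat.lt_succ_iff_lt_or_eq.1 hi with h3 | rfl
    · exact hP _ _ _ (min_le_left _ _) (h₁ i h3)
    · exact hP _ _ _ (min_le_right _ _) h₂

/-- Two branches over a common interval `[s,t]` of length at least `r`, both starting inside
`(p,q)`, whose phases separate at speed at least `c`. -/
def HasTransversalPair (f τ : ℝ → ℝ) (S : Set ℝ) (c : ℝ) (n : ℕ) (p q r : ℝ) : Prop :=
  ∃ O₁ ∈ pieces f S n, ∃ O₂ ∈ pieces f S n, O₁ ≠ O₂ ∧ ∃ s t, r ≤ t - s ∧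
    Icc s t ⊆ f^[n] '' (O₁ ∩ Ioo p q) ∧ Icc s t ⊆ f^[n] '' (O₂ ∩ Ioo p q) ∧
    (∀ x ∈ Icc s t, r ≤ |deriv (branch f n O₁) x| ∧ r ≤ |deriv (branch f n O₂) x|) ∧
    ∀ x ∈ Icc s t, ∀ y ∈ Icc s t, x ≤ y → c * (y - x) ≤
      (birkhoffSum f τ n (branch f n O₁ y) - birkhoffSum f τ n (branch f n O₂ y)) -
      (birkhoffSum f τ n (branch f n O₁ x) - birkhoffSum f τ n (branch f n O₂ x))

lemma HasTransversalPair.mono {c : ℝ} {n : ℕ} {p q r p' q' r' : ℝ}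
    (H : HasTransversalPair f τ S c n p q r) (hp : p' ≤ p) (hq : q ≤ q') (hr : r' ≤ r) :
    HasTransversalPair f τ S c n p' q' r' := by
  obtain ⟨O₁, hO₁, O₂, hO₂, hne, s, t, hst, h1, h2, hd, hs⟩ := H
  have hI := Ioo_subset_Ioo hp hq
  exact ⟨O₁, hO₁, O₂, hO₂, hne, s, t, hr.trans hst,
    h1.trans (image_mono (inter_subset_inter_right _ hI)),
    h2.trans (image_mono (inter_subset_inter_right _ hI)),
    fun x hx => ⟨hr.trans (hd x hx).1, hr.trans (hd x hx).2⟩, hs⟩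

/-- Uniformity in `(p,q)` is a finiteness argument: an interval of length `δ` contains one of `L >
2/δ` equal cells, and `r` is the minimum over the cells. The speed `c` is fixed before `n₀` and `δ`.
-/
theorem Setting.exists_hasTransversalPair (h : Setting α f τ S R) :
    ∃ c > 0, ∀ n₀ : ℕ, ∀ δ > 0, ∃ n ≥ n₀, ∃ r > 0, ∀ p q, 0 ≤ p → q ≤ 1 → δ ≤ q - p →
      HasTransversalPair f τ S c n p q r := by
  obtain ⟨c, hc, H⟩ := h.exists_transversal_in_pieces
  obtain ⟨l, hl2, hl⟩ := h.expanding
  have hl0 : 0 < l := (Real.log_pos (by norm_num)).trans hl2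
  refine ⟨c / 2, by positivity, fun n₀ δ hδ => ?_⟩
  obtain ⟨L, hL⟩ := exists_nat_gt (2 / δ)
  have hL0 : 0 < (L : ℝ) := lt_trans (by positivity) hL
  have hlim : Tendsto (fun k : ℕ => Real.exp (-(l * k))) atTop (𝓝 0) := by
    have : Tendsto (fun n : ℕ => l * (n : ℝ)) atTop atTop :=
      tendsto_natCast_atTop_atTop.const_mul_atTop hl0
    exact Real.tendsto_exp_neg_atTop_nhds_zero.comp this
  obtain ⟨k, hk⟩ := (hlim.eventually_lt_const (show 0 < 1 / (4 * (L : ℝ)) by positivity)).exists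
  obtain ⟨n, hn, Hn⟩ := H n₀ k
  have cell : ∀ i < L, ∃ r > 0,
      HasTransversalPair f τ S (c / 2) n (i / (L : ℝ)) ((i + 1) / (L : ℝ)) r := by
    intro i hi
    have hi1 : ((i : ℝ) + 1) / L ≤ 1 := by
      rw [div_le_one hL0]; exact_mod_cast hi
    have hwid : ((i : ℝ) + 1) / L - i / L = 1 / L := by ring
    have h4 : 1 / (4 * (L : ℝ)) = 1 / L / 4 := by ring
    have hw0 : 0 < 1 / (L : ℝ) := by positivity
    rw [h4] at hk
    set w : ℝ := 1 / L
    have hi0 : 0 ≤ (i : ℝ) / L := by positivity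
    -- A point of the third quarter of the cell: pieces of order `k` are shorter than a quarter
    -- cell, so the one around it stays inside.
    obtain ⟨x, hx, hxg⟩ := exists_mem_Ioo_of_countable_diff h.countable_diff_goodSet
      (p := i / L + w / 2) (q := i / L + w / 2 + w / 4) (by positivity) (by linarith) (by linarith)
    obtain ⟨O, hO, hxO⟩ := exists_mem_intervalsOf (goodSet_subset_regularSet k hxg)
    have hOsub : O ⊆ Ioo (i / (L : ℝ)) ((i + 1) / (L : ℝ)) := by
      intro z hz
      have := abs_le.1 (h.abs_sub_le_of_mem_pieces hl hO hz hxO)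
      constructor <;> linarith [this.1, this.2, hx.1, hx.2]
    obtain ⟨y₁, hy₁O, y₂, hy₂O, hy₁, hy₂, heq, hcy⟩ := Hn O hO
    exact h.exists_local_transversal hy₁ hy₂ heq (by linarith) (by positivity) isOpen_Ioo
      (hOsub hy₁O) (hOsub hy₂O)
  obtain ⟨r, hr, hcell⟩ := exists_pos_forall_lt
    (P := fun i r => HasTransversalPair f τ S (c / 2) n (i / (L : ℝ)) ((i + 1) / (L : ℝ)) r)
    (fun i r r' hr' H => H.mono le_rfl le_rfl hr') L cell
  refine ⟨n, hn, r, hr, fun p q hp hq hpq => ?_⟩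
  have h2L : 2 / (L : ℝ) < δ := by
    rw [div_lt_iff₀ hL0]; rw [div_lt_iff₀ hδ] at hL; linarith
  set i := ⌈p * L⌉₊
  have e1 : p * L ≤ i := Nat.le_ceil _
  have e2 : (i : ℝ) < p * L + 1 := Nat.ceil_lt_add_one (by positivity)
  have e3 : p ≤ i / L := by rwa [le_div_iff₀ hL0]
  have e4 : ((i : ℝ) + 1) / L < q := by
    calc ((i : ℝ) + 1) / L < (p * L + 2) / L := div_lt_div_of_pos_right (by linarith) hL0
      _ = p + 2 / L := by field_simp
      _ ≤ q := by linarith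
  have hiL : i < L := by
    have : ((i : ℝ) + 1) / L < 1 := e4.trans_le hq
    rw [div_lt_one hL0] at this
    have : (i : ℝ) < L := by linarith
    exact_mod_cast this
  exact (hcell i hiL).mono e3 e4.le le_rfl

end SkewProduct

/-! ### Atoms and their countable sums. -/

namespace SkewProduct

open Filter Topology

variable {α : ℝ≥0} {a H H' : ℝ} {I : Set ℝ} {u : ℝ → ℝ} {ω φ : ℝ → ℂ}

/-- A density `u` on an interval `I` which is log-Hölder with constant `a`, together with a phase
`ω` in the unit disc which is Hölder with constant `H`. The complex density is `u * ω`. -/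
structure IsAtom (α : ℝ≥0) (a H : ℝ) (I : Set ℝ) (u : ℝ → ℝ) (ω : ℝ → ℂ) : Prop where
  ordConnected : I.OrdConnected
  subset : I ⊆ Ioo 0 1
  pos : ∀ x ∈ I, 0 < u x
  le_exp_mul : ∀ x ∈ I, ∀ y ∈ I, u x ≤ Real.exp (a * |x - y| ^ (α : ℝ)) * u y
  norm_le_one : ∀ x ∈ I, ‖ω x‖ ≤ 1
  norm_sub_le : ∀ x ∈ I, ∀ y ∈ I, ‖ω x - ω y‖ ≤ H * |x - y| ^ (α : ℝ)

/-- The mass of an atom. -/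
noncomputable def atomMass (I : Set ℝ) (u : ℝ → ℝ) : ℝ≥0∞ := ∫⁻ x in I, ENNReal.ofReal (u x)

/-- The supremum of the density of an atom. -/
noncomputable def atomSup (I : Set ℝ) (u : ℝ → ℝ) : ℝ≥0∞ := ⨆ x ∈ I, ENNReal.ofReal (u x)

/-- The functional on test functions given by the complex density of an atom. -/
noncomputable def atomFunctional (I : Set ℝ) (u : ℝ → ℝ) (ω : ℝ → ℂ) (φ : ℝ → ℂ) : ℂ :=
  ∫ x in I, (u x : ℂ) * ω x * φ x

/-- Measurable functions into the unit disc. -/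
def IsTest (φ : ℝ → ℂ) : Prop := Measurable φ ∧ ∀ x, ‖φ x‖ ≤ 1

/-- The functional `Λ` is a countable sum of atoms of total mass at most `m` and with sum of the
suprema at most `z`. -/
def Decomposes (α : ℝ≥0) (a H : ℝ) (Λ : (ℝ → ℂ) → ℂ) (m z : ℝ≥0∞) : Prop :=
  ∃ (ι : Type) (_ : Countable ι) (I : ι → Set ℝ) (u : ι → ℝ → ℝ) (ω : ι → ℝ → ℂ),
    (∀ i, IsAtom α a H (I i) (u i) (ω i)) ∧ ∑' i, atomMass (I i) (u i) ≤ m ∧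
    ∑' i, atomSup (I i) (u i) ≤ z ∧
    ∀ φ, IsTest φ → HasSum (fun i => atomFunctional (I i) (u i) (ω i) φ) (Λ φ)

namespace IsAtom

lemma mono (hA : IsAtom α a H I u ω) (hH : H ≤ H') : IsAtom α a H' I u ω where
  ordConnected := hA.ordConnected
  subset := hA.subset
  pos := hA.pos
  le_exp_mul := hA.le_exp_mul
  norm_le_one := hA.norm_le_one
  norm_sub_le x hx y hy := (hA.norm_sub_le x hx y hy).trans (by gcongr)

lemma inter (hA : IsAtom α a H I u ω) {J : Set ℝ} (hJ : J.OrdConnected) :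
    IsAtom α a H (I ∩ J) u ω where
  ordConnected := hA.ordConnected.inter hJ
  subset := inter_subset_left.trans hA.subset
  pos x hx := hA.pos x hx.1
  le_exp_mul x hx y hy := hA.le_exp_mul x hx.1 y hy.1
  norm_le_one x hx := hA.norm_le_one x hx.1
  norm_sub_le x hx y hy := hA.norm_sub_le x hx.1 y hy.1

lemma measurableSet (hA : IsAtom α a H I u ω) : MeasurableSet I := hA.ordConnected.measurableSet

lemma rpow_abs_sub_le_one (hA : IsAtom α a H I u ω) {x y : ℝ} (hx : x ∈ I) (hy : y ∈ I) :
    |x - y| ^ (α : ℝ) ≤ 1 := by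
  refine Real.rpow_le_one (abs_nonneg _) ?_ α.2
  have h1 := hA.subset hx
  have h2 := hA.subset hy
  rw [abs_le]
  constructor <;> linarith [h1.1, h1.2, h2.1, h2.2]

lemma le_exp (hA : IsAtom α a H I u ω) (ha : 0 ≤ a) {x y : ℝ} (hx : x ∈ I) (hy : y ∈ I) :
    u x ≤ Real.exp a * u y := by
  refine (hA.le_exp_mul x hx y hy).trans ?_
  have := hA.pos y hy
  have h1 := hA.rpow_abs_sub_le_one hx hy
  gcongr
  nlinarith

lemma tendsto_rpow_abs_sub (hα : 0 < α) (y : ℝ) :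
    Tendsto (fun x : ℝ => |x - y| ^ (α : ℝ)) (𝓝 y) (𝓝 0) := by
  have : Continuous fun x : ℝ => |x - y| ^ (α : ℝ) :=
    (continuous_id.sub continuous_const).abs.rpow_const fun _ => Or.inr α.2
  simpa [Real.zero_rpow (NNReal.coe_ne_zero.2 hα.ne')] using this.tendsto y

lemma continuousOn_density (hA : IsAtom α a H I u ω) (hα : 0 < α) : ContinuousOn u I := by
  intro y hy
  have h1 : Tendsto (fun x : ℝ => Real.exp (a * |x - y| ^ (α : ℝ)) * u y) (𝓝[I] y) (𝓝 (u y)) := by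
    have := (((Real.continuous_exp.tendsto _).comp
      ((tendsto_rpow_abs_sub hα y).const_mul a)).mul_const (u y)).mono_left
      (nhdsWithin_le_nhds (s := I))
    simpa using this
  have h2 : Tendsto (fun x : ℝ => Real.exp (-(a * |x - y| ^ (α : ℝ))) * u y) (𝓝[I] y)
      (𝓝 (u y)) := by
    have := (((Real.continuous_exp.tendsto _).comp
      ((tendsto_rpow_abs_sub hα y).const_mul a).neg).mul_const (u y)).mono_left
      (nhdsWithin_le_nhds (s := I))
    simpa using this
  refine tendsto_of_tendsto_of_tendsto_of_le_of_le' h2 h1 ?_ ?_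
  · filter_upwards [self_mem_nhdsWithin] with x hx
    have := hA.le_exp_mul y hy x hx
    rw [abs_sub_comm] at this
    rw [Real.exp_neg, inv_mul_le_iff₀ (Real.exp_pos _)]
    exact this
  · filter_upwards [self_mem_nhdsWithin] with x hx using hA.le_exp_mul x hx y hy

lemma continuousOn_phase (hA : IsAtom α a H I u ω) (hα : 0 < α) : ContinuousOn ω I := by
  intro y hy
  rw [ContinuousWithinAt, tendsto_iff_norm_sub_tendsto_zero]
  have h1 := ((tendsto_rpow_abs_sub hα y).const_mul H).mono_left (nhdsWithin_le_nhds (s := I))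
  rw [mul_zero] at h1
  refine tendsto_of_tendsto_of_tendsto_of_le_of_le' tendsto_const_nhds h1
    (Eventually.of_forall fun _ => norm_nonneg _) ?_
  filter_upwards [self_mem_nhdsWithin] with x hx using hA.norm_sub_le x hx y hy

lemma volume_lt_top (hA : IsAtom α a H I u ω) : volume I < ∞ :=
  (measure_mono hA.subset).trans_lt (by simp)

lemma atomMass_lt_top (hA : IsAtom α a H I u ω) (ha : 0 ≤ a) : atomMass I u < ∞ := by
  rcases I.eq_empty_or_nonempty with rfl | ⟨y, hy⟩
  · simp [atomMass]
  · calc atomMass I u ≤ ∫⁻ _ in I, ENNReal.ofReal (Real.exp a * u y) :=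
        setLIntegral_mono measurable_const fun x hx => ENNReal.ofReal_le_ofReal (hA.le_exp ha hx hy)
      _ < ∞ := by
        rw [setLIntegral_const]
        exact ENNReal.mul_lt_top ENNReal.ofReal_lt_top hA.volume_lt_top

lemma enorm_le (hA : IsAtom α a H I u ω) (hφ : IsTest φ) {x : ℝ} (hx : x ∈ I) :
    ‖(u x : ℂ) * ω x * φ x‖ₑ ≤ ENNReal.ofReal (u x) := by
  rw [← ofReal_norm]
  refine ENNReal.ofReal_le_ofReal ?_
  have h1 := hA.norm_le_one x hx
  have h2 := hφ.2 x
  have h3 := (hA.pos x hx).le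
  rw [norm_mul, norm_mul, Complex.norm_real, Real.norm_of_nonneg h3]
  calc u x * ‖ω x‖ * ‖φ x‖ ≤ u x * 1 * 1 := by gcongr
    _ = u x := by ring

lemma integrableOn (hA : IsAtom α a H I u ω) (hα : 0 < α) (ha : 0 ≤ a) (hφ : IsTest φ) :
    IntegrableOn (fun x => (u x : ℂ) * ω x * φ x) I := by
  refine ⟨?_, ?_⟩
  · exact ((Complex.continuous_ofReal.comp_continuousOn (hA.continuousOn_density hα)).mul
      (hA.continuousOn_phase hα)).aestronglyMeasurable hA.measurableSet |>.mul
      hφ.1.aestronglyMeasurable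
  · refine lt_of_le_of_lt ?_ (hA.atomMass_lt_top ha)
    exact setLIntegral_mono' hA.measurableSet fun x hx => hA.enorm_le hφ hx

lemma norm_atomFunctional_le (hA : IsAtom α a H I u ω) (ha : 0 ≤ a) (hφ : IsTest φ) :
    ‖atomFunctional I u ω φ‖ ≤ (atomMass I u).toReal := by
  rw [← toReal_enorm]
  refine ENNReal.toReal_mono (hA.atomMass_lt_top ha).ne ?_
  refine (enorm_integral_le_lintegral_enorm _).trans ?_
  exact setLIntegral_mono' hA.measurableSet fun x hx => hA.enorm_le hφ hx

/-- Short atoms are controlled through this inequality: their mass is a small multiple of the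
supremum. -/
lemma atomMass_le (hA : IsAtom α a H I u ω) : atomMass I u ≤ volume I * atomSup I u := by
  calc atomMass I u ≤ ∫⁻ _ in I, atomSup I u :=
        setLIntegral_mono' hA.measurableSet fun x hx => le_biSup (fun x => ENNReal.ofReal (u x)) hx
    _ = _ := by rw [setLIntegral_const, mul_comm]

/-- The converse, up to `e^a`. It trades the supremum for mass on intervals whose length is bounded
below. -/
lemma volume_mul_le (hA : IsAtom α a H I u ω) (ha : 0 ≤ a) {x : ℝ} (hx : x ∈ I) :
    ENNReal.ofReal (u x) * volume I ≤ ENNReal.ofReal (Real.exp a) * atomMass I u := by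
  rw [atomMass, ← lintegral_const_mul' _ _ ENNReal.ofReal_ne_top, ← setLIntegral_const]
  refine setLIntegral_mono' hA.measurableSet fun y hy => ?_
  rw [← ENNReal.ofReal_mul (Real.exp_pos _).le]
  exact ENNReal.ofReal_le_ofReal (hA.le_exp ha hx hy)

end IsAtom

lemma atomSup_mono {J : Set ℝ} (hJ : J ⊆ I) : atomSup J u ≤ atomSup I u :=
  biSup_mono fun _ hx => hJ hx

namespace Decomposes

variable {Λ Λ' : (ℝ → ℂ) → ℂ} {m m' z z' : ℝ≥0∞}

lemma mono (hΛ : Decomposes α a H Λ m z) (hH : H ≤ H') (hm : m ≤ m') (hz : z ≤ z') :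
    Decomposes α a H' Λ m' z' := by
  obtain ⟨ι, hι, I, u, ω, hA, h1, h2, h3⟩ := hΛ
  exact ⟨ι, hι, I, u, ω, fun i => (hA i).mono hH, h1.trans hm, h2.trans hz, h3⟩

lemma congr (hΛ : Decomposes α a H Λ m z) (h : ∀ φ, IsTest φ → Λ φ = Λ' φ) :
    Decomposes α a H Λ' m z := by
  obtain ⟨ι, hι, I, u, ω, hA, h1, h2, h3⟩ := hΛ
  exact ⟨ι, hι, I, u, ω, hA, h1, h2, fun φ hφ => h φ hφ ▸ h3 φ hφ⟩

lemma of_isAtom (hA : IsAtom α a H I u ω) :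
    Decomposes α a H (atomFunctional I u ω) (atomMass I u) (atomSup I u) :=
  ⟨Unit, inferInstance, fun _ => I, fun _ => u, fun _ => ω, fun _ => hA, by simp, by simp,
    fun φ _ => hasSum_unique (fun _ : Unit => atomFunctional I u ω φ)⟩

lemma norm_le (ha : 0 ≤ a) (hΛ : Decomposes α a H Λ m z) (hm : m ≠ ∞) (hφ : IsTest φ) :
    ‖Λ φ‖ ≤ m.toReal := by
  obtain ⟨ι, hι, I, u, ω, hA, h1, h2, h3⟩ := hΛ
  have hne : ∑' i, atomMass (I i) (u i) ≠ ∞ := (h1.trans_lt hm.lt_top).ne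
  have hs := ENNReal.hasSum_toReal hne
  rw [← (h3 φ hφ).tsum_eq]
  refine (tsum_of_norm_bounded hs fun i => (hA i).norm_atomFunctional_le ha hφ).trans ?_
  rw [← ENNReal.tsum_toReal_eq fun i => ((hA i).atomMass_lt_top ha).ne]
  exact ENNReal.toReal_mono hm h1

lemma tsum (ha : 0 ≤ a) {κ : Type} [Countable κ] {Λk : κ → (ℝ → ℂ) → ℂ} {mk zk : κ → ℝ≥0∞}
    (hk : ∀ k, Decomposes α a H (Λk k) (mk k) (zk k))
    (hsum : ∀ φ, IsTest φ → HasSum (fun k => Λk k φ) (Λ φ))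
    (hm : ∑' k, mk k ≤ m) (hm' : m ≠ ∞) (hz : ∑' k, zk k ≤ z) : Decomposes α a H Λ m z := by
  choose ι hι I u ω hA h1 h2 h3 using hk
  have hmass : ∑' i : Σ k, ι k, atomMass (I i.1 i.2) (u i.1 i.2) ≤ m := by
    rw [ENNReal.tsum_sigma']
    exact (ENNReal.tsum_le_tsum h1).trans hm
  refine ⟨Σ k, ι k, inferInstance, fun i => I i.1 i.2, fun i => u i.1 i.2, fun i => ω i.1 i.2,
    fun i => hA i.1 i.2, hmass, ?_, fun φ hφ => ?_⟩
  · rw [ENNReal.tsum_sigma']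
    exact (ENNReal.tsum_le_tsum h2).trans hz
  -- Finite total mass makes the double series absolutely summable, so it can be summed in either
  -- order.
  · have hs : Summable fun i : Σ k, ι k => atomFunctional (I i.1 i.2) (u i.1 i.2) (ω i.1 i.2) φ :=
      Summable.of_norm_bounded (ENNReal.summable_toReal (hmass.trans_lt hm'.lt_top).ne)
        fun i => (hA i.1 i.2).norm_atomFunctional_le ha hφ
    have h4 := hs.hasSum.sigma fun k => h3 k φ hφ
    rw [← h4.unique (hsum φ hφ)]
    exact hs.hasSum

lemma add (ha : 0 ≤ a) (h : Decomposes α a H Λ m z) (h' : Decomposes α a H Λ' m' z')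
    (hm : m ≠ ∞) (hm' : m' ≠ ∞) :
    Decomposes α a H (fun φ => Λ φ + Λ' φ) (m + m') (z + z') := by
  refine tsum ha (κ := Bool) (Λk := fun k => cond k Λ Λ') (mk := fun k => cond k m m')
    (zk := fun k => cond k z z') (fun k => by cases k <;> assumption) (fun φ _ => ?_)
    (by simp) (by simp [hm, hm']) (by simp)
  have := hasSum_fintype fun k : Bool => (cond k Λ Λ') φ
  simpa [add_comm] using this

/-- If every atom of a decomposition of `Λ` can be decomposed after applying `T` to the test
functions, so can `Λ`. -/
lemma bind (ha : 0 ≤ a) {T : (ℝ → ℂ) → ℝ → ℂ} (hT : ∀ φ, IsTest φ → IsTest (T φ))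
    (hΛ : Decomposes α a H Λ m z) {M Z : Set ℝ → (ℝ → ℝ) → ℝ≥0∞}
    (hA : ∀ I u ω, IsAtom α a H I u ω →
      Decomposes α a H' (fun φ => atomFunctional I u ω (T φ)) (M I u) (Z I u))
    (hm' : m' ≠ ∞)
    (hsum : ∀ (ι : Type) (_ : Countable ι) (I : ι → Set ℝ) (u : ι → ℝ → ℝ) (ω : ι → ℝ → ℂ),
      (∀ i, IsAtom α a H (I i) (u i) (ω i)) → ∑' i, atomMass (I i) (u i) ≤ m →
      ∑' i, atomSup (I i) (u i) ≤ z →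
      ∑' i, M (I i) (u i) ≤ m' ∧ ∑' i, Z (I i) (u i) ≤ z') :
    Decomposes α a H' (fun φ => Λ (T φ)) m' z' := by
  obtain ⟨ι, hι, I, u, ω, hA', h1, h2, h3⟩ := hΛ
  have := hsum ι hι I u ω hA' h1 h2
  exact tsum ha (fun i => hA _ _ _ (hA' i)) (fun φ hφ => h3 _ (hT φ hφ)) this.1 hm' this.2

end Decomposes

end SkewProduct

/-! ### The dual operator and the transport of atoms along branches. -/

namespace SkewProduct

open Filter Topology

variable {α : ℝ≥0} {f τ : ℝ → ℝ} {S R : Set ℝ} {l D C a : ℝ}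

/-- Explicit constants for the standing assumptions; `a` is a log-Hölder constant preserved by the
transfer operator. -/
structure UniformBounds (α : ℝ≥0) (f τ : ℝ → ℝ) (S R : Set ℝ) (l D C a : ℝ) : Prop where
  setting : Setting α f τ S R
  exponent_pos : 0 < α
  exponent_le_one : α ≤ 1
  log_two_lt : Real.log 2 < l
  expanding : ∀ n : ℕ, ∀ x ∈ regularSet f S n, Real.exp (l * n) ≤ |deriv (f^[n]) x|
  distortion_nonneg : 0 ≤ D
  distortion : ∀ n : ℕ, ∀ O ∈ pieces f S n, ∀ x ∈ f^[n] '' O, ∀ y ∈ f^[n] '' O,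
    |deriv (branch f n O) x| / |deriv (branch f n O) y| ≤ Real.exp (D * |x - y| ^ (α : ℝ))
  slope_nonneg : 0 ≤ C
  slope : ∀ n : ℕ, ∀ O ∈ pieces f S n, ∀ x ∈ f^[n] '' O,
    DifferentiableAt ℝ (birkhoffSum f τ n ∘ branch f n O) x ∧
    |deriv (birkhoffSum f τ n ∘ branch f n O) x| ≤ C
  holder_nonneg : 0 ≤ a
  holder : a * Real.exp (-l) ^ (α : ℝ) + D ≤ a

lemma UniformBounds.log_pos (B : UniformBounds α f τ S R l D C a) : 0 < l :=
  (Real.log_pos (by norm_num)).trans B.log_two_lt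

lemma UniformBounds.rate_lt_one (B : UniformBounds α f τ S R l D C a) :
    Real.exp (-l) ^ (α : ℝ) < 1 :=
  Real.rpow_lt_one (Real.exp_pos _).le (Real.exp_lt_one_iff.2 (neg_lt_zero.2 B.log_pos))
    B.exponent_pos

lemma Setting.exists_uniformBounds (h : Setting α f τ S R) (hα : 0 < α) (hα₁ : α ≤ 1) :
    ∃ l D C a, UniformBounds α f τ S R l D C a := by
  obtain ⟨l, hl2, hl⟩ := h.expanding
  obtain ⟨D, hD, hd⟩ := h.distortion
  obtain ⟨C, hC⟩ := h.regular
  have hl0 : 0 < l := (Real.log_pos (by norm_num)).trans hl2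
  have hρ : Real.exp (-l) ^ (α : ℝ) < 1 :=
    Real.rpow_lt_one (Real.exp_pos _).le (Real.exp_lt_one_iff.2 (neg_lt_zero.2 hl0)) hα
  -- The constant `a` is the fixed point of `a ↦ ρ a + D` with `ρ = e^{-lα}`.
  refine ⟨l, D, |C|, D / (1 - Real.exp (-l) ^ (α : ℝ)), h, hα, hα₁, hl2, hl, hD, hd, abs_nonneg _,
    fun n O hO x hx => ⟨(hC n O hO x hx).1, (hC n O hO x hx).2.trans (le_abs_self C)⟩,
    div_nonneg hD (by linarith), ?_⟩
  have : 1 - Real.exp (-l) ^ (α : ℝ) ≠ 0 := by linarith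
  apply le_of_eq
  field_simp
  ring

/-- The dual of the twisted transfer operator. -/
noncomputable def twist (f τ : ℝ → ℝ) (S : Set ℝ) (b : ℝ) (n : ℕ) (φ : ℝ → ℂ) : ℝ → ℂ :=
  (regularSet f S n).indicator fun x =>
    Complex.exp (Complex.I * b * birkhoffSum f τ n x) * φ (f^[n] x)

lemma norm_exp_I_mul_mul (b t : ℝ) : ‖Complex.exp (Complex.I * b * t)‖ = 1 := by
  have : Complex.I * b * t = ((b * t : ℝ) : ℂ) * Complex.I := by push_cast; ring
  rw [this, Complex.norm_exp_ofReal_mul_I]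

lemma norm_exp_I_mul_mul_sub_le (b s t : ℝ) :
    ‖Complex.exp (Complex.I * b * s) - Complex.exp (Complex.I * b * t)‖ ≤ |b| * |s - t| := by
  have e : Complex.exp (Complex.I * b * s) - Complex.exp (Complex.I * b * t) =
      Complex.exp (Complex.I * b * t) *
        (Complex.exp (Complex.I * (b * (s - t) : ℝ)) - 1) := by
    rw [mul_sub, mul_one, ← Complex.exp_add]
    push_cast
    ring_nf
  rw [e, norm_mul, norm_exp_I_mul_mul, one_mul, ← abs_mul, ← Real.norm_eq_abs]
  exact Real.norm_exp_I_mul_ofReal_sub_one_le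

/-- Interpolation between the Lipschitz bound and the trivial bound `2`. It yields a Hölder constant
of order `|b|^α` instead of `|b|`, matching blocks of length of order `1 / |b|`. -/
lemma norm_exp_I_mul_mul_sub_le_rpow (hα : 0 < α) (hα₁ : α ≤ 1) (b s t : ℝ) :
    ‖Complex.exp (Complex.I * b * s) - Complex.exp (Complex.I * b * t)‖ ≤
      2 * (|b| * |s - t|) ^ (α : ℝ) := by
  have hα' : (0 : ℝ) < α := hα
  have hα₁' : (α : ℝ) ≤ 1 := hα₁
  have h0 : 0 ≤ |b| * |s - t| := by positivity
  rcases le_total (|b| * |s - t|) 1 with h1 | h1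
  · have h2 := Real.rpow_le_rpow_of_exponent_ge' h0 h1 hα'.le hα₁'
    rw [Real.rpow_one] at h2
    linarith [norm_exp_I_mul_mul_sub_le b s t]
  · have h2 := Real.one_le_rpow h1 hα'.le
    have h3 := norm_sub_le (Complex.exp (Complex.I * b * s)) (Complex.exp (Complex.I * b * t))
    rw [norm_exp_I_mul_mul, norm_exp_I_mul_mul] at h3
    linarith

lemma IsTest.twist (h : Setting α f τ S R) {φ : ℝ → ℂ} (hφ : IsTest φ) (b : ℝ) (n : ℕ) :
    IsTest (twist f τ S b n φ) := by
  classical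
  refine ⟨?_, fun x => ?_⟩
  · have hm := (h.isOpen_regularSet n).measurableSet
    have e1 : Measurable ((regularSet f S n).indicator fun x =>
        Complex.exp (Complex.I * b * birkhoffSum f τ n x)) := by
      rw [← piecewise_eq_indicator]
      refine ContinuousOn.measurable_piecewise ?_ continuous_zero.continuousOn hm
      intro x hx
      have := (h.differentiableAt_birkhoffSum hx).continuousAt
      exact ContinuousAt.continuousWithinAt (by fun_prop)
    have e2 : Measurable ((regularSet f S n).indicator f^[n]) := by
      rw [← piecewise_eq_indicator]
      exact ContinuousOn.measurable_piecewise (fun x hx =>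
        (h.contDiffAt_iterate hx).continuousAt.continuousWithinAt) continuous_zero.continuousOn hm
    have e3 := e1.mul (hφ.1.comp e2)
    convert e3 using 1
    funext x
    by_cases hx : x ∈ regularSet f S n <;> simp [SkewProduct.twist, hx]
  · unfold SkewProduct.twist
    by_cases hx : x ∈ regularSet f S n
    · rw [indicator_of_mem hx, norm_mul, norm_exp_I_mul_mul, one_mul]
      exact hφ.2 _
    · rw [indicator_of_notMem hx, norm_zero]
      exact zero_le_one

lemma iterate_mem_regularSet_iff (h : Setting α f τ S R) {m n : ℕ} {x : ℝ}
    (hx : x ∈ regularSet f S m) : f^[m] x ∈ regularSet f S n ↔ x ∈ regularSet f S (m + n) := by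
  constructor
  · rintro ⟨-, h2⟩
    refine ⟨hx.1, fun j hj => ?_⟩
    by_cases hjm : j < m
    · exact hx.2 j hjm
    · obtain ⟨k, rfl⟩ := Nat.exists_eq_add_of_le (not_lt.1 hjm)
      rw [add_comm, Function.iterate_add_apply]
      exact h2 k (by omega)
  · rintro ⟨-, h2⟩
    obtain ⟨O, hO, hxO⟩ := exists_mem_intervalsOf hx
    refine ⟨h.image_subset hO (mem_image_of_mem _ hxO), fun j hj => ?_⟩
    rw [← Function.iterate_add_apply]
    exact h2 _ (by omega)

lemma twist_twist (h : Setting α f τ S R) (b : ℝ) (m n : ℕ) (φ : ℝ → ℂ) :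
    twist f τ S b m (twist f τ S b n φ) = twist f τ S b (m + n) φ := by
  funext x
  by_cases hx : x ∈ regularSet f S m
  · by_cases hxn : x ∈ regularSet f S (m + n)
    · have hx' := (iterate_mem_regularSet_iff h hx).2 hxn
      simp only [twist, indicator_of_mem hx, indicator_of_mem hxn, indicator_of_mem hx']
      rw [← mul_assoc, ← Complex.exp_add, birkhoffSum_add, ← Function.iterate_add_apply,
        add_comm n m]
      push_cast
      ring_nf
    · have hx' := fun hcon => hxn ((iterate_mem_regularSet_iff h hx).1 hcon)
      simp only [twist, indicator_of_mem hx, indicator_of_notMem hxn, indicator_of_notMem hx',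
        mul_zero]
  · have hxn : x ∉ regularSet f S (m + n) := fun hcon =>
      hx ⟨hcon.1, fun j hj => hcon.2 j (by omega)⟩
    simp only [twist, indicator_of_notMem hx, indicator_of_notMem hxn]

/-- The density of an atom transported by the branch of `f^n` on the piece `O`. -/
noncomputable def pushDensity (f : ℝ → ℝ) (n : ℕ) (O : Set ℝ) (u : ℝ → ℝ) (x : ℝ) : ℝ :=
  u (branch f n O x) * |deriv (branch f n O) x|

/-- The phase of an atom transported by the branch of `f^n` on the piece `O`. -/
noncomputable def pushPhase (f τ : ℝ → ℝ) (b : ℝ) (n : ℕ) (O : Set ℝ) (ω : ℝ → ℂ) (x : ℝ) : ℂ :=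
  Complex.exp (Complex.I * b * birkhoffSum f τ n (branch f n O x)) * ω (branch f n O x)

variable {H b : ℝ} {I O : Set ℝ} {u : ℝ → ℝ} {ω : ℝ → ℂ} {n : ℕ}

lemma mem_of_mem_image_inter {x : ℝ} (h : Setting α f τ S R) (hO : O ∈ pieces f S n)
    (hx : x ∈ f^[n] '' (O ∩ I)) : x ∈ f^[n] '' O ∧ branch f n O x ∈ I := by
  obtain ⟨y, hy, rfl⟩ := hx
  refine ⟨mem_image_of_mem _ hy.1, ?_⟩
  rw [h.branch_iterate hO hy.1]
  exact hy.2

lemma UniformBounds.rpow_abs_branch_sub_le (B : UniformBounds α f τ S R l D C a)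
    (hO : O ∈ pieces f S n) {x y : ℝ} (hx : x ∈ f^[n] '' O) (hy : y ∈ f^[n] '' O) :
    |branch f n O x - branch f n O y| ^ (α : ℝ) ≤
      (Real.exp (-l) ^ (α : ℝ)) ^ n * |x - y| ^ (α : ℝ) := by
  have h1 := B.setting.abs_branch_sub_le B.expanding hO hx hy
  have h2 : Real.exp (-(l * n)) = Real.exp (-l) ^ n := by
    rw [← Real.exp_nat_mul]; ring_nf
  rw [h2] at h1
  calc _ ≤ (Real.exp (-l) ^ n * |x - y|) ^ (α : ℝ) :=
        Real.rpow_le_rpow (abs_nonneg _) h1 α.2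
    _ = _ := by
      rw [Real.mul_rpow (by positivity) (abs_nonneg _), ← Real.rpow_natCast, ← Real.rpow_natCast,
        ← Real.rpow_mul (Real.exp_pos _).le, ← Real.rpow_mul (Real.exp_pos _).le, mul_comm (n : ℝ)]

/-- The density inherits `a ρ^n` from `u` and `D` from distortion, together at most `a` because `n ≥
1`. The phase inherits `ρ^n H` from `ω` and the second term from `e^{ibτ_n ∘ h}`. -/
lemma UniformBounds.isAtom_push (B : UniformBounds α f τ S R l D C a)
    (hA : IsAtom α a H I u ω) (hH : 0 ≤ H) (hn : 1 ≤ n) (hO : O ∈ pieces f S n) (b : ℝ) :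
    IsAtom α a ((Real.exp (-l) ^ (α : ℝ)) ^ n * H + 2 * (C * |b|) ^ (α : ℝ))
      (f^[n] '' (O ∩ I)) (pushDensity f n O u) (pushPhase f τ b n O ω) where
  ordConnected := B.setting.ordConnected_image hO hA.ordConnected
  subset := (image_mono inter_subset_left).trans (B.setting.image_subset hO)
  pos x hx := by
    obtain ⟨h1, h2⟩ := mem_of_mem_image_inter B.setting hO hx
    exact mul_pos (hA.pos _ h2) (B.setting.abs_deriv_branch_pos hO h1)
  le_exp_mul x hx y hy := by
    obtain ⟨hx1, hx2⟩ := mem_of_mem_image_inter B.setting hO hx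
    obtain ⟨hy1, hy2⟩ := mem_of_mem_image_inter B.setting hO hy
    have h1 := hA.le_exp_mul _ hx2 _ hy2
    have h2 := B.distortion n O hO x hx1 y hy1
    have hpy := B.setting.abs_deriv_branch_pos hO hy1
    rw [div_le_iff₀ hpy] at h2
    have h3 := B.rpow_abs_branch_sub_le hO hx1 hy1
    have h0 : 0 ≤ Real.exp (-l) ^ (α : ℝ) := by positivity
    have hρ : (Real.exp (-l) ^ (α : ℝ)) ^ n ≤ Real.exp (-l) ^ (α : ℝ) :=
      pow_le_of_le_one h0 B.rate_lt_one.le (by omega)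
    set E := |x - y| ^ (α : ℝ)
    have hE : 0 ≤ E := by positivity
    have huy := hA.pos _ hy2
    have h4 : a * |branch f n O x - branch f n O y| ^ (α : ℝ) + D * E ≤ a * E := by
      have ha := B.holder_nonneg
      calc _ ≤ a * (Real.exp (-l) ^ (α : ℝ) * E) + D * E := by gcongr; exact h3.trans (by gcongr)
        _ = (a * Real.exp (-l) ^ (α : ℝ) + D) * E := by ring
        _ ≤ a * E := by gcongr; exact B.holder
    calc pushDensity f n O u x
        ≤ (Real.exp (a * |branch f n O x - branch f n O y| ^ (α : ℝ)) * u (branch f n O y)) *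
          (Real.exp (D * E) * |deriv (branch f n O) y|) := by
          unfold pushDensity; gcongr
      _ = Real.exp (a * |branch f n O x - branch f n O y| ^ (α : ℝ) + D * E) *
          pushDensity f n O u y := by
          rw [Real.exp_add]; unfold pushDensity; ring
      _ ≤ _ := by
          have : 0 ≤ pushDensity f n O u y := by unfold pushDensity; positivity
          gcongr
  norm_le_one x hx := by
    obtain ⟨h1, h2⟩ := mem_of_mem_image_inter B.setting hO hx
    rw [pushPhase, norm_mul, norm_exp_I_mul_mul, one_mul]
    exact hA.norm_le_one _ h2
  norm_sub_le x hx y hy := by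
    obtain ⟨hx1, hx2⟩ := mem_of_mem_image_inter B.setting hO hx
    obtain ⟨hy1, hy2⟩ := mem_of_mem_image_inter B.setting hO hy
    have h1 := hA.norm_sub_le _ hx2 _ hy2
    have h3 := B.rpow_abs_branch_sub_le hO hx1 hy1
    have h4 := B.setting.abs_birkhoffSum_branch_sub_le B.slope hO hx1 hy1
    have h5 := norm_exp_I_mul_mul_sub_le_rpow B.exponent_pos B.exponent_le_one b
      (birkhoffSum f τ n (branch f n O x)) (birkhoffSum f τ n (branch f n O y))
    have hC := B.slope_nonneg
    have h6 : (|b| * |birkhoffSum f τ n (branch f n O x) - birkhoffSum f τ n (branch f n O y)|) ^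
        (α : ℝ) ≤ (C * |b|) ^ (α : ℝ) * |x - y| ^ (α : ℝ) := by
      rw [← Real.mul_rpow (by positivity) (by positivity)]
      refine Real.rpow_le_rpow (by positivity) ?_ α.2
      calc _ ≤ |b| * (C * |x - y|) := by gcongr
        _ = _ := by ring
    unfold pushPhase
    set e₁ := Complex.exp (Complex.I * b * birkhoffSum f τ n (branch f n O x)) with he₁
    set e₂ := Complex.exp (Complex.I * b * birkhoffSum f τ n (branch f n O y))
    set w₁ := ω (branch f n O x)
    set w₂ := ω (branch f n O y)
    have hw : ‖w₂‖ ≤ 1 := hA.norm_le_one _ hy2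
    have he : ‖e₁‖ = 1 := norm_exp_I_mul_mul _ _
    calc ‖e₁ * w₁ - e₂ * w₂‖ = ‖e₁ * (w₁ - w₂) + (e₁ - e₂) * w₂‖ := by ring_nf
      _ ≤ ‖e₁‖ * ‖w₁ - w₂‖ + ‖e₁ - e₂‖ * ‖w₂‖ := by
          rw [← norm_mul, ← norm_mul]; exact norm_add_le _ _
      _ ≤ 1 * (H * ((Real.exp (-l) ^ (α : ℝ)) ^ n * |x - y| ^ (α : ℝ))) +
          (2 * ((C * |b|) ^ (α : ℝ) * |x - y| ^ (α : ℝ))) * 1 := by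
          rw [he]
          gcongr
          · exact h1.trans (by gcongr)
          · exact h5.trans (by gcongr)
      _ = _ := by ring

end SkewProduct

/-! ### Growth of the sum of the suprema under transport. -/

namespace SkewProduct

open Filter Topology

variable {α : ℝ≥0} {f τ : ℝ → ℝ} {S R : Set ℝ} {l D C a : ℝ}
variable {H b : ℝ} {I O : Set ℝ} {u : ℝ → ℝ} {ω φ : ℝ → ℂ} {n : ℕ}

lemma Setting.abs_deriv_mul_abs_deriv_branch (h : Setting α f τ S R) (hO : O ∈ pieces f S n)
    {x : ℝ} (hx : x ∈ O) : |deriv f^[n] x| * |deriv (branch f n O) (f^[n] x)| = 1 := by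
  rw [h.deriv_branch_iterate hO hx, abs_inv]
  exact mul_inv_cancel₀ (abs_ne_zero.2 (h.deriv_iterate_ne_zero (subset_of_mem_pieces hO hx)))

/-- Change of variables by `f^n`: the Jacobian cancels the factor `|h'|`. -/
lemma Setting.atomFunctional_push (h : Setting α f τ S R) (hO : O ∈ pieces f S n)
    (hI : MeasurableSet I) :
    atomFunctional (f^[n] '' (O ∩ I)) (pushDensity f n O u) (pushPhase f τ b n O ω) φ =
      ∫ x in O ∩ I, (u x : ℂ) * ω x * twist f τ S b n φ x := by
  have hm : MeasurableSet (O ∩ I) := (h.isOpen_of_mem_pieces hO).measurableSet.inter hI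
  rw [atomFunctional, integral_image_eq_integral_abs_deriv_smul hm
    (fun x hx => (h.hasDerivAt_iterate (subset_of_mem_pieces hO hx.1)).hasDerivWithinAt)
    ((h.injOn_iterate hO).mono inter_subset_left)]
  refine setIntegral_congr_fun hm fun x hx => ?_
  have h1 := h.abs_deriv_mul_abs_deriv_branch hO hx.1
  have h2 : ((|deriv f^[n] x| : ℝ) : ℂ) * ((|deriv (branch f n O) (f^[n] x)| : ℝ) : ℂ) = 1 := by
    rw [← Complex.ofReal_mul, h1, Complex.ofReal_one]
  simp only [pushDensity, pushPhase, twist, indicator_of_mem (subset_of_mem_pieces hO hx.1),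
    h.branch_iterate hO hx.1, Complex.real_smul, Complex.ofReal_mul]
  linear_combination (u x : ℂ) * (Complex.exp (Complex.I * b * birkhoffSum f τ n x) * ω x) *
    φ (f^[n] x) * h2

lemma Setting.atomMass_push (h : Setting α f τ S R) (hO : O ∈ pieces f S n)
    (hI : MeasurableSet I) :
    atomMass (f^[n] '' (O ∩ I)) (pushDensity f n O u) = atomMass (O ∩ I) u := by
  have hm : MeasurableSet (O ∩ I) := (h.isOpen_of_mem_pieces hO).measurableSet.inter hI
  rw [atomMass, lintegral_image_eq_lintegral_abs_deriv_mul hm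
    (fun x hx => (h.hasDerivAt_iterate (subset_of_mem_pieces hO hx.1)).hasDerivWithinAt)
    ((h.injOn_iterate hO).mono inter_subset_left)]
  refine setLIntegral_congr_fun hm fun x hx => ?_
  have h1 := h.abs_deriv_mul_abs_deriv_branch hO hx.1
  simp only [pushDensity, h.branch_iterate hO hx.1]
  rw [← ENNReal.ofReal_mul (abs_nonneg _)]
  congr 1
  linear_combination u x * h1

lemma Setting.pairwise_disjoint_pieces_inter (I : Set ℝ) :
    Pairwise (Function.onFun Disjoint fun O : pieces f S n => (O : Set ℝ) ∩ I) := by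
  intro O₁ O₂ hne
  have : Disjoint (O₁ : Set ℝ) O₂ :=
    pairwiseDisjoint_intervalsOf O₁.2 O₂.2 fun hcon => hne (Subtype.ext hcon)
  exact this.mono inter_subset_left inter_subset_left

lemma iUnion_pieces_inter (I : Set ℝ) :
    ⋃ O : pieces f S n, (O : Set ℝ) ∩ I = regularSet f S n ∩ I := by
  rw [← iUnion_inter, ← sUnion_eq_iUnion]
  congr 1
  exact sUnion_intervalsOf

lemma UniformBounds.hasSum_atomFunctional_push (B : UniformBounds α f τ S R l D C a)
    (hA : IsAtom α a H I u ω) (b : ℝ) (n : ℕ) (hφ : IsTest φ) :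
    HasSum (fun O : pieces f S n => atomFunctional (f^[n] '' (O ∩ I)) (pushDensity f n O u)
      (pushPhase f τ b n O ω) φ) (atomFunctional I u ω (twist f τ S b n φ)) := by
  have h := B.setting
  have : Countable (pieces f S n) := (h.countable_pieces n).to_subtype
  have hint := hA.integrableOn B.exponent_pos B.holder_nonneg (hφ.twist h b n)
  have h1 := hasSum_integral_iUnion (μ := volume)
    (s := fun O : pieces f S n => (O : Set ℝ) ∩ I)
    (f := fun x => (u x : ℂ) * ω x * twist f τ S b n φ x)
    (fun O => (h.isOpen_of_mem_pieces O.2).measurableSet.inter hA.measurableSet)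
    (Setting.pairwise_disjoint_pieces_inter I)
    (by rw [iUnion_pieces_inter]; exact hint.mono_set inter_subset_right)
  rw [iUnion_pieces_inter] at h1
  have h2 : ∫ x in regularSet f S n ∩ I, (u x : ℂ) * ω x * twist f τ S b n φ x =
      atomFunctional I u ω (twist f τ S b n φ) := by
    refine (setIntegral_eq_of_subset_of_forall_sdiff_eq_zero hA.measurableSet inter_subset_right
      fun x hx => ?_).symm
    have : x ∉ regularSet f S n := fun hcon => hx.2 ⟨hcon, hx.1⟩
    simp [twist, this]
  rw [funext fun O : pieces f S n => h.atomFunctional_push O.2 hA.measurableSet, ← h2]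
  exact h1

lemma UniformBounds.tsum_atomMass_inter_le (B : UniformBounds α f τ S R l D C a)
    (hI : MeasurableSet I) (n : ℕ) (u : ℝ → ℝ) :
    ∑' O : pieces f S n, atomMass (O ∩ I) u ≤ atomMass I u := by
  have h := B.setting
  have : Countable (pieces f S n) := (h.countable_pieces n).to_subtype
  unfold atomMass
  rw [← lintegral_iUnion
    (fun O : pieces f S n => (h.isOpen_of_mem_pieces O.2).measurableSet.inter hI)
    (Setting.pairwise_disjoint_pieces_inter I)]
  exact lintegral_mono_set (by rw [iUnion_pieces_inter]; exact inter_subset_right)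

lemma tsum_indicator_subsingleton_le {ι : Type*} {s : Set ι} (hs : s.Subsingleton) (c : ℝ≥0∞) :
    ∑' i, s.indicator (fun _ => c) i ≤ c := by
  rcases hs.eq_empty_or_singleton with rfl | ⟨i, rfl⟩
  · simp
  · rw [tsum_eq_single i fun j hj => by simp [hj]]
    simp

/-- A disjoint family of intervals has at most two members which meet `I` without being contained
in it. -/
lemma tsum_indicator_not_subset_le (hI : I.OrdConnected) (n : ℕ) (c : ℝ≥0∞) :
    ∑' O : pieces f S n,
      {O : pieces f S n | ((O : Set ℝ) ∩ I).Nonempty ∧ ¬ (O : Set ℝ) ⊆ I}.indicator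
        (fun _ => c) O ≤ 2 * c := by
  -- Pieces protruding to the left of `I`; `s₂` collects those protruding to the right. If two
  -- protrude on the same side, the one reaching further out contains the protruding point of the
  -- other, so they coincide.
  set s₁ : Set (pieces f S n) :=
    {O | ((O : Set ℝ) ∩ I).Nonempty ∧ ∃ o ∈ (O : Set ℝ), ∀ i ∈ I, o < i}
  set s₂ : Set (pieces f S n) :=
    {O | ((O : Set ℝ) ∩ I).Nonempty ∧ ∃ o ∈ (O : Set ℝ), ∀ i ∈ I, i < o}
  have hs₁ : s₁.Subsingleton := by
    have key : ∀ O₁ ∈ s₁, ∀ O₂ ∈ s₁, ∀ o₁ ∈ (O₁ : Set ℝ), ∀ o₂ ∈ (O₂ : Set ℝ),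
        (∀ i ∈ I, o₂ < i) → o₁ ≤ o₂ → O₁ = O₂ := by
      rintro O₁ ⟨⟨i₁, hi₁, hi₁I⟩, -⟩ O₂ - o₁ ho₁ o₂ ho₂ hlt hle
      exact Subtype.ext (eq_of_mem_intervalsOf O₁.2 O₂.2
        ((ordConnected_of_mem_pieces O₁.2).out ho₁ hi₁ ⟨hle, (hlt _ hi₁I).le⟩) ho₂)
    intro O₁ h₁ O₂ h₂
    obtain ⟨-, o₁, ho₁, hlt₁⟩ := id h₁
    obtain ⟨-, o₂, ho₂, hlt₂⟩ := id h₂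
    rcases le_total o₁ o₂ with hle | hle
    · exact key O₁ h₁ O₂ h₂ o₁ ho₁ o₂ ho₂ hlt₂ hle
    · exact (key O₂ h₂ O₁ h₁ o₂ ho₂ o₁ ho₁ hlt₁ hle).symm
  have hs₂ : s₂.Subsingleton := by
    have key : ∀ O₁ ∈ s₂, ∀ O₂ ∈ s₂, ∀ o₁ ∈ (O₁ : Set ℝ), ∀ o₂ ∈ (O₂ : Set ℝ),
        (∀ i ∈ I, i < o₂) → o₂ ≤ o₁ → O₁ = O₂ := by
      rintro O₁ ⟨⟨i₁, hi₁, hi₁I⟩, -⟩ O₂ - o₁ ho₁ o₂ ho₂ hlt hle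
      exact Subtype.ext (eq_of_mem_intervalsOf O₁.2 O₂.2
        ((ordConnected_of_mem_pieces O₁.2).out hi₁ ho₁ ⟨(hlt _ hi₁I).le, hle⟩) ho₂)
    intro O₁ h₁ O₂ h₂
    obtain ⟨-, o₁, ho₁, hlt₁⟩ := id h₁
    obtain ⟨-, o₂, ho₂, hlt₂⟩ := id h₂
    rcases le_total o₁ o₂ with hle | hle
    · exact (key O₂ h₂ O₁ h₁ o₂ ho₂ o₁ ho₁ hlt₁ hle).symm
    · exact key O₁ h₁ O₂ h₂ o₁ ho₁ o₂ ho₂ hlt₂ hle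
  have hle : ∀ O : pieces f S n,
      {O : pieces f S n | ((O : Set ℝ) ∩ I).Nonempty ∧ ¬ (O : Set ℝ) ⊆ I}.indicator
        (fun _ => c) O ≤ s₁.indicator (fun _ => c) O + s₂.indicator (fun _ => c) O := by
    intro O
    by_cases hO : O ∈ {O : pieces f S n | ((O : Set ℝ) ∩ I).Nonempty ∧ ¬ (O : Set ℝ) ⊆ I}
    · rw [indicator_of_mem hO]
      obtain ⟨o, ho, hoI⟩ := not_subset.1 hO.2
      obtain ⟨i, hi, hiI⟩ := hO.1
      rcases lt_trichotomy o i with hlt | rfl | hlt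
      · have : O ∈ s₁ := ⟨hO.1, o, ho, fun j hj => by
          by_contra! hcon
          exact hoI (hI.out hj hiI ⟨hcon, hlt.le⟩)⟩
        rw [indicator_of_mem this]
        exact le_self_add
      · exact absurd hiI hoI
      · have : O ∈ s₂ := ⟨hO.1, o, ho, fun j hj => by
          by_contra! hcon
          exact hoI (hI.out hiI hj ⟨hlt.le, hcon⟩)⟩
        rw [indicator_of_mem this]
        exact le_add_self
    · rw [indicator_of_notMem hO]
      exact zero_le
  calc _ ≤ ∑' O, (s₁.indicator (fun _ => c) O + s₂.indicator (fun _ => c) O) :=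
        ENNReal.tsum_le_tsum hle
    _ = _ := ENNReal.tsum_add
    _ ≤ c + c := add_le_add (tsum_indicator_subsingleton_le hs₁ c)
        (tsum_indicator_subsingleton_le hs₂ c)
    _ = 2 * c := (two_mul c).symm

/-- The supremum of the derivative of a branch. -/
noncomputable def branchSup (f : ℝ → ℝ) (n : ℕ) (O : Set ℝ) : ℝ :=
  sSup ((fun x => |deriv (branch f n O) x|) '' (f^[n] '' O))

lemma UniformBounds.abs_deriv_branch_le_branchSup (B : UniformBounds α f τ S R l D C a)
    (hO : O ∈ pieces f S n) {x : ℝ} (hx : x ∈ f^[n] '' O) :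
    |deriv (branch f n O) x| ≤ branchSup f n O := by
  refine le_csSup ⟨Real.exp (-(l * n)), ?_⟩ (mem_image_of_mem _ hx)
  rintro _ ⟨y, hy, rfl⟩
  exact B.setting.abs_deriv_branch_le B.expanding hO hy

lemma UniformBounds.atomSup_push_le (B : UniformBounds α f τ S R l D C a)
    (hA : IsAtom α a H I u ω) (hO : O ∈ pieces f S n) {r : ℝ}
    (hr : ∀ x ∈ f^[n] '' O, |deriv (branch f n O) x| ≤ r) :
    atomSup (f^[n] '' (O ∩ I)) (pushDensity f n O u) ≤
      ENNReal.ofReal r * atomSup (O ∩ I) u := by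
  refine iSup₂_le fun x hx => ?_
  obtain ⟨h1, h2⟩ := mem_of_mem_image_inter B.setting hO hx
  rw [pushDensity, ENNReal.ofReal_mul (hA.pos _ h2).le, mul_comm]
  gcongr
  · exact hr x h1
  · exact le_biSup (fun x => ENNReal.ofReal (u x)) ⟨branch_mem h1, h2⟩

/-- The Lasota–Yorke inequality for the sum of the suprema. -/
lemma UniformBounds.exists_tsum_atomSup_push_le (B : UniformBounds α f τ S R l D C a)
    (n : ℕ) {ε : ℝ≥0∞} (hε : 0 < ε) : ∃ c : ℝ≥0∞, c ≠ ∞ ∧ ∀ H I u ω, IsAtom α a H I u ω →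
      ∑' O : pieces f S n, atomSup (f^[n] '' (O ∩ I)) (pushDensity f n O u) ≤
        (2 * ENNReal.ofReal (Real.exp (-(l * n))) + ε) * atomSup I u + c * atomMass I u := by
  classical
  have h := B.setting
  have hsum : ∑' O : pieces f S n, ENNReal.ofReal (branchSup f n O) ≠ ∞ :=
    (h.summable n).tsum_ofReal_ne_top
  -- All but finitely many branches have total derivative supremum at most `ε`; the constant `c` is
  -- finite because it involves only the pieces of `F`, which have positive length.
  obtain ⟨F, hF⟩ := ((ENNReal.tendsto_tsum_compl_atTop_zero hsum).eventually
    (ge_mem_nhds hε)).exists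
  set c : ℝ≥0∞ := ∑ O ∈ F, ENNReal.ofReal (branchSup f n O) * ENNReal.ofReal (Real.exp a) /
    volume (O : Set ℝ) with hc
  have hvol : ∀ O : pieces f S n, volume (O : Set ℝ) ≠ 0 := fun O =>
    ((h.isOpen_of_mem_pieces O.2).measure_pos volume (nonempty_of_mem_intervalsOf O.2)).ne'
  have hvol' : ∀ O : pieces f S n, volume (O : Set ℝ) ≠ ∞ := fun O =>
    ((measure_mono ((subset_of_mem_pieces O.2).trans (regularSet_subset n))).trans_lt
      (by simp)).ne
  refine ⟨c, ?_, fun H I u ω hA => ?_⟩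
  · refine (ENNReal.sum_lt_top.2 fun O _ => ?_).ne
    exact ENNReal.div_lt_top (ENNReal.mul_ne_top ENNReal.ofReal_ne_top ENNReal.ofReal_ne_top)
      (hvol O)
  set Z := atomSup I u
  set e := ENNReal.ofReal (Real.exp (-(l * n)))
  set s : Set (pieces f S n) := {O | ((O : Set ℝ) ∩ I).Nonempty ∧ ¬ (O : Set ℝ) ⊆ I}
  -- Each piece is charged to one term: pieces outside `F` to the tail, pieces of `F` cut by an end
  -- of `I` to the boundary term, and pieces of `F` inside `I` to the mass.
  have hterm : ∀ O : pieces f S n, atomSup (f^[n] '' (O ∩ I)) (pushDensity f n O u) ≤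
      s.indicator (fun _ => e * Z) O +
      {O | O ∉ F}.indicator (fun O => ENNReal.ofReal (branchSup f n O) * Z) O +
      c * atomMass (O ∩ I) u := by
    intro O
    have hb := B.atomSup_push_le hA O.2 fun x hx => B.abs_deriv_branch_le_branchSup O.2 hx
    have hZ : atomSup ((O : Set ℝ) ∩ I) u ≤ Z := atomSup_mono inter_subset_right
    by_cases hOF : O ∈ F
    · by_cases hne : ((O : Set ℝ) ∩ I).Nonempty
      · by_cases hsub : (O : Set ℝ) ⊆ I
        · refine le_trans (hb.trans ?_) le_add_self
          have hOI : (O : Set ℝ) ∩ I = O := inter_eq_left.2 hsub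
          have hA' := hA.inter (ordConnected_of_mem_pieces O.2)
          rw [inter_comm, hOI] at hA'
          rw [hOI]
          have h1 : atomSup (O : Set ℝ) u ≤
              ENNReal.ofReal (Real.exp a) * atomMass O u / volume (O : Set ℝ) := by
            refine iSup₂_le fun x hx => ?_
            rw [ENNReal.le_div_iff_mul_le (Or.inl (hvol O)) (Or.inl (hvol' O))]
            exact hA'.volume_mul_le B.holder_nonneg hx
          calc _ ≤ ENNReal.ofReal (branchSup f n O) *
                (ENNReal.ofReal (Real.exp a) * atomMass O u / volume (O : Set ℝ)) := by gcongr
            _ = (ENNReal.ofReal (branchSup f n O) * ENNReal.ofReal (Real.exp a) /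
                volume (O : Set ℝ)) * atomMass O u := by
                simp only [div_eq_mul_inv]; ring
            _ ≤ c * atomMass O u := by
                gcongr
                exact Finset.single_le_sum (f := fun O : pieces f S n =>
                  ENNReal.ofReal (branchSup f n O) * ENNReal.ofReal (Real.exp a) /
                    volume (O : Set ℝ)) (fun _ _ => zero_le) hOF
        · have hs : O ∈ s := ⟨hne, hsub⟩
          rw [indicator_of_mem hs, add_assoc]
          refine le_trans ?_ le_self_add
          refine (B.atomSup_push_le hA O.2 fun x hx =>
            h.abs_deriv_branch_le B.expanding O.2 hx).trans ?_
          gcongr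
      · rw [not_nonempty_iff_eq_empty] at hne
        simp [hne, atomSup]
    · have : O ∈ {O | O ∉ F} := hOF
      rw [indicator_of_mem this]
      refine le_trans (hb.trans ?_) (le_add_self.trans le_self_add)
      gcongr
  calc _ ≤ ∑' O : pieces f S n, (s.indicator (fun _ => e * Z) O +
      {O | O ∉ F}.indicator (fun O => ENNReal.ofReal (branchSup f n O) * Z) O +
      c * atomMass (O ∩ I) u) := ENNReal.tsum_le_tsum hterm
    _ = ∑' O : pieces f S n, s.indicator (fun _ => e * Z) O +
      ∑' O : pieces f S n, {O | O ∉ F}.indicator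
        (fun O => ENNReal.ofReal (branchSup f n O) * Z) O +
      ∑' O : pieces f S n, c * atomMass (O ∩ I) u := by
        rw [ENNReal.tsum_add, ENNReal.tsum_add]
    _ ≤ 2 * (e * Z) + ε * Z + c * atomMass I u := by
        gcongr
        · exact tsum_indicator_not_subset_le hA.ordConnected n _
        · rw [← tsum_subtype, ENNReal.tsum_mul_right]
          gcongr
          exact hF
        · rw [ENNReal.tsum_mul_left]
          gcongr
          exact B.tsum_atomMass_inter_le hA.measurableSet n u
    _ = _ := by ring

/-- One application of the transfer operator to an atom. -/
lemma UniformBounds.decomposes_push (B : UniformBounds α f τ S R l D C a)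
    (hA : IsAtom α a H I u ω) (hH : 0 ≤ H) (hn : 1 ≤ n) (b : ℝ) {z : ℝ≥0∞}
    (hz : ∑' O : pieces f S n, atomSup (f^[n] '' (O ∩ I)) (pushDensity f n O u) ≤ z) :
    Decomposes α a ((Real.exp (-l) ^ (α : ℝ)) ^ n * H + 2 * (C * |b|) ^ (α : ℝ))
      (fun φ => atomFunctional I u ω (twist f τ S b n φ)) (atomMass I u) z := by
  have : Countable (pieces f S n) := (B.setting.countable_pieces n).to_subtype
  refine ⟨pieces f S n, this, fun O => f^[n] '' (O ∩ I), fun O => pushDensity f n O u,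
    fun O => pushPhase f τ b n O ω, fun O => B.isAtom_push hA hH hn O.2 b, ?_, hz,
    fun φ hφ => B.hasSum_atomFunctional_push hA b n hφ⟩
  rw [tsum_congr fun O : pieces f S n => B.setting.atomMass_push O.2 hA.measurableSet]
  exact B.tsum_atomMass_inter_le hA.measurableSet n u

/-- The contraction rate of the sum of the suprema. -/
noncomputable def supRate (l : ℝ) : ℝ≥0∞ := ENNReal.ofReal ((2 * Real.exp (-l) + 1) / 2)

lemma UniformBounds.two_mul_exp_neg_lt_one (B : UniformBounds α f τ S R l D C a) :
    2 * Real.exp (-l) < 1 := by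
  have := Real.exp_lt_exp.2 (neg_lt_neg B.log_two_lt)
  rw [Real.exp_neg (Real.log 2), Real.exp_log (by norm_num)] at this
  linarith

lemma UniformBounds.supRate_lt_one (B : UniformBounds α f τ S R l D C a) : supRate l < 1 := by
  rw [supRate, ENNReal.ofReal_lt_one]
  linarith [B.two_mul_exp_neg_lt_one]

/-- Here `ε` is half of the gap `1 - 2e^{-l}`, which makes the rate the midpoint of `2e^{-l}` and
`1`, independently of `n`. -/
lemma UniformBounds.exists_tsum_atomSup_push_le_supRate (B : UniformBounds α f τ S R l D C a)
    (hn : 1 ≤ n) : ∃ c : ℝ≥0∞, c ≠ ∞ ∧ ∀ H I u ω, IsAtom α a H I u ω →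
      ∑' O : pieces f S n, atomSup (f^[n] '' (O ∩ I)) (pushDensity f n O u) ≤
        supRate l * atomSup I u + c * atomMass I u := by
  have h2 := B.two_mul_exp_neg_lt_one
  obtain ⟨c, hc, hle⟩ := B.exists_tsum_atomSup_push_le n
    (ε := ENNReal.ofReal ((1 - 2 * Real.exp (-l)) / 2)) (ENNReal.ofReal_pos.2 (by linarith))
  have hrate : 2 * ENNReal.ofReal (Real.exp (-(l * n))) +
      ENNReal.ofReal ((1 - 2 * Real.exp (-l)) / 2) ≤ supRate l := by
    have e2 : (2 : ℝ≥0∞) = ENNReal.ofReal 2 := by simp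
    rw [e2, ← ENNReal.ofReal_mul (by norm_num), ← ENNReal.ofReal_add (by positivity) (by linarith)]
    refine ENNReal.ofReal_le_ofReal ?_
    have : Real.exp (-(l * n)) ≤ Real.exp (-l) := by
      apply Real.exp_le_exp.2
      have h1 : (1 : ℝ) ≤ n := by exact_mod_cast hn
      nlinarith [B.log_pos]
    linarith
  exact ⟨c, hc, fun H I u ω hA => (hle H I u ω hA).trans (by gcongr)⟩

/-- The transfer operator contracts the sum of the suprema up to the mass. -/
lemma UniformBounds.exists_decomposes_twist (B : UniformBounds α f τ S R l D C a) (hn : 1 ≤ n) :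
    ∃ c : ℝ≥0∞, c ≠ ∞ ∧ ∀ (b H : ℝ), 0 ≤ H → ∀ Λ m z, m ≠ ∞ → Decomposes α a H Λ m z →
      Decomposes α a ((Real.exp (-l) ^ (α : ℝ)) ^ n * H + 2 * (C * |b|) ^ (α : ℝ))
        (fun φ => Λ (twist f τ S b n φ)) m (supRate l * z + c * m) := by
  obtain ⟨c, hc, hle⟩ := B.exists_tsum_atomSup_push_le_supRate hn
  refine ⟨c, hc, fun b H hH Λ m z hm hΛ => ?_⟩
  refine hΛ.bind B.holder_nonneg (fun φ hφ => hφ.twist B.setting b n)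
    (M := fun I u => atomMass I u) (Z := fun I u => supRate l * atomSup I u + c * atomMass I u)
    (fun I u ω hA => B.decomposes_push hA hH hn b (hle H I u ω hA)) hm ?_
  intro ι hι I u ω hA h1 h2
  refine ⟨h1, ?_⟩
  rw [ENNReal.tsum_add, ENNReal.tsum_mul_left, ENNReal.tsum_mul_left]
  gcongr

end SkewProduct

/-! ### Cancellation between two atoms at and near a point. -/

namespace SkewProduct

open Filter Topology ComplexConjugate

variable {α : ℝ≥0} {a H H' : ℝ} {I I₁ I₂ T : Set ℝ} {u u₁ u₂ : ℝ → ℝ} {ω ω₁ ω₂ φ : ℝ → ℂ}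

/-- If the real part were at most `3/4`, expanding the square would lose `v₁ v₂ / 2`. Comparability
gives `v₁ v₂ ≥ (c₀/4)(v₁ + v₂)^2`, and `1 - c₀/8 ≤ (1 - c₀/16)^2`. -/
lemma three_quarters_lt_re {c₀ v₁ v₂ : ℝ} {z₁ z₂ : ℂ} (hc₀ : 0 < c₀) (hc₁ : c₀ ≤ 1)
    (hv₁ : 0 < v₁) (hv₂ : 0 < v₂) (h₁₂ : c₀ * v₁ ≤ v₂) (h₂₁ : c₀ * v₂ ≤ v₁)
    (hz₁ : ‖z₁‖ ≤ 1) (hz₂ : ‖z₂‖ ≤ 1)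
    (h : (1 - c₀ / 16) * (v₁ + v₂) < ‖(v₁ : ℂ) * z₁ + (v₂ : ℂ) * z₂‖) :
    3 / 4 < (z₁ * conj z₂).re := by
  by_contra! hcon
  have hprod : c₀ / 4 * (v₁ + v₂) ^ 2 ≤ v₁ * v₂ := by
    rcases le_total v₁ v₂ with hle | hle
    · nlinarith [mul_nonneg hc₀.le hv₂.le, mul_nonneg hc₀.le hv₁.le,
        mul_le_mul_of_nonneg_right h₂₁ hv₂.le,
        mul_nonneg hc₀.le (mul_nonneg (sub_nonneg.2 hle) (add_pos hv₁ hv₂).le),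
        mul_nonneg hc₀.le (mul_nonneg (sub_nonneg.2 hle) hv₂.le)]
    · nlinarith [mul_nonneg hc₀.le hv₂.le, mul_nonneg hc₀.le hv₁.le,
        mul_le_mul_of_nonneg_right h₁₂ hv₁.le,
        mul_nonneg hc₀.le (mul_nonneg (sub_nonneg.2 hle) (add_pos hv₁ hv₂).le),
        mul_nonneg hc₀.le (mul_nonneg (sub_nonneg.2 hle) hv₁.le)]
  have hsq : ‖(v₁ : ℂ) * z₁ + (v₂ : ℂ) * z₂‖ ^ 2 =
      v₁ ^ 2 * ‖z₁‖ ^ 2 + v₂ ^ 2 * ‖z₂‖ ^ 2 + 2 * (v₁ * v₂) * (z₁ * conj z₂).re := by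
    rw [← Complex.normSq_eq_norm_sq, ← Complex.normSq_eq_norm_sq, ← Complex.normSq_eq_norm_sq,
      Complex.normSq_apply, Complex.normSq_apply, Complex.normSq_apply]
    simp
    ring
  have h1 : ‖z₁‖ ^ 2 ≤ 1 := pow_le_one₀ (norm_nonneg _) hz₁
  have h2 : ‖z₂‖ ^ 2 ≤ 1 := pow_le_one₀ (norm_nonneg _) hz₂
  have h3 : ‖(v₁ : ℂ) * z₁ + (v₂ : ℂ) * z₂‖ ^ 2 ≤ (v₁ + v₂) ^ 2 - v₁ * v₂ / 2 := by
    rw [hsq]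
    have e1 : v₁ ^ 2 * ‖z₁‖ ^ 2 ≤ v₁ ^ 2 * 1 := by gcongr
    have e2 : v₂ ^ 2 * ‖z₂‖ ^ 2 ≤ v₂ ^ 2 * 1 := by gcongr
    have e3 : 2 * (v₁ * v₂) * (z₁ * conj z₂).re ≤ 2 * (v₁ * v₂) * (3 / 4) := by gcongr
    nlinarith
  have h4 : ((1 - c₀ / 16) * (v₁ + v₂)) ^ 2 < ‖(v₁ : ℂ) * z₁ + (v₂ : ℂ) * z₂‖ ^ 2 := by
    have : 0 ≤ (1 - c₀ / 16) * (v₁ + v₂) := by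
      have : 0 ≤ 1 - c₀ / 16 := by linarith
      positivity
    gcongr
  nlinarith [sq_nonneg (c₀ * (v₁ + v₂))]

/-- The two products would add up to something of real part above `3/2`. Their rotating factors are
opposite and the remaining factors nearly equal, so the sum has modulus at most `1/2`. -/
lemma not_aligned_of_opposite_phase {e d : ℂ} {w₁ w₂ w₁' w₂' z₁ z₂ y₁ y₂ : ℂ}
    (hz : z₁ * conj z₂ = e * (w₁ * conj w₂)) (hy : y₁ * conj y₂ = d * (w₁' * conj w₂'))
    (hed : d = -e) (he : ‖e‖ = 1) (hw₁ : ‖w₁‖ ≤ 1) (hw₂' : ‖w₂'‖ ≤ 1)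
    (h₁ : ‖w₁ - w₁'‖ ≤ 1 / 4) (h₂ : ‖w₂ - w₂'‖ ≤ 1 / 4)
    (hz' : 3 / 4 < (z₁ * conj z₂).re) (hy' : 3 / 4 < (y₁ * conj y₂).re) : False := by
  have e1 : z₁ * conj z₂ + y₁ * conj y₂ =
      e * (w₁ * conj (w₂ - w₂') + (w₁ - w₁') * conj w₂') := by
    rw [hz, hy, hed, map_sub]; ring
  have e2 : ‖z₁ * conj z₂ + y₁ * conj y₂‖ ≤ 1 / 2 := by
    rw [e1, norm_mul, he, one_mul]
    refine (norm_add_le _ _).trans ?_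
    rw [norm_mul, norm_mul, RCLike.norm_conj, RCLike.norm_conj]
    calc _ ≤ 1 * (1 / 4) + 1 / 4 * (1 : ℝ) := by gcongr
      _ = 1 / 2 := by norm_num
  have e3 := (Complex.re_le_norm (z₁ * conj z₂ + y₁ * conj y₂)).trans e2
  rw [Complex.add_re] at e3
  linarith

/-- On an interval on which the relative phase of two atoms makes half a turn, some point has a
definite cancellation. -/
lemma exists_cancelling_point {b c c₀ s t : ℝ} {ψ₁ ψ₂ : ℝ → ℝ} {w₁ w₂ : ℝ → ℂ}
    (hc₀ : 0 < c₀) (hc₁ : c₀ ≤ 1) (hb : b ≠ 0) (hst : s ≤ t)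
    (hω₁ : ∀ x ∈ Icc s t, ω₁ x = Complex.exp (Complex.I * b * ψ₁ x) * w₁ x)
    (hω₂ : ∀ x ∈ Icc s t, ω₂ x = Complex.exp (Complex.I * b * ψ₂ x) * w₂ x)
    (hw₁ : ∀ x ∈ Icc s t, ‖w₁ x‖ ≤ 1) (hw₂ : ∀ x ∈ Icc s t, ‖w₂ x‖ ≤ 1)
    (hv₁ : ∀ x ∈ Icc s t, ∀ y ∈ Icc s t, ‖w₁ x - w₁ y‖ ≤ 1 / 4)
    (hv₂ : ∀ x ∈ Icc s t, ∀ y ∈ Icc s t, ‖w₂ x - w₂ y‖ ≤ 1 / 4)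
    (hu₁ : ∀ x ∈ Icc s t, 0 < u₁ x) (hu₂ : ∀ x ∈ Icc s t, 0 < u₂ x)
    (h₁₂ : ∀ x ∈ Icc s t, c₀ * u₁ x ≤ u₂ x) (h₂₁ : ∀ x ∈ Icc s t, c₀ * u₂ x ≤ u₁ x)
    (hψ : ContinuousOn (fun x => ψ₁ x - ψ₂ x) (Icc s t))
    (hgrow : c * (t - s) ≤ (ψ₁ t - ψ₂ t) - (ψ₁ s - ψ₂ s)) (hlen : Real.pi ≤ |b| * (c * (t - s))) :
    ∃ x ∈ Icc s t, ‖(u₁ x : ℂ) * ω₁ x + (u₂ x : ℂ) * ω₂ x‖ ≤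
      (1 - c₀ / 16) * (u₁ x + u₂ x) := by
  have hb' : 0 < |b| := abs_pos.2 hb
  have hs : s ∈ Icc s t := left_mem_Icc.2 hst
  -- At `y` the phase difference times `b` has moved by exactly `π` in absolute value since `s`, so
  -- the rotating factor has changed sign.
  obtain ⟨y, hy, hyeq⟩ : ∃ y ∈ Icc s t, ψ₁ y - ψ₂ y = ψ₁ s - ψ₂ s + Real.pi / |b| := by
    have h1 : Real.pi / |b| ≤ c * (t - s) := by rwa [div_le_iff₀' hb']
    have h2 : 0 ≤ Real.pi / |b| := by positivity
    exact intermediate_value_Icc hst hψ ⟨by linarith, by linarith⟩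
  by_contra! hcon
  have hnorm : ∀ x : ℝ, ∀ ψ : ℝ → ℝ, conj (Complex.exp (Complex.I * b * ψ x)) =
      Complex.exp (-(Complex.I * b * ψ x)) := by
    intro x ψ
    rw [← Complex.exp_conj]
    simp
  have hprod : ∀ x ∈ Icc s t, ω₁ x * conj (ω₂ x) =
      Complex.exp (Complex.I * b * (ψ₁ x - ψ₂ x : ℝ)) * (w₁ x * conj (w₂ x)) := by
    intro x hx
    rw [hω₁ x hx, hω₂ x hx, map_mul, hnorm]
    have : Complex.exp (Complex.I * b * (ψ₁ x - ψ₂ x : ℝ)) =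
        Complex.exp (Complex.I * b * ψ₁ x) * Complex.exp (-(Complex.I * b * ψ₂ x)) := by
      rw [← Complex.exp_add]; push_cast; ring_nf
    rw [this]; ring
  have hle : ∀ x ∈ Icc s t, ‖ω₁ x‖ ≤ 1 ∧ ‖ω₂ x‖ ≤ 1 := by
    intro x hx
    rw [hω₁ x hx, hω₂ x hx, norm_mul, norm_mul, norm_exp_I_mul_mul, norm_exp_I_mul_mul]
    simpa using ⟨hw₁ x hx, hw₂ x hx⟩
  have hre : ∀ x ∈ Icc s t, 3 / 4 < (ω₁ x * conj (ω₂ x)).re := fun x hx =>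
    three_quarters_lt_re hc₀ hc₁ (hu₁ x hx) (hu₂ x hx) (h₁₂ x hx) (h₂₁ x hx) (hle x hx).1
      (hle x hx).2 (hcon x hx)
  have hopp : Complex.exp (Complex.I * b * (ψ₁ y - ψ₂ y : ℝ)) =
      -Complex.exp (Complex.I * b * (ψ₁ s - ψ₂ s : ℝ)) := by
    have hbc : (b : ℂ) ≠ 0 := Complex.ofReal_ne_zero.2 hb
    rw [hyeq]
    rcases abs_choice b with hab | hab
    · rw [hab]
      have : Complex.I * b * ((ψ₁ s - ψ₂ s + Real.pi / b : ℝ) : ℂ) =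
          Complex.I * b * (ψ₁ s - ψ₂ s : ℝ) + Real.pi * Complex.I := by
        push_cast; field_simp
      rw [this, Complex.exp_add, Complex.exp_pi_mul_I]; ring
    · rw [hab]
      have : Complex.I * b * ((ψ₁ s - ψ₂ s + Real.pi / -b : ℝ) : ℂ) =
          Complex.I * b * (ψ₁ s - ψ₂ s : ℝ) + -(Real.pi * Complex.I) := by
        push_cast; field_simp
      rw [this, Complex.exp_add, Complex.exp_neg, Complex.exp_pi_mul_I]; norm_num
  exact not_aligned_of_opposite_phase (hprod s hs) (hprod y hy) hopp (norm_exp_I_mul_mul _ _)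
    (hw₁ s hs) (hw₂ y hy) (hv₁ s hs y hy) (hv₂ s hs y hy) (hre s hs) (hre y hy)

lemma IsAtom.abs_density_sub_le (hA : IsAtom α a H I u ω) {x y ζ : ℝ} (hx : x ∈ I) (hy : y ∈ I)
    (hζ : Real.exp (a * |x - y| ^ (α : ℝ)) ≤ 1 + ζ) : |u x - u y| ≤ ζ * u x := by
  have h1 := hA.le_exp_mul x hx y hy
  have h2 := hA.le_exp_mul y hy x hx
  rw [abs_sub_comm y x] at h2
  have hux := hA.pos x hx
  have huy := hA.pos y hy
  have h3 : u y ≤ (1 + ζ) * u x := h2.trans (by gcongr)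
  have h4 : u x ≤ (1 + ζ) * u y := h1.trans (by gcongr)
  have hζ0 : 0 ≤ ζ ∨ ζ < 0 := le_or_gt 0 ζ
  rw [abs_le]
  rcases hζ0 with h0 | h0
  · constructor
    · linarith
    · nlinarith
  · exfalso
    nlinarith

/-- The cancellation at a point persists in a small neighbourhood. -/
lemma norm_add_le_of_near {x x₀ η : ℝ} (hA₁ : IsAtom α a H I₁ u₁ ω₁) (hA₂ : IsAtom α a H I₂ u₂ ω₂)
    (hη : 0 ≤ η) (hη' : η ≤ 1 / 2) (hx₁ : x ∈ I₁) (hx₂ : x ∈ I₂) (hx₀₁ : x₀ ∈ I₁) (hx₀₂ : x₀ ∈ I₂)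
    (h₀ : ‖(u₁ x₀ : ℂ) * ω₁ x₀ + (u₂ x₀ : ℂ) * ω₂ x₀‖ ≤ (1 - 2 * η) * (u₁ x₀ + u₂ x₀))
    (hd : Real.exp (a * |x - x₀| ^ (α : ℝ)) ≤ 1 + η / 4) (hH : H * |x - x₀| ^ (α : ℝ) ≤ η / 4) :
    ‖(u₁ x : ℂ) * ω₁ x + (u₂ x : ℂ) * ω₂ x‖ ≤ (1 - η) * (u₁ x + u₂ x) := by
  have d₁ := hA₁.abs_density_sub_le hx₁ hx₀₁ hd
  have d₂ := hA₂.abs_density_sub_le hx₂ hx₀₂ hd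
  have p₁ := (hA₁.norm_sub_le x hx₁ x₀ hx₀₁).trans hH
  have p₂ := (hA₂.norm_sub_le x hx₂ x₀ hx₀₂).trans hH
  have n₁ := hA₁.norm_le_one x₀ hx₀₁
  have n₂ := hA₂.norm_le_one x₀ hx₀₂
  have hu₁ := hA₁.pos x hx₁
  have hu₂ := hA₂.pos x hx₂
  have e : (u₁ x : ℂ) * ω₁ x + (u₂ x : ℂ) * ω₂ x =
      ((u₁ x₀ : ℂ) * ω₁ x₀ + (u₂ x₀ : ℂ) * ω₂ x₀) +
      (((u₁ x - u₁ x₀ : ℝ) : ℂ) * ω₁ x₀ + ((u₂ x - u₂ x₀ : ℝ) : ℂ) * ω₂ x₀ +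
      ((u₁ x : ℂ) * (ω₁ x - ω₁ x₀) + (u₂ x : ℂ) * (ω₂ x - ω₂ x₀))) := by
    push_cast; ring
  have b₁ : ‖((u₁ x - u₁ x₀ : ℝ) : ℂ) * ω₁ x₀‖ ≤ η / 4 * u₁ x := by
    rw [norm_mul, Complex.norm_real, Real.norm_eq_abs]
    calc _ ≤ η / 4 * u₁ x * 1 := by gcongr
      _ = _ := mul_one _
  have b₂ : ‖((u₂ x - u₂ x₀ : ℝ) : ℂ) * ω₂ x₀‖ ≤ η / 4 * u₂ x := by
    rw [norm_mul, Complex.norm_real, Real.norm_eq_abs]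
    calc _ ≤ η / 4 * u₂ x * 1 := by gcongr
      _ = _ := mul_one _
  have b₃ : ‖(u₁ x : ℂ) * (ω₁ x - ω₁ x₀)‖ ≤ u₁ x * (η / 4) := by
    rw [norm_mul, Complex.norm_real, Real.norm_of_nonneg hu₁.le]; gcongr
  have b₄ : ‖(u₂ x : ℂ) * (ω₂ x - ω₂ x₀)‖ ≤ u₂ x * (η / 4) := by
    rw [norm_mul, Complex.norm_real, Real.norm_of_nonneg hu₂.le]; gcongr
  rw [abs_le] at d₁ d₂
  have hsum : u₁ x₀ + u₂ x₀ ≤ (1 + η / 4) * (u₁ x + u₂ x) := by linarith [d₁.1, d₂.1]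
  have h5 : (1 - 2 * η) * (u₁ x₀ + u₂ x₀) ≤ (1 - 2 * η) * ((1 + η / 4) * (u₁ x + u₂ x)) := by
    have : 0 ≤ 1 - 2 * η := by linarith
    gcongr
  rw [e]
  refine (norm_add_le _ _).trans ?_
  have t₁ := norm_add_le (((u₁ x - u₁ x₀ : ℝ) : ℂ) * ω₁ x₀ + ((u₂ x - u₂ x₀ : ℝ) : ℂ) * ω₂ x₀)
    ((u₁ x : ℂ) * (ω₁ x - ω₁ x₀) + (u₂ x : ℂ) * (ω₂ x - ω₂ x₀))
  have t₂ := norm_add_le (((u₁ x - u₁ x₀ : ℝ) : ℂ) * ω₁ x₀) (((u₂ x - u₂ x₀ : ℝ) : ℂ) * ω₂ x₀)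
  have t₃ := norm_add_le ((u₁ x : ℂ) * (ω₁ x - ω₁ x₀)) ((u₂ x : ℂ) * (ω₂ x - ω₂ x₀))
  -- The budget is `(1 - 2η)(1 + η/4) + η/4 + η/4 ≤ 1 - η`: comparison of the total densities, then
  -- variation of densities and of phases.
  nlinarith [mul_nonneg hη (add_pos hu₁ hu₂).le, mul_nonneg (mul_nonneg hη hη) (add_pos hu₁ hu₂).le]

/-- The sum of two atoms with a definite cancellation is an atom with smaller density. -/
lemma IsAtom.merge {η : ℝ} (ha : 0 ≤ a) (hA₁ : IsAtom α a H T u₁ ω₁)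
    (hA₂ : IsAtom α a H T u₂ ω₂) (hη' : η ≤ 1 / 2)
    (hc : ∀ x ∈ T, ‖(u₁ x : ℂ) * ω₁ x + (u₂ x : ℂ) * ω₂ x‖ ≤ (1 - η) * (u₁ x + u₂ x)) :
    IsAtom α a (2 * (H + 4 * a * Real.exp (2 * a))) T (fun x => (1 - η) * (u₁ x + u₂ x))
      (fun x => ((u₁ x : ℂ) * ω₁ x + (u₂ x : ℂ) * ω₂ x) / (((1 - η) * (u₁ x + u₂ x) : ℝ) : ℂ)) where
  ordConnected := hA₁.ordConnected
  subset := hA₁.subset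
  pos x hx := by
    have := hA₁.pos x hx
    have := hA₂.pos x hx
    have : 0 < 1 - η := by linarith
    positivity
  le_exp_mul x hx y hy := by
    have h1 := hA₁.le_exp_mul x hx y hy
    have h2 := hA₂.le_exp_mul x hx y hy
    have : 0 < 1 - η := by linarith
    calc (1 - η) * (u₁ x + u₂ x) ≤ (1 - η) * (Real.exp (a * |x - y| ^ (α : ℝ)) * u₁ y +
          Real.exp (a * |x - y| ^ (α : ℝ)) * u₂ y) := by gcongr
      _ = _ := by ring
  norm_le_one x hx := by
    have h1 := hA₁.pos x hx
    have h2 := hA₂.pos x hx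
    have h3 : 0 < 1 - η := by linarith
    have h4 : 0 < (1 - η) * (u₁ x + u₂ x) := by positivity
    rw [norm_div, Complex.norm_real, Real.norm_of_nonneg h4.le, div_le_one h4]
    exact hc x hx
  norm_sub_le x hx y hy := by
    have h3 : 0 < 1 - η := by linarith
    have hE1 := hA₁.rpow_abs_sub_le_one hx hy
    set E := |x - y| ^ (α : ℝ) with hE
    have hE0 : 0 ≤ E := by positivity
    have px₁ := hA₁.pos x hx
    have px₂ := hA₂.pos x hx
    have py₁ := hA₁.pos y hy
    have py₂ := hA₂.pos y hy
    have q₁ := hA₁.norm_sub_le x hx y hy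
    have q₂ := hA₂.norm_sub_le x hx y hy
    set θx := u₁ x / (u₁ x + u₂ x) with hθx
    set θy := u₁ y / (u₁ y + u₂ y) with hθy
    -- The merged phase is `(1 - η)⁻¹` times the average of `ω₁` and `ω₂` with weight `θ = u₁ / (u₁
    -- + u₂)`. The weights at two points differ by a factor at most `e^{2aE}`, hence are Hölder with
    -- constant `2a e^{2a}`.
    have key : ∀ z₁ z₂ w₁ w₂ : ℝ, 0 < z₁ → 0 < z₂ → 0 < w₁ → 0 < w₂ →
        z₁ ≤ Real.exp (a * E) * w₁ → w₁ ≤ Real.exp (a * E) * z₁ →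
        z₂ ≤ Real.exp (a * E) * w₂ → w₂ ≤ Real.exp (a * E) * z₂ →
        z₁ / (z₁ + z₂) - w₁ / (w₁ + w₂) ≤ 2 * a * Real.exp (2 * a) * E := by
      intro z₁ z₂ w₁ w₂ hz₁ hz₂ hw₁ hw₂ h1 h2 h3 h4
      have hexp : Real.exp (a * E) * Real.exp (a * E) = Real.exp (2 * a * E) := by
        rw [← Real.exp_add]; ring_nf
      have h5 : z₁ / (z₁ + z₂) ≤ Real.exp (2 * a * E) * (w₁ / (w₁ + w₂)) := by
        rw [← hexp, div_le_iff₀ (by positivity)]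
        have h6 : w₁ + w₂ ≤ Real.exp (a * E) * (z₁ + z₂) := by linarith
        have h7 : (w₁ + w₂) * z₁ ≤ (Real.exp (a * E) * (z₁ + z₂)) * (Real.exp (a * E) * w₁) := by
          gcongr
        calc z₁ = ((w₁ + w₂) * z₁) / (w₁ + w₂) := by field_simp
          _ ≤ ((Real.exp (a * E) * (z₁ + z₂)) * (Real.exp (a * E) * w₁)) / (w₁ + w₂) := by gcongr
          _ = _ := by ring
      have h8 : w₁ / (w₁ + w₂) ≤ 1 := by
        rw [div_le_one (by positivity)]; linarith
      have h9 : 1 ≤ Real.exp (2 * a * E) := Real.one_le_exp (by positivity)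
      have h10 : Real.exp (2 * a * E) - 1 ≤ 2 * a * E * Real.exp (2 * a * E) := by
        have := Real.add_one_le_exp (-(2 * a * E))
        have h11 : Real.exp (2 * a * E) * (-(2 * a * E) + 1) ≤ 1 := by
          calc _ ≤ Real.exp (2 * a * E) * Real.exp (-(2 * a * E)) := by gcongr
            _ = 1 := by rw [← Real.exp_add, add_neg_cancel, Real.exp_zero]
        linarith
      have h12 : Real.exp (2 * a * E) ≤ Real.exp (2 * a) := by
        apply Real.exp_le_exp.2; nlinarith
      have h13 : 0 ≤ w₁ / (w₁ + w₂) := by positivity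
      calc _ ≤ (Real.exp (2 * a * E) - 1) * (w₁ / (w₁ + w₂)) := by linarith
        _ ≤ (Real.exp (2 * a * E) - 1) * 1 := by
            have : 0 ≤ Real.exp (2 * a * E) - 1 := by linarith
            gcongr
        _ ≤ 2 * a * E * Real.exp (2 * a) := by
            rw [mul_one]
            refine h10.trans ?_
            gcongr
        _ = _ := by ring
    have l₁ := hA₁.le_exp_mul x hx y hy
    have l₂ := hA₂.le_exp_mul x hx y hy
    have l₁' := hA₁.le_exp_mul y hy x hx
    have l₂' := hA₂.le_exp_mul y hy x hx
    rw [abs_sub_comm y x, ← hE] at l₁' l₂'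
    have hθ : |θx - θy| ≤ 2 * a * Real.exp (2 * a) * E := by
      rw [abs_le]
      constructor
      · linarith [key _ _ _ _ py₁ py₂ px₁ px₂ l₁' l₁ l₂' l₂]
      · exact key _ _ _ _ px₁ px₂ py₁ py₂ l₁ l₁' l₂ l₂'
    have rew : ∀ z, 0 < u₁ z → 0 < u₂ z →
        ((u₁ z : ℂ) * ω₁ z + (u₂ z : ℂ) * ω₂ z) / (((1 - η) * (u₁ z + u₂ z) : ℝ) : ℂ) =
        ((1 - η : ℝ) : ℂ)⁻¹ * (((u₁ z / (u₁ z + u₂ z) : ℝ) : ℂ) * ω₁ z +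
          ((1 - u₁ z / (u₁ z + u₂ z) : ℝ) : ℂ) * ω₂ z) := by
      intro z hz₁ hz₂
      have hne : ((u₁ z + u₂ z : ℝ) : ℂ) ≠ 0 := Complex.ofReal_ne_zero.2 (by positivity)
      have hne' : ((1 - η : ℝ) : ℂ) ≠ 0 := Complex.ofReal_ne_zero.2 h3.ne'
      push_cast at hne hne' ⊢
      field_simp
      ring
    rw [rew x px₁ px₂, rew y py₁ py₂, ← mul_sub, norm_mul, norm_inv, Complex.norm_real,
      Real.norm_of_nonneg h3.le, ← hθx, ← hθy]
    have hθx0 : 0 ≤ θx := by positivity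
    have hθx1 : θx ≤ 1 := by rw [hθx, div_le_one (by positivity)]; linarith
    have e : (θx : ℂ) * ω₁ x + ((1 - θx : ℝ) : ℂ) * ω₂ x -
        ((θy : ℂ) * ω₁ y + ((1 - θy : ℝ) : ℂ) * ω₂ y) =
        (θx : ℂ) * (ω₁ x - ω₁ y) + ((1 - θx : ℝ) : ℂ) * (ω₂ x - ω₂ y) +
        ((θx - θy : ℝ) : ℂ) * (ω₁ y - ω₂ y) := by push_cast; ring
    have m₁ : ‖(θx : ℂ) * (ω₁ x - ω₁ y)‖ ≤ θx * (H * E) := by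
      rw [norm_mul, Complex.norm_real, Real.norm_of_nonneg hθx0]; gcongr
    have m₂ : ‖((1 - θx : ℝ) : ℂ) * (ω₂ x - ω₂ y)‖ ≤ (1 - θx) * (H * E) := by
      have : 0 ≤ 1 - θx := by linarith
      rw [norm_mul, Complex.norm_real, Real.norm_of_nonneg this]; gcongr
    have m₃ : ‖((θx - θy : ℝ) : ℂ) * (ω₁ y - ω₂ y)‖ ≤ 2 * a * Real.exp (2 * a) * E * 2 := by
      rw [norm_mul, Complex.norm_real, Real.norm_eq_abs]
      have : ‖ω₁ y - ω₂ y‖ ≤ 2 := by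
        linarith [_root_.norm_sub_le (ω₁ y) (ω₂ y), hA₁.norm_le_one y hy, hA₂.norm_le_one y hy]
      gcongr
    rw [e]
    have hinv : (1 - η)⁻¹ ≤ 2 := by
      rw [inv_le_comm₀ h3 (by norm_num)]; linarith
    calc _ ≤ 2 * (θx * (H * E) + (1 - θx) * (H * E) + 2 * a * Real.exp (2 * a) * E * 2) := by
          gcongr
          refine (norm_add_le _ _).trans (add_le_add ((norm_add_le _ _).trans ?_) m₃)
          exact add_le_add m₁ m₂
      _ = _ := by ring

end SkewProduct

/-! ### Cancellation on one block. -/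

namespace SkewProduct

open Filter Topology ComplexConjugate

variable {α : ℝ≥0} {a H H' : ℝ} {I I₁ I₂ T : Set ℝ} {u u₁ u₂ : ℝ → ℝ} {ω ω₁ ω₂ φ : ℝ → ℂ}

lemma atomMass_union {J K : Set ℝ} (hK : MeasurableSet K) (hJK : Disjoint J K) :
    atomMass (J ∪ K) u = atomMass J u + atomMass K u := lintegral_union hK hJK

lemma IsAtom.restrict {J : Set ℝ} (hA : IsAtom α a H I u ω) (hJ : J.OrdConnected) (hJI : J ⊆ I) :
    IsAtom α a H J u ω := inter_eq_right.2 hJI ▸ hA.inter hJ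

lemma IsAtom.atomFunctional_union (hA : IsAtom α a H I u ω) (hα : 0 < α) (ha : 0 ≤ a)
    (hφ : IsTest φ) {J K : Set ℝ} (hK : MeasurableSet K) (hJK : Disjoint J K) (hJI : J ⊆ I)
    (hKI : K ⊆ I) :
    atomFunctional (J ∪ K) u ω φ = atomFunctional J u ω φ + atomFunctional K u ω φ :=
  setIntegral_union hJK hK ((hA.integrableOn hα ha hφ).mono_set hJI)
    ((hA.integrableOn hα ha hφ).mono_set hKI)

/-- By bounded oscillation of the density, a subinterval carries at least `e^{-a}` times its share
of length. This bounds below the proportion of mass where merging takes place. -/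
lemma IsAtom.volume_mul_atomMass_le (hA : IsAtom α a H I u ω) (ha : 0 ≤ a) {J : Set ℝ}
    (hJ : J.OrdConnected) (hJI : J ⊆ I) :
    volume J * atomMass I u ≤ ENNReal.ofReal (Real.exp a) * (volume I * atomMass J u) := by
  have h1 : ∀ x ∈ I, volume J * ENNReal.ofReal (u x) ≤
      ENNReal.ofReal (Real.exp a) * atomMass J u := by
    intro x hx
    rw [atomMass, ← lintegral_const_mul' _ _ ENNReal.ofReal_ne_top, mul_comm, ← setLIntegral_const]
    refine setLIntegral_mono' hJ.measurableSet fun y hy => ?_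
    rw [← ENNReal.ofReal_mul (Real.exp_pos _).le]
    exact ENNReal.ofReal_le_ofReal (hA.le_exp ha hx (hJI hy))
  have hJv : volume J ≠ ∞ := ((measure_mono hJI).trans_lt hA.volume_lt_top).ne
  calc volume J * atomMass I u = ∫⁻ x in I, volume J * ENNReal.ofReal (u x) := by
        rw [atomMass, lintegral_const_mul' _ _ hJv]
    _ ≤ ∫⁻ _ in I, ENNReal.ofReal (Real.exp a) * atomMass J u :=
        setLIntegral_mono' hA.measurableSet h1
    _ = _ := by rw [setLIntegral_const]; ring

/-- If `x` is at least the fraction `ξ` of the total and loses the proportion `η`, the total loses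
the proportion `η ξ`. -/
lemma ofReal_one_sub_mul_add_le {x y : ℝ≥0∞} {η ξ : ℝ} (hη : 0 ≤ η) (hη' : η ≤ 1) (hξ : 0 ≤ ξ)
    (hξ' : ξ ≤ 1) (hx : x ≠ ∞) (hy : y ≠ ∞) (h : ENNReal.ofReal ξ * (x + y) ≤ x) :
    ENNReal.ofReal (1 - η) * x + y ≤ ENNReal.ofReal (1 - η * ξ) * (x + y) := by
  lift x to ℝ≥0 using hx
  lift y to ℝ≥0 using hy
  have hηξ : η * ξ ≤ 1 := mul_le_one₀ hη' hξ hξ'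
  rw [← ENNReal.ofReal_coe_nnreal (p := x), ← ENNReal.ofReal_coe_nnreal (p := y),
    ← ENNReal.ofReal_add x.coe_nonneg y.coe_nonneg, ← ENNReal.ofReal_mul hξ] at h
  rw [← ENNReal.ofReal_coe_nnreal (p := x), ← ENNReal.ofReal_coe_nnreal (p := y),
    ← ENNReal.ofReal_add x.coe_nonneg y.coe_nonneg, ← ENNReal.ofReal_mul (by linarith),
    ← ENNReal.ofReal_mul (by linarith), ← ENNReal.ofReal_add (by
      have : 0 ≤ 1 - η := by linarith
      positivity) y.coe_nonneg]
  refine ENNReal.ofReal_le_ofReal ?_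
  have h' := (ENNReal.ofReal_le_ofReal_iff x.coe_nonneg).1 h
  nlinarith

/-- The data of two atoms overlapping in an interval with rotating relative phase. -/
structure RotatingPair (α : ℝ≥0) (a H : ℝ) (b c c₀ s t : ℝ) (I₁ I₂ : Set ℝ) (u₁ u₂ : ℝ → ℝ)
    (ω₁ ω₂ : ℝ → ℂ) (ψ₁ ψ₂ : ℝ → ℝ) (w₁ w₂ : ℝ → ℂ) (ℓ : ℝ) : Prop where
  atom₁ : IsAtom α a H I₁ u₁ ω₁
  atom₂ : IsAtom α a H I₂ u₂ ω₂
  subset₁ : Icc s t ⊆ I₁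
  subset₂ : Icc s t ⊆ I₂
  ratio_pos : 0 < c₀
  ratio_le_one : c₀ ≤ 1
  phase₁ : ∀ x ∈ Icc s t, ω₁ x = Complex.exp (Complex.I * b * ψ₁ x) * w₁ x
  phase₂ : ∀ x ∈ Icc s t, ω₂ x = Complex.exp (Complex.I * b * ψ₂ x) * w₂ x
  norm₁ : ∀ x ∈ Icc s t, ‖w₁ x‖ ≤ 1
  norm₂ : ∀ x ∈ Icc s t, ‖w₂ x‖ ≤ 1
  near₁ : ∀ x ∈ Icc s t, ∀ y ∈ Icc s t, |x - y| ≤ ℓ → ‖w₁ x - w₁ y‖ ≤ 1 / 4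
  near₂ : ∀ x ∈ Icc s t, ∀ y ∈ Icc s t, |x - y| ≤ ℓ → ‖w₂ x - w₂ y‖ ≤ 1 / 4
  ratio₁ : ∀ x ∈ Icc s t, c₀ * u₁ x ≤ u₂ x
  ratio₂ : ∀ x ∈ Icc s t, c₀ * u₂ x ≤ u₁ x
  continuousOn : ContinuousOn (fun x => ψ₁ x - ψ₂ x) (Icc s t)
  growth : ∀ x ∈ Icc s t, ∀ y ∈ Icc s t, x ≤ y → c * (y - x) ≤ (ψ₁ y - ψ₂ y) - (ψ₁ x - ψ₂ x)

variable {b c c₀ s t ℓ : ℝ} {ψ₁ ψ₂ : ℝ → ℝ} {w₁ w₂ : ℝ → ℂ}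

/-- Cancellation in a block `[p,q)` which is long enough for half a turn of the relative phase. -/
lemma RotatingPair.decomposes_block
    (P : RotatingPair α a H b c c₀ s t I₁ I₂ u₁ u₂ ω₁ ω₂ ψ₁ ψ₂ w₁ w₂ ℓ)
    (hα : 0 < α) (ha : 0 ≤ a) (hH : 0 ≤ H) (hb : b ≠ 0) {p q κ ξ : ℝ} (hp : s ≤ p) (hq : q ≤ t)
    (hpq : q - p ≤ ℓ) (hlen : Real.pi ≤ |b| * (c * (q - p))) (hκ : 0 < κ) (hκ' : κ ≤ q - p)
    (hκd : Real.exp (a * κ ^ (α : ℝ)) ≤ 1 + c₀ / 32 / 4) (hκH : H * κ ^ (α : ℝ) ≤ c₀ / 32 / 4)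
    (hξ : 0 ≤ ξ) (hξ' : ξ * Real.exp a * (q - p) ≤ κ) :
    Decomposes α a (2 * (H + 4 * a * Real.exp (2 * a)))
      (fun φ => atomFunctional (Ico p q) u₁ ω₁ φ + atomFunctional (Ico p q) u₂ ω₂ φ)
      (ENNReal.ofReal (1 - c₀ / 32 * ξ) * (atomMass (Ico p q) u₁ + atomMass (Ico p q) u₂))
      (3 * (atomSup I₁ u₁ + atomSup I₂ u₂)) := by
  have hc₀ := P.ratio_pos
  have hc₁ := P.ratio_le_one
  have hpq0 : p ≤ q := by linarith
  have hsub : Icc p q ⊆ Icc s t := Icc_subset_Icc hp hq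
  have hdist : ∀ x ∈ Icc p q, ∀ y ∈ Icc p q, |x - y| ≤ ℓ := fun x hx y hy => by
    rw [abs_le]; constructor <;> linarith [hx.1, hx.2, hy.1, hy.2]
  obtain ⟨x₀, hx₀, hcan⟩ := exists_cancelling_point (ω₁ := ω₁) (ω₂ := ω₂) (u₁ := u₁) (u₂ := u₂)
    (c := c) hc₀ hc₁ hb hpq0
    (fun x hx => P.phase₁ x (hsub hx)) (fun x hx => P.phase₂ x (hsub hx))
    (fun x hx => P.norm₁ x (hsub hx)) (fun x hx => P.norm₂ x (hsub hx))
    (fun x hx y hy => P.near₁ x (hsub hx) y (hsub hy) (hdist x hx y hy))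
    (fun x hx y hy => P.near₂ x (hsub hx) y (hsub hy) (hdist x hx y hy))
    (fun x hx => P.atom₁.pos x (P.subset₁ (hsub hx)))
    (fun x hx => P.atom₂.pos x (P.subset₂ (hsub hx)))
    (fun x hx => P.ratio₁ x (hsub hx)) (fun x hx => P.ratio₂ x (hsub hx))
    (P.continuousOn.mono hsub)
    (P.growth p (hsub (left_mem_Icc.2 hpq0)) q (hsub (right_mem_Icc.2 hpq0)) hpq0) hlen
  -- Half of the loss `c₀ / 16` found at `x₀`; the other half pays for moving away from `x₀`.
  set η : ℝ := c₀ / 32 with hη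
  have h2η : c₀ / 16 = 2 * η := by rw [hη]; ring
  have hη0 : 0 ≤ η := by rw [hη]; positivity
  have hη2 : η ≤ 1 / 2 := by rw [hη]; linarith
  rw [h2η] at hcan
  -- Left end of a window of length `κ` inside the block with `x₀` in its closure; it is shifted
  -- left when `x₀` is too close to `q`.
  set x₁ := min x₀ (q - κ) with hx₁
  have hx₁p : p ≤ x₁ := le_min hx₀.1 (by linarith)
  have hx₁q : x₁ + κ ≤ q := by linarith [min_le_right x₀ (q - κ)]
  have hx₁0 : x₁ ≤ x₀ := min_le_left _ _
  have hx₀1 : x₀ ≤ x₁ + κ := by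
    rw [hx₁, min_def]; split_ifs <;> linarith [hx₀.2]
  have hT : Ico x₁ (x₁ + κ) ⊆ Icc p q := fun x hx => ⟨hx₁p.trans hx.1, hx.2.le.trans hx₁q⟩
  have hTI₁ : Ico x₁ (x₁ + κ) ⊆ I₁ := hT.trans (hsub.trans P.subset₁)
  have hTI₂ : Ico x₁ (x₁ + κ) ⊆ I₂ := hT.trans (hsub.trans P.subset₂)
  have hI₁ : Icc p q ⊆ I₁ := hsub.trans P.subset₁
  have hI₂ : Icc p q ⊆ I₂ := hsub.trans P.subset₂
  have hcT : ∀ x ∈ Ico x₁ (x₁ + κ), ‖(u₁ x : ℂ) * ω₁ x + (u₂ x : ℂ) * ω₂ x‖ ≤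
      (1 - η) * (u₁ x + u₂ x) := by
    intro x hx
    have hxx : |x - x₀| ^ (α : ℝ) ≤ κ ^ (α : ℝ) := by
      refine Real.rpow_le_rpow (abs_nonneg _) ?_ α.2
      rw [abs_le]; constructor <;> linarith [hx.1, hx.2]
    refine norm_add_le_of_near P.atom₁ P.atom₂ hη0 hη2 (hTI₁ hx) (hTI₂ hx) (hI₁ hx₀) (hI₂ hx₀)
      hcan ?_ ?_
    · refine le_trans (Real.exp_le_exp.2 ?_) hκd
      gcongr
    · refine le_trans ?_ hκH
      gcongr
  have hm := IsAtom.merge ha (P.atom₁.restrict ordConnected_Ico hTI₁)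
    (P.atom₂.restrict ordConnected_Ico hTI₂) hη2 hcT
  set T := Ico x₁ (x₁ + κ) with hTdef
  have h1η : 0 ≤ 1 - η := by linarith
  -- the three parts
  have hLI₁ : Ico p x₁ ⊆ I₁ := fun x hx => hI₁ ⟨hx.1, by linarith [hx.2]⟩
  have hLI₂ : Ico p x₁ ⊆ I₂ := fun x hx => hI₂ ⟨hx.1, by linarith [hx.2]⟩
  have hRI₁ : Ico (x₁ + κ) q ⊆ I₁ := fun x hx => hI₁ ⟨by linarith [hx.1], hx.2.le⟩
  have hRI₂ : Ico (x₁ + κ) q ⊆ I₂ := fun x hx => hI₂ ⟨by linarith [hx.1], hx.2.le⟩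
  have aL₁ := P.atom₁.restrict ordConnected_Ico hLI₁
  have aL₂ := P.atom₂.restrict ordConnected_Ico hLI₂
  have aR₁ := P.atom₁.restrict ordConnected_Ico hRI₁
  have aR₂ := P.atom₂.restrict ordConnected_Ico hRI₂
  have hH2 : H ≤ 2 * (H + 4 * a * Real.exp (2 * a)) := by
    have : 0 ≤ 4 * a * Real.exp (2 * a) := by positivity
    linarith
  have fin : ∀ {J : Set ℝ} {v : ℝ → ℝ} {θ : ℝ → ℂ}, IsAtom α a H J v θ → atomMass J v ≠ ∞ :=
    fun hA => (hA.atomMass_lt_top ha).ne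
  have hsplit : Ico p q = (Ico p x₁ ∪ T) ∪ Ico (x₁ + κ) q := by
    rw [hTdef, Ico_union_Ico_eq_Ico hx₁p (by linarith), Ico_union_Ico_eq_Ico (by linarith) hx₁q]
  have hd₁ : Disjoint (Ico p x₁) T := by
    rw [Set.disjoint_left]; exact fun x hx hx' => absurd hx.2 (not_lt.2 hx'.1)
  have hd₂ : Disjoint (Ico p x₁ ∪ T) (Ico (x₁ + κ) q) := by
    rw [Set.disjoint_left]
    rintro x (hx | hx) hx'
    · linarith [hx.2, hx'.1]
    · linarith [hx.2, hx'.1]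
  have hmass : ∀ v : ℝ → ℝ, atomMass (Ico p q) v =
      atomMass T v + (atomMass (Ico p x₁) v + atomMass (Ico (x₁ + κ) q) v) := by
    intro v
    rw [hsplit, atomMass_union measurableSet_Ico hd₂, atomMass_union measurableSet_Ico hd₁]
    ring
  have hfun : ∀ {J : Set ℝ} {v : ℝ → ℝ} {θ : ℝ → ℂ} {φ : ℝ → ℂ}, IsAtom α a H J v θ →
      Icc p q ⊆ J → IsTest φ →
      atomFunctional (Ico p q) v θ φ = atomFunctional (Ico p x₁) v θ φ +
        atomFunctional T v θ φ + atomFunctional (Ico (x₁ + κ) q) v θ φ := by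
    intro J v θ φ hA hJ hφ
    rw [hsplit, hA.atomFunctional_union hα ha hφ measurableSet_Ico hd₂
      (union_subset (fun x hx => hJ ⟨hx.1, by linarith [hx.2]⟩) (hT.trans hJ))
      (fun x hx => hJ ⟨by linarith [hx.1], hx.2.le⟩),
      hA.atomFunctional_union hα ha hφ measurableSet_Ico hd₁
      (fun x hx => hJ ⟨hx.1, by linarith [hx.2]⟩) (hT.trans hJ)]
  have hT₁ := P.atom₁.restrict (J := T) ordConnected_Ico hTI₁
  have hT₂ := P.atom₂.restrict (J := T) ordConnected_Ico hTI₂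
  have hmm : atomMass T (fun x => (1 - η) * (u₁ x + u₂ x)) =
      ENNReal.ofReal (1 - η) * (atomMass T u₁ + atomMass T u₂) := by
    unfold atomMass
    rw [← lintegral_add_left' (((hT₁.continuousOn_density hα).aemeasurable
      measurableSet_Ico).ennreal_ofReal), ← lintegral_const_mul' _ _ ENNReal.ofReal_ne_top]
    refine setLIntegral_congr_fun measurableSet_Ico fun x hx => ?_
    simp only
    rw [← ENNReal.ofReal_add (hT₁.pos x hx).le (hT₂.pos x hx).le, ← ENNReal.ofReal_mul h1η]
  have hms : atomSup T (fun x => (1 - η) * (u₁ x + u₂ x)) ≤ atomSup I₁ u₁ + atomSup I₂ u₂ := by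
    refine iSup₂_le fun x hx => ?_
    have e1 := hT₁.pos x hx
    have e2 := hT₂.pos x hx
    calc ENNReal.ofReal ((1 - η) * (u₁ x + u₂ x)) ≤ ENNReal.ofReal (u₁ x + u₂ x) := by
          apply ENNReal.ofReal_le_ofReal; nlinarith
      _ = ENNReal.ofReal (u₁ x) + ENNReal.ofReal (u₂ x) := ENNReal.ofReal_add e1.le e2.le
      _ ≤ _ := add_le_add (le_biSup (fun x => ENNReal.ofReal (u₁ x)) (hTI₁ hx))
          (le_biSup (fun x => ENNReal.ofReal (u₂ x)) (hTI₂ hx))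
  have D₁ := ((Decomposes.of_isAtom aL₁).add ha (Decomposes.of_isAtom aL₂) (fin aL₁) (fin aL₂)).add
    ha ((Decomposes.of_isAtom aR₁).add ha (Decomposes.of_isAtom aR₂) (fin aR₁) (fin aR₂))
    (ENNReal.add_ne_top.2 ⟨fin aL₁, fin aL₂⟩) (ENNReal.add_ne_top.2 ⟨fin aR₁, fin aR₂⟩)
  -- One merged atom on the window and four untouched remainders. The window, the left parts and the
  -- right parts each cost at most the sum of the two suprema, hence the factor `3`.
  have D₂ := (Decomposes.of_isAtom hm).add ha (D₁.mono hH2 le_rfl le_rfl)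
    (hm.atomMass_lt_top ha).ne (by simp [fin aL₁, fin aL₂, fin aR₁, fin aR₂])
  refine (D₂.mono le_rfl ?_ ?_).congr fun φ hφ => ?_
  · rw [hmm, hmass u₁, hmass u₂]
    have hx : ∀ {J : Set ℝ} {v : ℝ → ℝ} {θ : ℝ → ℂ}, IsAtom α a H J v θ → Icc p q ⊆ J →
        ENNReal.ofReal ξ * (atomMass T v + (atomMass (Ico p x₁) v + atomMass (Ico (x₁ + κ) q) v))
          ≤ atomMass T v := by
      intro J v θ hA hJ
      rw [← hmass v]
      have hA' := hA.restrict (J := Ico p q) ordConnected_Ico (Ico_subset_Icc_self.trans hJ)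
      have hTs : T ⊆ Ico p q := fun x hx => ⟨hx₁p.trans hx.1, hx.2.trans_le hx₁q⟩
      have h1 := hA'.volume_mul_atomMass_le ha (J := T) ordConnected_Ico hTs
      rw [hTdef, Real.volume_Ico, Real.volume_Ico, add_sub_cancel_left, ← mul_assoc,
        ← ENNReal.ofReal_mul (Real.exp_pos _).le] at h1
      have hqp : 0 < Real.exp a * (q - p) := mul_pos (Real.exp_pos _) (by linarith)
      rw [← ENNReal.mul_le_mul_iff_right (ENNReal.ofReal_pos.2 hqp).ne' ENNReal.ofReal_ne_top]
      refine le_trans ?_ h1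
      rw [← mul_assoc, ← ENNReal.ofReal_mul hqp.le]
      gcongr
      linarith
    have hξ1 : ξ ≤ 1 := by
      have h1 : 1 ≤ Real.exp a := Real.one_le_exp ha
      have h2 : 0 < q - p := by linarith
      by_contra! hcon
      have h3 : 1 < ξ * Real.exp a := by nlinarith
      nlinarith
    have e₁ := ofReal_one_sub_mul_add_le hη0 (by linarith) hξ hξ1 (fin hT₁)
      (ENNReal.add_ne_top.2 ⟨fin aL₁, fin aR₁⟩) (hx P.atom₁ hI₁)
    have e₂ := ofReal_one_sub_mul_add_le hη0 (by linarith) hξ hξ1 (fin hT₂)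
      (ENNReal.add_ne_top.2 ⟨fin aL₂, fin aR₂⟩) (hx P.atom₂ hI₂)
    rw [mul_add (ENNReal.ofReal (1 - η * ξ))]
    refine le_trans (le_of_eq ?_) (add_le_add e₁ e₂)
    ring
  · have s₁ := atomSup_mono (u := u₁) hLI₁
    have s₂ := atomSup_mono (u := u₂) hLI₂
    have s₃ := atomSup_mono (u := u₁) hRI₁
    have s₄ := atomSup_mono (u := u₂) hRI₂
    refine (add_le_add hms (add_le_add (add_le_add s₁ s₂) (add_le_add s₃ s₄))).trans_eq ?_
    ring
  · rw [hfun P.atom₁ hI₁ hφ, hfun P.atom₂ hI₂ hφ]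
    have hmf : atomFunctional T (fun x => (1 - η) * (u₁ x + u₂ x))
        (fun x => ((u₁ x : ℂ) * ω₁ x + (u₂ x : ℂ) * ω₂ x) / (((1 - η) * (u₁ x + u₂ x) : ℝ) : ℂ)) φ =
        atomFunctional T u₁ ω₁ φ + atomFunctional T u₂ ω₂ φ := by
      unfold atomFunctional
      rw [← integral_add (hT₁.integrableOn hα ha hφ) (hT₂.integrableOn hα ha hφ)]
      refine setIntegral_congr_fun measurableSet_Ico fun x hx => ?_
      have e1 := hT₁.pos x hx
      have e2 := hT₂.pos x hx
      have e3 : 0 < 1 - η := by linarith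
      have hne : (((1 - η) * (u₁ x + u₂ x) : ℝ) : ℂ) ≠ 0 :=
        Complex.ofReal_ne_zero.2 (by positivity)
      simp only
      rw [mul_div_cancel₀ _ hne]
      ring
    rw [hmf]
    ring

end SkewProduct

/-! ### Cancellation on an overlap, inserted into a family of atoms. -/

namespace SkewProduct

open Filter Topology ComplexConjugate

variable {α : ℝ≥0} {a H H' : ℝ} {I I₁ I₂ T : Set ℝ} {u u₁ u₂ : ℝ → ℝ} {ω ω₁ ω₂ φ : ℝ → ℂ}
variable {b c c₀ s t ℓ : ℝ} {ψ₁ ψ₂ : ℝ → ℝ} {w₁ w₂ : ℝ → ℂ}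

/-- Cancellation on the whole overlap, by cutting it into `N` blocks. -/
lemma RotatingPair.decomposes
    (P : RotatingPair α a H b c c₀ s t I₁ I₂ u₁ u₂ ω₁ ω₂ ψ₁ ψ₂ w₁ w₂ ℓ)
    (hα : 0 < α) (ha : 0 ≤ a) (hH : 0 ≤ H) (hb : b ≠ 0) (hst : s ≤ t) {N : ℕ} (hN : N ≠ 0) {κ ξ : ℝ}
    (hℓ : (t - s) / N ≤ ℓ) (hlen : Real.pi ≤ |b| * (c * ((t - s) / N))) (hκ : 0 < κ)
    (hκ' : κ ≤ (t - s) / N)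
    (hκd : Real.exp (a * κ ^ (α : ℝ)) ≤ 1 + c₀ / 32 / 4) (hκH : H * κ ^ (α : ℝ) ≤ c₀ / 32 / 4)
    (hξ : 0 ≤ ξ) (hξ' : ξ * Real.exp a * ((t - s) / N) ≤ κ) :
    Decomposes α a (2 * (H + 4 * a * Real.exp (2 * a)))
      (fun φ => atomFunctional (Ico s t) u₁ ω₁ φ + atomFunctional (Ico s t) u₂ ω₂ φ)
      (ENNReal.ofReal (1 - c₀ / 32 * ξ) * (atomMass (Ico s t) u₁ + atomMass (Ico s t) u₂))
      (N * (3 * (atomSup I₁ u₁ + atomSup I₂ u₂))) := by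
  set d := (t - s) / N with hd
  have hN0 : (0 : ℝ) < N := by exact_mod_cast Nat.pos_of_ne_zero hN
  have hd0 : 0 ≤ d := div_nonneg (by linarith) hN0.le
  have hNd : N * d = t - s := by rw [hd]; field_simp
  have key : ∀ k : ℕ, k ≤ N → Decomposes α a (2 * (H + 4 * a * Real.exp (2 * a)))
      (fun φ => atomFunctional (Ico s (s + k * d)) u₁ ω₁ φ +
        atomFunctional (Ico s (s + k * d)) u₂ ω₂ φ)
      (ENNReal.ofReal (1 - c₀ / 32 * ξ) *
        (atomMass (Ico s (s + k * d)) u₁ + atomMass (Ico s (s + k * d)) u₂))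
      (k * (3 * (atomSup I₁ u₁ + atomSup I₂ u₂))) := by
    intro k
    induction k with
    | zero =>
      intro _
      have h0 : IsAtom α a H ∅ u₁ ω₁ := P.atom₁.restrict ordConnected_empty (empty_subset _)
      have hH2 : H ≤ 2 * (H + 4 * a * Real.exp (2 * a)) := by
        have : 0 ≤ 4 * a * Real.exp (2 * a) := by positivity
        linarith
      refine (((Decomposes.of_isAtom h0).mono hH2 ?_ ?_).congr fun φ _ => ?_)
      · simp [atomMass]
      · simp [atomSup]
      · simp [atomFunctional]
    | succ k ih =>
      intro hk
      have ih' := ih (by omega)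
      have hkN : ((k : ℝ) + 1) * d ≤ t - s := by
        rw [← hNd]
        have : (k : ℝ) + 1 ≤ N := by exact_mod_cast hk
        gcongr
      have hk0 : 0 ≤ (k : ℝ) * d := by positivity
      have hw : s + ((k : ℝ) + 1) * d - (s + k * d) = d := by ring
      have hb' := P.decomposes_block hα ha hH hb (p := s + k * d) (q := s + ((k : ℝ) + 1) * d)
        (κ := κ) (ξ := ξ) (by linarith) (by linarith) (by rwa [hw]) (by rwa [hw]) hκ (by rwa [hw])
        hκd hκH hξ (by rwa [hw])
      have hle : s + k * d ≤ s + ((k : ℝ) + 1) * d := by linarith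
      have hun : Ico s (s + ((k : ℝ) + 1) * d) =
          Ico s (s + k * d) ∪ Ico (s + k * d) (s + ((k : ℝ) + 1) * d) :=
        (Ico_union_Ico_eq_Ico (by linarith) hle).symm
      have hdis : Disjoint (Ico s (s + k * d)) (Ico (s + k * d) (s + ((k : ℝ) + 1) * d)) := by
        rw [Set.disjoint_left]; exact fun x hx hx' => absurd hx.2 (not_lt.2 hx'.1)
      have hs1 : Ico s (s + k * d) ⊆ Icc s t := fun x hx => ⟨hx.1, by linarith [hx.2]⟩
      have hs2 : Ico (s + k * d) (s + ((k : ℝ) + 1) * d) ⊆ Icc s t := fun x hx =>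
        ⟨by linarith [hx.1], by linarith [hx.2]⟩
      have fin₁ : ∀ {J}, J.OrdConnected → J ⊆ Icc s t → atomMass J u₁ ≠ ∞ := fun hJ hJs =>
        ((P.atom₁.restrict hJ (hJs.trans P.subset₁)).atomMass_lt_top ha).ne
      have fin₂ : ∀ {J}, J.OrdConnected → J ⊆ Icc s t → atomMass J u₂ ≠ ∞ := fun hJ hJs =>
        ((P.atom₂.restrict hJ (hJs.trans P.subset₂)).atomMass_lt_top ha).ne
      have hsum := ih'.add ha hb'
        (ENNReal.mul_ne_top ENNReal.ofReal_ne_top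
          (ENNReal.add_ne_top.2 ⟨fin₁ ordConnected_Ico hs1, fin₂ ordConnected_Ico hs1⟩))
        (ENNReal.mul_ne_top ENNReal.ofReal_ne_top
          (ENNReal.add_ne_top.2 ⟨fin₁ ordConnected_Ico hs2, fin₂ ordConnected_Ico hs2⟩))
      push_cast
      rw [hun]
      refine (hsum.mono le_rfl (le_of_eq ?_) (le_of_eq ?_)).congr fun φ hφ => ?_
      · rw [atomMass_union measurableSet_Ico hdis, atomMass_union measurableSet_Ico hdis]
        ring
      · ring
      · rw [P.atom₁.atomFunctional_union hα ha hφ measurableSet_Ico hdis (hs1.trans P.subset₁)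
          (hs2.trans P.subset₁), P.atom₂.atomFunctional_union hα ha hφ measurableSet_Ico hdis
          (hs1.trans P.subset₂) (hs2.trans P.subset₂)]
        ring
  have := key N le_rfl
  rwa [hNd, add_sub_cancel] at this

/-- Replace the contribution of two members of a family of atoms on a common interval. -/
lemma Decomposes.exchange {ι : Type} [Countable ι] {I : ι → Set ℝ} {u : ι → ℝ → ℝ} {ω : ι → ℝ → ℂ}
    {Λ : (ℝ → ℂ) → ℂ} (hα : 0 < α) (ha : 0 ≤ a) (hA : ∀ i, IsAtom α a H (I i) (u i) (ω i))
    (hH : H ≤ H') {m : ℝ≥0∞} (hm : ∑' i, atomMass (I i) (u i) ≤ m) (hm' : m ≠ ∞)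
    (hΛ : ∀ φ, IsTest φ → HasSum (fun i => atomFunctional (I i) (u i) (ω i) φ) (Λ φ))
    {i j : ι} (hij : i ≠ j) (hst : s ≤ t) (hi : Ico s t ⊆ I i) (hj : Ico s t ⊆ I j)
    {η ζ : ℝ} (hη : 0 ≤ η) (hη' : η ≤ 1) (hζ : 0 ≤ ζ) (hζ' : ζ ≤ 1) {zJ : ℝ≥0∞}
    (hD : Decomposes α a H'
      (fun φ => atomFunctional (Ico s t) (u i) (ω i) φ + atomFunctional (Ico s t) (u j) (ω j) φ)
      (ENNReal.ofReal (1 - η) * (atomMass (Ico s t) (u i) + atomMass (Ico s t) (u j))) zJ)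
    (hJ : ENNReal.ofReal ζ * m ≤ atomMass (Ico s t) (u i) + atomMass (Ico s t) (u j)) :
    Decomposes α a H' Λ (ENNReal.ofReal (1 - η * ζ) * m)
      (2 * ∑' i, atomSup (I i) (u i) + zJ) := by
  classical
  have hLc : ∀ k, OrdConnected (if k = i ∨ k = j then Iio s else univ : Set ℝ) := fun k => by
    split_ifs <;> infer_instance
  have hRc : ∀ k, OrdConnected (if k = i ∨ k = j then Ici t else ∅ : Set ℝ) := fun k => by
    split_ifs
    · infer_instance
    · exact ordConnected_empty
  -- Only the members `i` and `j` are cut, into the parts before `s`, from `t` on, and the middle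
  -- `[s,t)`. Every other atom is kept whole in `L`, with empty `R` and `M`.
  set L : ι → Set ℝ := fun k => I k ∩ if k = i ∨ k = j then Iio s else univ with hL
  set R : ι → Set ℝ := fun k => I k ∩ if k = i ∨ k = j then Ici t else ∅ with hR
  set M : ι → Set ℝ := fun k => if k = i ∨ k = j then Ico s t else ∅ with hM
  have aL : ∀ k, IsAtom α a H (L k) (u k) (ω k) := fun k => (hA k).inter (hLc k)
  have aR : ∀ k, IsAtom α a H (R k) (u k) (ω k) := fun k => (hA k).inter (hRc k)
  have hMI : ∀ k, M k ⊆ I k := fun k => by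
    simp only [hM]
    split_ifs with hk
    · rcases hk with rfl | rfl
      · exact hi
      · exact hj
    · exact empty_subset _
  have hMc : ∀ k, (M k).OrdConnected := fun k => by
    simp only [hM]
    split_ifs
    · exact ordConnected_Ico
    · exact ordConnected_empty
  have aM : ∀ k, IsAtom α a H (M k) (u k) (ω k) := fun k => (hA k).restrict (hMc k) (hMI k)
  have hLR : ∀ k, Disjoint (L k) (R k) := fun k => by
    rw [Set.disjoint_left]
    simp only [hL, hR]
    split_ifs
    · rintro x ⟨-, hx⟩ ⟨-, hx'⟩
      rw [mem_Iio] at hx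
      rw [mem_Ici] at hx'
      linarith
    · rintro x - ⟨-, hx'⟩
      exact hx'
  have hLRM : ∀ k, Disjoint (L k ∪ R k) (M k) := fun k => by
    rw [Set.disjoint_left]
    simp only [hL, hR, hM]
    split_ifs
    · rintro x (⟨-, hx⟩ | ⟨-, hx⟩) hx'
      · exact absurd hx (not_lt.2 hx'.1)
      · exact absurd hx'.2 (not_lt.2 hx)
    · exact fun x _ hx' => hx'
  have hU : ∀ k, I k = (L k ∪ R k) ∪ M k := fun k => by
    refine Subset.antisymm (fun x hx => ?_)
      (union_subset (union_subset inter_subset_left inter_subset_left) (hMI k))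
    simp only [hL, hR, hM]
    split_ifs
    · by_cases h1 : x < s
      · exact Or.inl (Or.inl ⟨hx, h1⟩)
      · by_cases h2 : x < t
        · exact Or.inr ⟨not_lt.1 h1, h2⟩
        · exact Or.inl (Or.inr ⟨hx, not_lt.1 h2⟩)
    · exact Or.inl (Or.inl ⟨hx, mem_univ _⟩)
  have hmass : ∀ k, atomMass (I k) (u k) =
      atomMass (M k) (u k) + (atomMass (L k) (u k) + atomMass (R k) (u k)) := fun k => by
    rw [hU k, atomMass_union (aM k).measurableSet (hLRM k),
      atomMass_union (aR k).measurableSet (hLR k)]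
    ring
  have hfun : ∀ φ, IsTest φ → ∀ k, atomFunctional (I k) (u k) (ω k) φ =
      atomFunctional (L k) (u k) (ω k) φ + atomFunctional (R k) (u k) (ω k) φ +
        atomFunctional (M k) (u k) (ω k) φ := fun φ hφ k => by
    have e1 : L k ⊆ I k := inter_subset_left
    have e2 : R k ⊆ I k := inter_subset_left
    rw [← (hA k).atomFunctional_union hα ha hφ (aR k).measurableSet (hLR k) e1 e2,
      ← (hA k).atomFunctional_union hα ha hφ (aM k).measurableSet (hLRM k) (union_subset e1 e2)
        (hMI k), ← hU k]
  have hMsum : ∀ {E : Type} [AddCommMonoid E] [TopologicalSpace E] (F : ι → E),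
      (∀ k, k ≠ i → k ≠ j → F k = 0) → HasSum F (F i + F j) := by
    intro E _ _ F hF
    have : HasSum F (∑ k ∈ {i, j}, F k) := hasSum_sum_of_ne_finset_zero (fun k hk => by
      simp only [Finset.mem_insert, Finset.mem_singleton, not_or] at hk
      exact hF k hk.1 hk.2)
    rwa [Finset.sum_pair hij] at this
  have hMi : M i = Ico s t := by simp [hM]
  have hMj : M j = Ico s t := by simp [hM]
  have hMk : ∀ k, k ≠ i → k ≠ j → M k = ∅ := fun k h1 h2 => by simp [hM, h1, h2]
  have hMmass : ∑' k, atomMass (M k) (u k) =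
      atomMass (Ico s t) (u i) + atomMass (Ico s t) (u j) := by
    have := (hMsum (fun k => atomMass (M k) (u k))
      (fun k h1 h2 => by simp [hMk k h1 h2, atomMass])).tsum_eq
    rwa [hMi, hMj] at this
  set x := atomMass (Ico s t) (u i) + atomMass (Ico s t) (u j) with hx
  set yL := ∑' k, atomMass (L k) (u k) with hyL
  set yR := ∑' k, atomMass (R k) (u k) with hyR
  have hxy : x + (yL + yR) ≤ m := by
    rw [← hMmass, hyL, hyR, ← ENNReal.tsum_add, ← ENNReal.tsum_add,
      ← tsum_congr hmass]
    exact hm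
  have hxy' := ENNReal.add_lt_top.1 (hxy.trans_lt hm'.lt_top)
  have hfin : x < ∞ ∧ yL < ∞ ∧ yR < ∞ := ⟨hxy'.1, ENNReal.add_lt_top.1 hxy'.2⟩
  have sumL : ∀ φ, IsTest φ → Summable fun k => atomFunctional (L k) (u k) (ω k) φ := fun φ hφ =>
    Summable.of_norm_bounded (ENNReal.summable_toReal hfin.2.1.ne)
      fun k => (aL k).norm_atomFunctional_le ha hφ
  have sumR : ∀ φ, IsTest φ → Summable fun k => atomFunctional (R k) (u k) (ω k) φ := fun φ hφ =>
    Summable.of_norm_bounded (ENNReal.summable_toReal hfin.2.2.ne)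
      fun k => (aR k).norm_atomFunctional_le ha hφ
  have DL : Decomposes α a H' (fun φ => ∑' k, atomFunctional (L k) (u k) (ω k) φ) yL
      (∑' k, atomSup (I k) (u k)) :=
    ⟨ι, inferInstance, L, u, ω, fun k => (aL k).mono hH, le_rfl,
      ENNReal.tsum_le_tsum fun k => atomSup_mono inter_subset_left, fun φ hφ => (sumL φ hφ).hasSum⟩
  have DR : Decomposes α a H' (fun φ => ∑' k, atomFunctional (R k) (u k) (ω k) φ) yR
      (∑' k, atomSup (I k) (u k)) :=
    ⟨ι, inferInstance, R, u, ω, fun k => (aR k).mono hH, le_rfl,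
      ENNReal.tsum_le_tsum fun k => atomSup_mono inter_subset_left, fun φ hφ => (sumR φ hφ).hasSum⟩
  have hy : yL + yR ≠ ∞ := ENNReal.add_ne_top.2 ⟨hfin.2.1.ne, hfin.2.2.ne⟩
  have D := hD.add ha (DL.add ha DR hfin.2.1.ne hfin.2.2.ne)
    (ENNReal.mul_ne_top ENNReal.ofReal_ne_top hfin.1.ne) hy
  refine (D.mono le_rfl ?_ (le_of_eq (by ring))).congr fun φ hφ => ?_
  · refine (ofReal_one_sub_mul_add_le hη hη' hζ hζ' hfin.1.ne hy ?_).trans (by gcongr)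
    exact le_trans (by gcongr) hJ
  · have h1 := hMsum (fun k => atomFunctional (M k) (u k) (ω k) φ)
      (fun k h1 h2 => by simp [hMk k h1 h2, atomFunctional])
    simp only [hMi, hMj] at h1
    have h2 := ((sumL φ hφ).hasSum.add (sumR φ hφ).hasSum).add h1
    rw [funext fun k => (hfun φ hφ k).symm] at h2
    rw [(hΛ φ hφ).unique h2]
    ring

end SkewProduct

/-! ### A long atom loses a fixed proportion of its mass. -/

namespace SkewProduct

open Filter Topology

variable {α : ℝ≥0} {f τ : ℝ → ℝ} {S R : Set ℝ} {l D C a : ℝ}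
variable {H b c : ℝ} {I O O₁ O₂ : Set ℝ} {u : ℝ → ℝ} {ω φ : ℝ → ℂ} {n : ℕ}

lemma IsAtom.exists_Ioo_subset (hA : IsAtom α a H I u ω) {δ : ℝ} (hδ : 0 < δ)
    (hI : ENNReal.ofReal δ ≤ volume I) :
    ∃ p q, 0 ≤ p ∧ q ≤ 1 ∧ δ ≤ q - p ∧ Ioo p q ⊆ I := by
  have hne : I.Nonempty := by
    rw [nonempty_iff_ne_empty]
    rintro rfl
    rw [measure_empty, nonpos_iff_eq_zero, ENNReal.ofReal_eq_zero] at hI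
    linarith
  have hbb : BddBelow I := ⟨0, fun x hx => (hA.subset hx).1.le⟩
  have hba : BddAbove I := ⟨1, fun x hx => (hA.subset hx).2.le⟩
  refine ⟨sInf I, sSup I, le_csInf hne fun x hx => (hA.subset hx).1.le,
    csSup_le hne fun x hx => (hA.subset hx).2.le, ?_, fun x hx => ?_⟩
  · have h1 : volume I ≤ ENNReal.ofReal (sSup I - sInf I) := by
      rw [← Real.volume_Icc]
      exact measure_mono fun x hx => ⟨csInf_le hbb hx, le_csSup hba hx⟩
    by_contra! hcon
    exact absurd (hI.trans h1) (not_le.2 ((ENNReal.ofReal_lt_ofReal_iff hδ).2 hcon))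
  · obtain ⟨y, hy, hyx⟩ := exists_lt_of_csInf_lt hne hx.1
    obtain ⟨z, hz, hxz⟩ := exists_lt_of_lt_csSup hne hx.2
    exact hA.ordConnected.out hy hz ⟨hyx.le, hxz.le⟩

lemma exists_pos_small (hα : 0 < α) {K E d : ℝ} (hE : 0 < E) (hd : 0 < d) :
    ∃ κ > 0, κ ≤ d ∧ Real.exp (a * κ ^ (α : ℝ)) ≤ 1 + E ∧ K * κ ^ (α : ℝ) ≤ E := by
  have h0 : Tendsto (fun x : ℝ => |x| ^ (α : ℝ)) (𝓝 0) (𝓝 0) := by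
    simpa using IsAtom.tendsto_rpow_abs_sub hα 0
  have h1 := (h0.const_mul K).eventually (ge_mem_nhds (show K * 0 < E by simpa using hE))
  have h2 := ((Real.continuous_exp.tendsto _).comp (h0.const_mul a)).eventually
    (ge_mem_nhds (show Real.exp (a * 0) < 1 + E by simpa using hE))
  have h3 : ∀ᶠ x : ℝ in 𝓝[>] 0, 0 < x := self_mem_nhdsWithin
  have h4 : ∀ᶠ x : ℝ in 𝓝[>] 0, x ≤ d := nhdsWithin_le_nhds (ge_mem_nhds hd)
  have h5 : ∀ᶠ x : ℝ in 𝓝[>] 0, K * |x| ^ (α : ℝ) ≤ E := nhdsWithin_le_nhds h1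
  have h6 := h2.filter_mono (nhdsWithin_le_nhds (s := Ioi (0 : ℝ)))
  obtain ⟨κ, e1, e2, e3, e4⟩ := (h3.and (h4.and (h5.and h6))).exists
  rw [abs_of_pos e1] at e3
  simp only [Function.comp_apply, abs_of_pos e1] at e4
  exact ⟨κ, e1, e2, e4, e3⟩

lemma UniformBounds.abs_deriv_branch_le_one (B : UniformBounds α f τ S R l D C a)
    (hO : O ∈ pieces f S n) {x : ℝ} (hx : x ∈ f^[n] '' O) : |deriv (branch f n O) x| ≤ 1 := by
  refine (B.setting.abs_deriv_branch_le B.expanding hO hx).trans ?_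
  rw [Real.exp_le_one_iff, neg_nonpos]
  have := B.log_pos
  positivity

/-- The density `u` varies by at most `e^a` over `I`, and the two branch derivatives lie between `r`
and `1`. -/
lemma UniformBounds.mul_pushDensity_le (B : UniformBounds α f τ S R l D C a)
    (hA : IsAtom α a H I u ω) (hO₁ : O₁ ∈ pieces f S n) (hO₂ : O₂ ∈ pieces f S n) {r x : ℝ}
    (hr : 0 ≤ r) (hx₁ : x ∈ f^[n] '' (O₁ ∩ I)) (hx₂ : x ∈ f^[n] '' (O₂ ∩ I))
    (hrx : r ≤ |deriv (branch f n O₂) x|) :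
    r * Real.exp (-a) * pushDensity f n O₁ u x ≤ pushDensity f n O₂ u x := by
  obtain ⟨i₁, j₁⟩ := mem_of_mem_image_inter B.setting hO₁ hx₁
  obtain ⟨i₂, j₂⟩ := mem_of_mem_image_inter B.setting hO₂ hx₂
  have h1 := hA.le_exp B.holder_nonneg j₁ j₂
  have h2 := B.abs_deriv_branch_le_one hO₁ i₁
  have p₁ := hA.pos _ j₁
  have p₂ := hA.pos _ j₂
  unfold pushDensity
  calc _ ≤ r * Real.exp (-a) * ((Real.exp a * u (branch f n O₂ x)) * 1) := by gcongr
    _ = (Real.exp (-a) * Real.exp a) * (u (branch f n O₂ x) * r) := by ring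
    _ = u (branch f n O₂ x) * r := by rw [← Real.exp_add]; simp
    _ ≤ _ := by gcongr

/-- Since `I` has length at most `1`, `u` is at least `e^{-a}` times the mass. One factor `r` comes
from the derivative and one from the length of `[s,t]`. -/
lemma UniformBounds.mul_atomMass_le_push (B : UniformBounds α f τ S R l D C a)
    (hA : IsAtom α a H I u ω) (hO : O ∈ pieces f S n) {r s t : ℝ} (hr : 0 ≤ r) (hst : r ≤ t - s)
    (hsub : Icc s t ⊆ f^[n] '' (O ∩ I)) (hd : ∀ x ∈ Icc s t, r ≤ |deriv (branch f n O) x|) :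
    ENNReal.ofReal (r ^ 2 * Real.exp (-a)) * atomMass I u ≤
      atomMass (Ico s t) (pushDensity f n O u) := by
  have hvol : volume I ≤ 1 := (measure_mono hA.subset).trans (by simp)
  have key : ∀ x ∈ Ico s t, ENNReal.ofReal (r * Real.exp (-a)) * atomMass I u ≤
      ENNReal.ofReal (pushDensity f n O u x) := by
    intro x hx
    have hx' := Ico_subset_Icc_self hx
    obtain ⟨i, j⟩ := mem_of_mem_image_inter B.setting hO (hsub hx')
    have hm : atomMass I u ≤ ENNReal.ofReal (Real.exp a * u (branch f n O x)) := by
      calc atomMass I u ≤ ∫⁻ _ in I, ENNReal.ofReal (Real.exp a * u (branch f n O x)) :=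
            setLIntegral_mono' hA.measurableSet fun y hy =>
              ENNReal.ofReal_le_ofReal (hA.le_exp B.holder_nonneg hy j)
        _ = ENNReal.ofReal (Real.exp a * u (branch f n O x)) * volume I := setLIntegral_const _ _
        _ ≤ ENNReal.ofReal (Real.exp a * u (branch f n O x)) * 1 := by gcongr
        _ = _ := mul_one _
    calc _ ≤ ENNReal.ofReal (r * Real.exp (-a)) *
          ENNReal.ofReal (Real.exp a * u (branch f n O x)) := by gcongr
      _ = ENNReal.ofReal (u (branch f n O x) * r) := by
          rw [← ENNReal.ofReal_mul (by positivity)]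
          congr 1
          calc _ = (Real.exp (-a) * Real.exp a) * (u (branch f n O x) * r) := by ring
            _ = _ := by rw [← Real.exp_add]; simp
      _ ≤ _ := by
          have := hA.pos _ j
          apply ENNReal.ofReal_le_ofReal
          unfold pushDensity
          have := hd x hx'
          gcongr
  calc _ = ENNReal.ofReal (r * Real.exp (-a)) * atomMass I u * ENNReal.ofReal r := by
        rw [show r ^ 2 * Real.exp (-a) = (r * Real.exp (-a)) * r by ring,
          ENNReal.ofReal_mul (by positivity)]
        ring
    _ ≤ ENNReal.ofReal (r * Real.exp (-a)) * atomMass I u * volume (Ico s t) := by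
        rw [Real.volume_Ico]; gcongr
    _ = ∫⁻ _ in Ico s t, ENNReal.ofReal (r * Real.exp (-a)) * atomMass I u :=
        (setLIntegral_const _ _).symm
    _ ≤ _ := setLIntegral_mono' measurableSet_Ico key

/-- Two transported atoms over a transversal pair of branches form a rotating pair. -/
lemma UniformBounds.rotatingPair (B : UniformBounds α f τ S R l D C a) {A r s t ℓ : ℝ}
    (hA : IsAtom α a (A * |b| ^ (α : ℝ)) I u ω) (hA0 : 0 ≤ A) (hn : 1 ≤ n)
    (hO₁ : O₁ ∈ pieces f S n) (hO₂ : O₂ ∈ pieces f S n) (hr : 0 < r) (hr₁ : r ≤ 1)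
    (h₁ : Icc s t ⊆ f^[n] '' (O₁ ∩ I)) (h₂ : Icc s t ⊆ f^[n] '' (O₂ ∩ I))
    (hd : ∀ x ∈ Icc s t, r ≤ |deriv (branch f n O₁) x| ∧ r ≤ |deriv (branch f n O₂) x|)
    (hg : ∀ x ∈ Icc s t, ∀ y ∈ Icc s t, x ≤ y → c * (y - x) ≤
      (birkhoffSum f τ n (branch f n O₁ y) - birkhoffSum f τ n (branch f n O₂ y)) -
      (birkhoffSum f τ n (branch f n O₁ x) - birkhoffSum f τ n (branch f n O₂ x)))
    (hℓ : A * (Real.exp (-l) ^ (α : ℝ)) ^ n * (|b| * ℓ) ^ (α : ℝ) ≤ 1 / 4) (hℓ0 : 0 ≤ ℓ) :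
    RotatingPair α a ((Real.exp (-l) ^ (α : ℝ)) ^ n * (A * |b| ^ (α : ℝ)) +
        2 * (C * |b|) ^ (α : ℝ)) b c
      (r * Real.exp (-a)) s t (f^[n] '' (O₁ ∩ I)) (f^[n] '' (O₂ ∩ I)) (pushDensity f n O₁ u)
      (pushDensity f n O₂ u) (pushPhase f τ b n O₁ ω) (pushPhase f τ b n O₂ ω)
      (fun x => birkhoffSum f τ n (branch f n O₁ x)) (fun x => birkhoffSum f τ n (branch f n O₂ x))
      (fun x => ω (branch f n O₁ x)) (fun x => ω (branch f n O₂ x)) ℓ := by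
  have near : ∀ O ∈ pieces f S n, Icc s t ⊆ f^[n] '' (O ∩ I) → ∀ x ∈ Icc s t, ∀ y ∈ Icc s t,
      |x - y| ≤ ℓ → ‖ω (branch f n O x) - ω (branch f n O y)‖ ≤ 1 / 4 := by
    intro O hO hsub x hx y hy hxy
    obtain ⟨i, j⟩ := mem_of_mem_image_inter B.setting hO (hsub hx)
    obtain ⟨i', j'⟩ := mem_of_mem_image_inter B.setting hO (hsub hy)
    refine (hA.norm_sub_le _ j _ j').trans ?_
    calc _ ≤ A * |b| ^ (α : ℝ) * ((Real.exp (-l) ^ (α : ℝ)) ^ n * |x - y| ^ (α : ℝ)) := by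
          gcongr; exact B.rpow_abs_branch_sub_le hO i i'
      _ ≤ A * |b| ^ (α : ℝ) * ((Real.exp (-l) ^ (α : ℝ)) ^ n * ℓ ^ (α : ℝ)) := by
          gcongr
      _ = A * (Real.exp (-l) ^ (α : ℝ)) ^ n * (|b| * ℓ) ^ (α : ℝ) := by
          rw [Real.mul_rpow (abs_nonneg _) hℓ0]; ring
      _ ≤ 1 / 4 := hℓ
  have norm : ∀ O ∈ pieces f S n, Icc s t ⊆ f^[n] '' (O ∩ I) → ∀ x ∈ Icc s t,
      ‖ω (branch f n O x)‖ ≤ 1 := fun O hO hsub x hx =>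
    hA.norm_le_one _ (mem_of_mem_image_inter B.setting hO (hsub hx)).2
  have cont : ∀ O ∈ pieces f S n, Icc s t ⊆ f^[n] '' (O ∩ I) →
      ContinuousOn (fun x => birkhoffSum f τ n (branch f n O x)) (Icc s t) := fun O hO hsub x hx =>
    (B.slope n O hO x (mem_of_mem_image_inter B.setting hO
      (hsub hx)).1).1.continuousAt.continuousWithinAt
  exact
    { atom₁ := B.isAtom_push hA (by positivity) hn hO₁ b
      atom₂ := B.isAtom_push hA (by positivity) hn hO₂ b
      subset₁ := h₁
      subset₂ := h₂
      ratio_pos := by positivity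
      ratio_le_one := mul_le_one₀ hr₁ (Real.exp_pos _).le
        (Real.exp_le_one_iff.2 (neg_nonpos.2 B.holder_nonneg))
      phase₁ := fun x _ => rfl
      phase₂ := fun x _ => rfl
      norm₁ := norm O₁ hO₁ h₁
      norm₂ := norm O₂ hO₂ h₂
      near₁ := near O₁ hO₁ h₁
      near₂ := near O₂ hO₂ h₂
      ratio₁ := fun x hx => B.mul_pushDensity_le hA hO₁ hO₂ hr.le (h₁ hx) (h₂ hx) (hd x hx).2
      ratio₂ := fun x hx => B.mul_pushDensity_le hA hO₂ hO₁ hr.le (h₂ hx) (h₁ hx) (hd x hx).1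
      continuousOn := (cont O₁ hO₁ h₁).sub (cont O₂ hO₂ h₂)
      growth := hg }

set_option maxHeartbeats 2000000 in
/-- An atom on a long interval loses a definite proportion of its mass. -/
theorem UniformBounds.exists_cancellation (B : UniformBounds α f τ S R l D C a) {A δ : ℝ}
    (hA0 : 0 ≤ A) (hδ : 0 < δ) :
    ∃ n : ℕ, 1 ≤ n ∧ ∃ η : ℝ, 0 < η ∧ η ≤ 1 / 2 ∧ ∃ b₁ : ℝ, 1 ≤ b₁ ∧ ∃ Q : ℝ≥0∞, Q ≠ ∞ ∧
      ∀ b, b₁ ≤ |b| → ∀ I u ω, IsAtom α a (A * |b| ^ (α : ℝ)) I u ω →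
      ENNReal.ofReal δ ≤ volume I →
      Decomposes α a (2 * ((Real.exp (-l) ^ (α : ℝ)) ^ n * (A * |b| ^ (α : ℝ)) +
          2 * (C * |b|) ^ (α : ℝ) + 4 * a * Real.exp (2 * a)))
        (fun φ => atomFunctional I u ω (twist f τ S b n φ))
        (ENNReal.ofReal (1 - η) * atomMass I u) (ENNReal.ofReal |b| * Q * atomSup I u) := by
  have hα := B.exponent_pos
  have ha := B.holder_nonneg
  obtain ⟨c, hc, Hc⟩ := B.setting.exists_hasTransversalPair
  set ρ := Real.exp (-l) ^ (α : ℝ) with hρ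
  have hρ0 : 0 ≤ ρ := by positivity
  have hρ1 : ρ < 1 := B.rate_lt_one
  -- For such `n` the inherited phase varies by at most `1/4` over a block of length at most `2π /
  -- (c|b|)`. The factor `|b|^α` of its Hölder constant cancels, so `n₀` does not depend on `b`.
  obtain ⟨n₀, hn₀⟩ : ∃ n₀ : ℕ, ∀ n ≥ n₀, A * ρ ^ n * (2 * Real.pi / c) ^ (α : ℝ) ≤ 1 / 4 := by
    have h1 : Tendsto (fun n : ℕ => A * ρ ^ n * (2 * Real.pi / c) ^ (α : ℝ)) atTop (𝓝 0) := by
      simpa using ((tendsto_pow_atTop_nhds_zero_of_lt_one hρ0 hρ1).const_mul A).mul_const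
        ((2 * Real.pi / c) ^ (α : ℝ))
    exact eventually_atTop.1 (h1.eventually (ge_mem_nhds (by norm_num)))
  obtain ⟨n, hn, r', hr', Hr'⟩ := Hc (max n₀ 1) δ hδ
  have hn1 : 1 ≤ n := (le_max_right _ _).trans hn
  have hnn₀ := hn₀ n ((le_max_left _ _).trans hn)
  set r := min r' 1 with hr
  have hr0 : 0 < r := lt_min hr' one_pos
  have hr1 : r ≤ 1 := min_le_right _ _
  have hea : Real.exp (-a) ≤ 1 := Real.exp_le_one_iff.2 (neg_nonpos.2 ha)
  set c₀ := r * Real.exp (-a) with hc₀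
  have hc₀0 : 0 < c₀ := by positivity
  have hc₀1 : c₀ ≤ 1 := mul_le_one₀ hr1 (Real.exp_pos _).le hea
  have hπ := Real.pi_pos
  -- The merging window will be `κ₀ / |b|`; `K` is the Hölder constant of the transported phases
  -- with `|b|^α` removed.
  obtain ⟨κ₀, hκ0, hκd, hκe, hκH⟩ := exists_pos_small (a := a) hα (K := ρ ^ n * A + 2 * C ^ (α : ℝ))
    (E := c₀ / 32 / 4) (d := Real.pi / c) (by positivity) (by positivity)
  -- The window's share of a block of length at most `2π / (c|b|)`, reduced by the oscillation
  -- `e^a`.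
  set ξ := κ₀ * c * Real.exp (-a) / (2 * Real.pi) with hξ
  have hξ0 : 0 < ξ := by positivity
  have hξ1 : ξ ≤ 1 := by
    have h1 : κ₀ * c ≤ Real.pi := by rwa [le_div_iff₀ hc] at hκd
    rw [hξ, div_le_one (by positivity)]
    calc κ₀ * c * Real.exp (-a) ≤ Real.pi * 1 := by gcongr
      _ ≤ 2 * Real.pi := by linarith
  set ζ := r ^ 2 * Real.exp (-a) with hζ
  have hζ0 : 0 < ζ := by positivity
  have hζ1 : ζ ≤ 1 := mul_le_one₀ (pow_le_one₀ hr0.le hr1) (Real.exp_pos _).le hea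
  obtain ⟨cc, hcc, Hcc⟩ := B.exists_tsum_atomSup_push_le_supRate hn1
  -- The loss multiplies the cancellation on a window, the window's share of a block and the
  -- overlap's share of the atom. The bound on `|b|` leaves room for one half turn in the overlap.
  -- In the last constant, `2 (1 + cc)` pays for the uncut parts and `6 c / π` for at most `|b| c /
  -- π` blocks.
  refine ⟨n, hn1, c₀ / 32 * ξ * ζ, by positivity, ?_, max 1 (Real.pi / (c * r)), le_max_left _ _,
    2 * (1 + cc) + 6 * ENNReal.ofReal (c / Real.pi), ?_, ?_⟩
  · calc c₀ / 32 * ξ * ζ ≤ 1 / 32 * 1 * 1 := by gcongr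
      _ ≤ 1 / 2 := by norm_num
  · exact ENNReal.add_ne_top.2 ⟨ENNReal.mul_ne_top (by simp) (by simp [hcc]),
      ENNReal.mul_ne_top (by simp) ENNReal.ofReal_ne_top⟩
  intro b hb I u ω hA hI
  have hb1 : 1 ≤ |b| := (le_max_left _ _).trans hb
  have hb0 : 0 < |b| := by linarith
  have hb2 : Real.pi / (c * r) ≤ |b| := (le_max_right _ _).trans hb
  obtain ⟨p, q, hp, hq, hpq, hsubI⟩ := hA.exists_Ioo_subset hδ hI
  obtain ⟨O₁, hO₁, O₂, hO₂, hne, s, t, hst, h₁, h₂, hd, hg⟩ :=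
    (Hr' p q hp hq hpq).mono le_rfl le_rfl (min_le_left r' 1)
  rw [← hr] at hst hd
  replace h₁ := h₁.trans (image_mono (inter_subset_inter_right O₁ hsubI))
  replace h₂ := h₂.trans (image_mono (inter_subset_inter_right O₂ hsubI))
  have hst0 : s ≤ t := by linarith
  have hts1 : t - s ≤ 1 := by
    have e1 := B.setting.image_subset hO₁
      (image_mono inter_subset_left (h₁ (left_mem_Icc.2 hst0)))
    have e2 := B.setting.image_subset hO₁
      (image_mono inter_subset_left (h₁ (right_mem_Icc.2 hst0)))
    linarith [e1.1, e2.2]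
  set ℓ := 2 * Real.pi / (c * |b|) with hℓ
  have hℓb : |b| * ℓ = 2 * Real.pi / c := by rw [hℓ]; field_simp
  have P := B.rotatingPair hA hA0 hn1 hO₁ hO₂ hr0 hr1 h₁ h₂ hd hg (ℓ := ℓ)
    (by rw [hℓb]; exact hnn₀) (by positivity)
  set X := (t - s) * |b| * c / Real.pi with hX
  have hX1 : 1 ≤ X := by
    rw [hX, le_div_iff₀ hπ, one_mul]
    rw [div_le_iff₀ (by positivity)] at hb2
    calc Real.pi ≤ |b| * (c * r) := hb2
      _ ≤ |b| * (c * (t - s)) := by gcongr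
      _ = _ := by ring
  -- `X` counts the half turns guaranteed at speed `c |b|`. As `N ≤ X ≤ 2N`, a block has length
  -- between `π / (c|b|)` and `2π / (c|b|)`.
  set N := ⌊X⌋₊ with hN
  have hN1 : 1 ≤ N := Nat.one_le_floor_iff _ |>.2 hX1
  have hNX : (N : ℝ) ≤ X := Nat.floor_le (by linarith)
  have hXN : X ≤ 2 * N := by
    have h1 := Nat.lt_floor_add_one X
    have h2 : (1 : ℝ) ≤ N := by exact_mod_cast hN1
    rw [← hN] at h1
    linarith
  have hN0 : (0 : ℝ) < N := by exact_mod_cast hN1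
  have hts0 : 0 < t - s := by linarith
  have hXe : X * Real.pi = (t - s) * |b| * c := by rw [hX]; field_simp
  have hlow : Real.pi / (c * |b|) ≤ (t - s) / N := by
    rw [div_le_div_iff₀ (by positivity) hN0]
    nlinarith
  have hup : (t - s) / N ≤ ℓ := by
    rw [hℓ, div_le_div_iff₀ hN0 (by positivity)]
    nlinarith
  set H₁ := ρ ^ n * (A * |b| ^ (α : ℝ)) + 2 * (C * |b|) ^ (α : ℝ) with hH₁
  have hC := B.slope_nonneg
  have hH₁0 : 0 ≤ H₁ := by positivity
  have hκb : (κ₀ / |b|) ^ (α : ℝ) ≤ κ₀ ^ (α : ℝ) :=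
    Real.rpow_le_rpow (by positivity) (div_le_self hκ0.le hb1) α.2
  have DJ := P.decomposes hα ha hH₁0 (abs_pos.1 hb0) hst0 (N := N) (by omega) (κ := κ₀ / |b|)
    (ξ := ξ) hup
    (by
      calc Real.pi = |b| * (c * (Real.pi / (c * |b|))) := by field_simp
        _ ≤ _ := by gcongr)
    (by positivity)
    (by
      refine le_trans ?_ hlow
      calc κ₀ / |b| ≤ Real.pi / c / |b| := by gcongr
        _ = _ := by rw [div_div])
    (le_trans (Real.exp_le_exp.2 (by gcongr)) hκe)
    (by
      calc H₁ * (κ₀ / |b|) ^ (α : ℝ) =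
          (ρ ^ n * A + 2 * C ^ (α : ℝ)) * κ₀ ^ (α : ℝ) := by
            rw [hH₁, Real.mul_rpow hC hb0.le, Real.div_rpow hκ0.le hb0.le]
            have : |b| ^ (α : ℝ) ≠ 0 := by positivity
            field_simp
        _ ≤ _ := hκH)
    hξ0.le
    (by
      calc ξ * Real.exp a * ((t - s) / N) ≤ ξ * Real.exp a * ℓ := by gcongr
        _ = (Real.exp (-a) * Real.exp a) * (κ₀ / |b|) := by rw [hξ, hℓ]; field_simp
        _ = κ₀ / |b| := by rw [← Real.exp_add]; simp)
  have : Countable (pieces f S n) := (B.setting.countable_pieces n).to_subtype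
  have hAh : 0 ≤ A * |b| ^ (α : ℝ) := by positivity
  have hm : ∑' O : pieces f S n, atomMass (f^[n] '' ((O : Set ℝ) ∩ I)) (pushDensity f n O u) ≤
      atomMass I u := by
    rw [tsum_congr fun O : pieces f S n => B.setting.atomMass_push O.2 hA.measurableSet]
    exact B.tsum_atomMass_inter_le hA.measurableSet n u
  have E := Decomposes.exchange (ι := pieces f S n)
    (I := fun O => f^[n] '' ((O : Set ℝ) ∩ I)) (u := fun O => pushDensity f n O u)
    (ω := fun O => pushPhase f τ b n O ω)
    (Λ := fun φ => atomFunctional I u ω (twist f τ S b n φ)) hα ha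
    (fun O => B.isAtom_push hA hAh hn1 O.2 b)
    (H' := 2 * (H₁ + 4 * a * Real.exp (2 * a)))
    (by
      have : 0 ≤ 4 * a * Real.exp (2 * a) := by positivity
      linarith)
    hm (hA.atomMass_lt_top ha).ne (fun φ hφ => B.hasSum_atomFunctional_push hA b n hφ)
    (i := ⟨O₁, hO₁⟩) (j := ⟨O₂, hO₂⟩) (fun hcon => hne (congrArg Subtype.val hcon)) hst0
    (Ico_subset_Icc_self.trans h₁) (Ico_subset_Icc_self.trans h₂)
    (η := c₀ / 32 * ξ) (ζ := ζ) (by positivity)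
    (by
      calc c₀ / 32 * ξ ≤ 1 / 32 * 1 := by gcongr
        _ ≤ 1 := by norm_num)
    hζ0.le hζ1 DJ
    ((B.mul_atomMass_le_push hA hO₁ hr0.le hst h₁ fun x hx => (hd x hx).1).trans le_self_add)
  refine E.mono le_rfl le_rfl ?_
  set Z := atomSup I u with hZ
  have hvol : volume I ≤ 1 := (measure_mono hA.subset).trans (by simp)
  have hmZ : atomMass I u ≤ Z := hA.atomMass_le.trans (by
    calc volume I * Z ≤ 1 * Z := by gcongr
      _ = Z := one_mul _)
  have hsupO : ∀ O ∈ pieces f S n, atomSup (f^[n] '' (O ∩ I)) (pushDensity f n O u) ≤ Z := by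
    intro O hO
    refine (B.atomSup_push_le hA hO fun x hx => B.abs_deriv_branch_le_one hO hx).trans ?_
    rw [ENNReal.ofReal_one, one_mul]
    exact atomSup_mono inter_subset_right
  have hNb : (N : ℝ≥0∞) ≤ ENNReal.ofReal |b| * ENNReal.ofReal (c / Real.pi) := by
    rw [← ENNReal.ofReal_mul hb0.le, ← ENNReal.ofReal_natCast]
    refine ENNReal.ofReal_le_ofReal (hNX.trans ?_)
    calc X = (t - s) * (|b| * (c / Real.pi)) := by rw [hX]; ring
      _ ≤ 1 * (|b| * (c / Real.pi)) := by gcongr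
      _ = _ := one_mul _
  have hone : 1 ≤ ENNReal.ofReal |b| := by
    rw [← ENNReal.ofReal_one]; exact ENNReal.ofReal_le_ofReal hb1
  calc _ ≤ 2 * (1 * Z + cc * Z) +
        ENNReal.ofReal |b| * ENNReal.ofReal (c / Real.pi) * (3 * (Z + Z)) := by
        gcongr
        · refine (Hcc _ I u ω hA).trans ?_
          gcongr
          exact B.supRate_lt_one.le
        · exact hsupO O₁ hO₁
        · exact hsupO O₂ hO₂
    _ = 1 * (2 * (1 + cc) * Z) + ENNReal.ofReal |b| * (6 * ENNReal.ofReal (c / Real.pi) * Z) := by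
        ring
    _ ≤ ENNReal.ofReal |b| * (2 * (1 + cc) * Z) +
        ENNReal.ofReal |b| * (6 * ENNReal.ofReal (c / Real.pi) * Z) := by gcongr
    _ = _ := by ring

end SkewProduct

/-! ### Iteration: contraction in logarithmically many steps. -/

namespace SkewProduct

open Filter Topology

variable {α : ℝ≥0} {f τ : ℝ → ℝ} {S R : Set ℝ} {l D C a : ℝ}
variable {H b : ℝ} {I : Set ℝ} {u : ℝ → ℝ} {ω φ : ℝ → ℂ} {n : ℕ}
variable {Λ : (ℝ → ℂ) → ℂ} {m z : ℝ≥0∞}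

lemma twist_zero (b : ℝ) (φ : ℝ → ℂ) : twist f τ S b 0 φ = (Ioo (0 : ℝ) 1).indicator φ := by
  simp [twist, regularSet_zero, birkhoffSum]

lemma IsAtom.atomFunctional_twist_zero (hA : IsAtom α a H I u ω) (b : ℝ) (φ : ℝ → ℂ) :
    atomFunctional I u ω (twist f τ S b 0 φ) = atomFunctional I u ω φ :=
  setIntegral_congr_fun hA.measurableSet fun x hx => by
    simp [twist_zero, indicator_of_mem (hA.subset hx)]

lemma Decomposes.twist_zero (h : Setting α f τ S R) (hΛ : Decomposes α a H Λ m z) (b : ℝ) :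
    Decomposes α a H (fun φ => Λ (twist f τ S b 0 φ)) m z := by
  refine hΛ.congr fun φ hφ => ?_
  obtain ⟨ι, hι, I, u, ω, hA, -, -, h3⟩ := hΛ
  refine (h3 φ hφ).unique ?_
  rw [← funext fun i => (hA i).atomFunctional_twist_zero (f := f) (τ := τ) (S := S) b φ]
  exact h3 _ (hφ.twist h b 0)

/-- Iterating the transfer operator regularizes the phases and the densities. -/
theorem UniformBounds.exists_regularization (B : UniformBounds α f τ S R l D C a) :
    ∃ K : ℝ, 0 ≤ K ∧ ∃ c : ℝ≥0∞, c ≠ ∞ ∧ 1 ≤ c ∧ ∀ (k : ℕ) (b H : ℝ), 0 ≤ H → ∀ Λ m z, m ≠ ∞ →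
      Decomposes α a H Λ m z →
      Decomposes α a ((Real.exp (-l) ^ (α : ℝ)) ^ k * H + K * |b| ^ (α : ℝ))
        (fun φ => Λ (twist f τ S b k φ)) m (supRate l ^ k * z + c * m) := by
  obtain ⟨c, hc, Hc⟩ := B.exists_decomposes_twist le_rfl
  set ρ := Real.exp (-l) ^ (α : ℝ) with hρ
  have hρ0 : 0 ≤ ρ := by positivity
  have hρ1 : 0 < 1 - ρ := sub_pos.2 B.rate_lt_one
  have hC := B.slope_nonneg
  set σ : ℝ≥0∞ := supRate l with hσ
  have hσ1 : σ < 1 := B.supRate_lt_one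
  have hσ0 : 1 - σ ≠ 0 := (tsub_pos_of_lt hσ1).ne'
  have hσt : 1 - σ ≠ ∞ := (tsub_le_self.trans_lt ENNReal.one_lt_top).ne
  -- Fixed point of `x ↦ σ x + c`, just as `K` below is the fixed point of the recursion for the
  -- phases. The `1` added to `x` in the conclusion survives the recursion because `σ ≤ 1`, and
  -- ensures a constant at least `1`.
  set x := c / (1 - σ) with hx
  have hxe : σ * x + c = x := by
    have h1 : (1 - σ) * x = c := ENNReal.mul_div_cancel hσ0 hσt
    rw [← h1, ← add_mul, add_tsub_cancel_of_le hσ1.le, one_mul]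
  set K := 2 * C ^ (α : ℝ) / (1 - ρ) with hK
  have hKe : ρ * K + 2 * C ^ (α : ℝ) = K := by rw [hK]; field_simp; ring
  have hK0 : 0 ≤ K := by positivity
  refine ⟨K, hK0, x + 1, by simp [hx, ENNReal.div_eq_top, hc, hσ0], le_add_self, ?_⟩
  intro k b H hH Λ m z hm hΛ
  induction k with
  | zero =>
    refine (hΛ.twist_zero B.setting b).mono ?_ le_rfl ?_
    · have : 0 ≤ K * |b| ^ (α : ℝ) := by positivity
      simpa using this
    · simp
  | succ k ih =>
    have h1 := Hc b _ (by positivity) _ m _ hm ih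
    simp only [twist_twist B.setting] at h1
    refine h1.mono ?_ le_rfl ?_
    · rw [Real.mul_rpow hC (abs_nonneg b), pow_one]
      apply le_of_eq
      linear_combination |b| ^ (α : ℝ) * hKe
    · calc σ * (σ ^ k * z + (x + 1) * m) + c * m
          = σ ^ (k + 1) * z + ((σ * x + c) + σ) * m := by ring
        _ ≤ σ ^ (k + 1) * z + (x + 1) * m := by
          rw [hxe]
          gcongr

/-- One cancellation step for a sum of atoms. -/
theorem UniformBounds.exists_contraction (B : UniformBounds α f τ S R l D C a) {A : ℝ}
    (hA0 : 0 ≤ A) {Z : ℝ≥0∞} (hZ : Z ≠ ∞) :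
    ∃ n : ℕ, ∃ θ : ℝ, 1 / 2 ≤ θ ∧ θ < 1 ∧ ∃ b₁ : ℝ, 1 ≤ b₁ ∧ ∃ A' : ℝ, 0 ≤ A' ∧ ∃ Q : ℝ≥0∞, Q ≠ ∞ ∧
      ∀ b, b₁ ≤ |b| → ∀ Λ m, m ≠ ∞ → Decomposes α a (A * |b| ^ (α : ℝ)) Λ m (Z * m) →
      Decomposes α a (A' * |b| ^ (α : ℝ)) (fun φ => Λ (twist f τ S b n φ))
        (ENNReal.ofReal θ * m) (ENNReal.ofReal |b| * Q * m) := by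
  have ha := B.holder_nonneg
  have hC := B.slope_nonneg
  -- Atoms shorter than `δ` carry at most `δ Z m ≤ m / 2` of the mass, so at least half of it
  -- undergoes cancellation.
  set δ := 1 / (2 * (Z.toReal + 1)) with hδ
  have hZr : 0 ≤ Z.toReal := ENNReal.toReal_nonneg
  have hδ0 : 0 < δ := by positivity
  have hδZ : ENNReal.ofReal δ * Z ≤ ENNReal.ofReal (1 / 2) := by
    rw [← ENNReal.ofReal_toReal hZ, ← ENNReal.ofReal_mul hδ0.le]
    apply ENNReal.ofReal_le_ofReal
    rw [hδ, div_mul_eq_mul_div, one_mul, div_le_div_iff₀ (by positivity) (by norm_num)]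
    linarith
  obtain ⟨n, hn, η, hη0, hη, b₁, hb₁, Q, hQ, HQ⟩ := B.exists_cancellation hA0 hδ0
  obtain ⟨c, hc, Hc⟩ := B.exists_decomposes_twist hn
  set ρ := Real.exp (-l) ^ (α : ℝ) with hρ
  have hρ0 : 0 ≤ ρ := by positivity
  have hρn : ρ ^ n ≤ 1 := pow_le_one₀ hρ0 B.rate_lt_one.le
  refine ⟨n, 1 - η / 2, by linarith, by linarith, b₁, hb₁,
    2 * (A + 2 * C ^ (α : ℝ) + 4 * a * Real.exp (2 * a)), by positivity, Q * Z + (Z + c),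
    by finiteness, ?_⟩
  intro b hb Λ m hm hΛ
  have hb1 : 1 ≤ |b| := hb₁.trans hb
  have hβ : 1 ≤ |b| ^ (α : ℝ) := Real.one_le_rpow hb1 α.2
  have hone : 1 ≤ ENNReal.ofReal |b| := ENNReal.one_le_ofReal.2 hb1
  have hAρ : ρ ^ n * (A * |b| ^ (α : ℝ)) ≤ A * |b| ^ (α : ℝ) :=
    mul_le_of_le_one_left (by positivity) hρn
  have hE : 4 * a * Real.exp (2 * a) ≤ 4 * a * Real.exp (2 * a) * |b| ^ (α : ℝ) :=
    le_mul_of_one_le_right (by positivity) hβ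
  have hpos : 0 ≤ A * |b| ^ (α : ℝ) + 2 * C ^ (α : ℝ) * |b| ^ (α : ℝ) +
    4 * a * Real.exp (2 * a) * |b| ^ (α : ℝ) := by positivity
  have hpos' : 0 ≤ 4 * a * Real.exp (2 * a) := by positivity
  have hCb : (C * |b|) ^ (α : ℝ) = C ^ (α : ℝ) * |b| ^ (α : ℝ) := Real.mul_rpow hC (abs_nonneg b)
  have hsplit : ENNReal.ofReal (1 - η) + ENNReal.ofReal η = 1 := by
    rw [← ENNReal.ofReal_add (by linarith) hη0.le]; simp
  -- A single mass bound serves both cases: for a short atom the term with `δ` covers the proportion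
  -- `η` that is not lost, since its mass is at most `δ` times its supremum. Summing gives `1 - η +
  -- η/2`.
  refine hΛ.bind ha (fun φ hφ => hφ.twist B.setting b n)
    (M := fun I u => ENNReal.ofReal (1 - η) * atomMass I u +
      ENNReal.ofReal η * (ENNReal.ofReal δ * atomSup I u))
    (Z := fun I u => ENNReal.ofReal |b| * Q * atomSup I u + (atomSup I u + c * atomMass I u))
    ?_ (by finiteness) ?_
  · intro I u ω hI
    by_cases hδI : ENNReal.ofReal δ ≤ volume I
    · refine (HQ b hb I u ω hI hδI).mono ?_ le_self_add le_self_add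
      rw [hCb]
      linarith
    · refine (Hc b _ (by positivity) _ _ _ (hI.atomMass_lt_top ha).ne
        (Decomposes.of_isAtom hI)).mono ?_ ?_ ?_
      · rw [hCb]
        linarith
      · calc atomMass I u = ENNReal.ofReal (1 - η) * atomMass I u +
              ENNReal.ofReal η * atomMass I u := by rw [← add_mul, hsplit, one_mul]
          _ ≤ _ := by
            gcongr
            refine hI.atomMass_le.trans ?_
            gcongr
            exact (not_le.1 hδI).le
      · refine le_trans ?_ le_add_self
        gcongr
        exact mul_le_of_le_one_left zero_le B.supRate_lt_one.le
  · intro ι _ I u ω _ h1 h2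
    simp only [ENNReal.tsum_add, ENNReal.tsum_mul_left]
    constructor
    · calc _ ≤ ENNReal.ofReal (1 - η) * m + ENNReal.ofReal η * (ENNReal.ofReal δ * (Z * m)) := by
            gcongr
        _ = (ENNReal.ofReal (1 - η) + ENNReal.ofReal η * (ENNReal.ofReal δ * Z)) * m := by ring
        _ ≤ (ENNReal.ofReal (1 - η) + ENNReal.ofReal η * ENNReal.ofReal (1 / 2)) * m := by gcongr
        _ = _ := by
            rw [← ENNReal.ofReal_mul hη0.le, ← ENNReal.ofReal_add (by linarith) (by linarith)]
            congr 2
            ring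
    · calc _ ≤ ENNReal.ofReal |b| * Q * (Z * m) + (1 * (Z * m) + 1 * (c * m)) := by
            rw [one_mul, one_mul]
            gcongr
        _ ≤ ENNReal.ofReal |b| * Q * (Z * m) +
            (ENNReal.ofReal |b| * (Z * m) + ENNReal.ofReal |b| * (c * m)) := by gcongr
        _ = _ := by ring

/-- A contraction of the mass within logarithmically many steps. -/
theorem UniformBounds.exists_log_contraction (B : UniformBounds α f τ S R l D C a) :
    ∃ A : ℝ, 1 ≤ A ∧ ∃ Z : ℝ≥0∞, 1 ≤ Z ∧ ∃ θ : ℝ, 0 < θ ∧ θ < 1 ∧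
      ∃ b₀ : ℝ, 1 < b₀ ∧ ∃ L : ℝ, 0 < L ∧ ∀ b, b₀ ≤ |b| → ∃ M : ℕ, 0 < M ∧
      (M : ℝ) ≤ L * Real.log |b| ∧ ∀ Λ m, m ≠ ∞ → Decomposes α a (A * |b| ^ (α : ℝ)) Λ m (Z * m) →
      Decomposes α a (A * |b| ^ (α : ℝ)) (fun φ => Λ (twist f τ S b M φ))
        (ENNReal.ofReal θ * m) (Z * (ENNReal.ofReal θ * m)) := by
  obtain ⟨K, hK, c, hc, hc1, Hc⟩ := B.exists_regularization
  -- The values `K + 1` and `2 c` are those to which regularization returns after cancellation: one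
  -- unit of slack in the Hölder constant and a factor two in the suprema.
  obtain ⟨n, θ, hθ, hθ1, b₁, hb₁, A', hA', Q, hQ, HQ⟩ :=
    B.exists_contraction (A := K + 1) (by positivity) (Z := 2 * c) (by finiteness)
  set ρ := Real.exp (-l) ^ (α : ℝ) with hρ
  have hρ0 : 0 ≤ ρ := by positivity
  have hρ1 : ρ < 1 := B.rate_lt_one
  set σ := supRate l with hσ
  have hσ1 : σ < 1 := B.supRate_lt_one
  have hσt := ENNReal.tendsto_pow_atTop_nhds_zero_of_lt_one hσ1
  obtain ⟨k₀, hk₀⟩ : ∃ k : ℕ, ρ ^ k * A' ≤ 1 := by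
    have h1 := (tendsto_pow_atTop_nhds_zero_of_lt_one hρ0 hρ1).mul_const A'
    rw [zero_mul] at h1
    exact (h1.eventually (ge_mem_nhds one_pos)).exists
  obtain ⟨k₁, hk₁⟩ : ∃ k : ℕ, σ ^ k * (2 * Q) ≤ 1 := by
    have h1 := ENNReal.Tendsto.mul_const hσt (b := 2 * Q) (Or.inr (by finiteness))
    rw [zero_mul] at h1
    exact (h1.eventually (ge_mem_nhds one_pos)).exists
  -- Each `j` steps gain a factor `e`, so `j ⌈log |b|⌉` steps absorb the factor `|b|` created by the
  -- blocks.
  obtain ⟨j, hj⟩ : ∃ k : ℕ, σ ^ k ≤ ENNReal.ofReal (Real.exp (-1)) :=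
    (hσt.eventually (ge_mem_nhds (ENNReal.ofReal_pos.2 (Real.exp_pos _)))).exists
  refine ⟨K + 1, by linarith, 2 * c, ?_, θ, by linarith, hθ1, max b₁ (Real.exp 1), ?_,
    n + k₀ + k₁ + 2 * j + 1, by positivity, ?_⟩
  · calc (1 : ℝ≥0∞) ≤ 2 * 1 := by norm_num
      _ ≤ 2 * c := by gcongr
  · exact lt_max_of_lt_right (by simp)
  intro b hb
  have hb1 : b₁ ≤ |b| := (le_max_left _ _).trans hb
  have hb2 : Real.exp 1 ≤ |b| := (le_max_right _ _).trans hb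
  have hb0 : 0 < |b| := (Real.exp_pos 1).trans_le hb2
  have hlog : 1 ≤ Real.log |b| := by rwa [Real.le_log_iff_exp_le hb0]
  have hβ : 1 ≤ |b| ^ (α : ℝ) := Real.one_le_rpow (hb₁.trans hb1) α.2
  set N := ⌈Real.log |b|⌉₊ with hN
  have hNl : Real.log |b| ≤ N := Nat.le_ceil _
  have hNu : (N : ℝ) ≤ 2 * Real.log |b| := by
    have := Nat.ceil_lt_add_one (show 0 ≤ Real.log |b| by linarith)
    rw [← hN] at this
    linarith
  set k := k₀ + k₁ + j * N + 1 with hk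
  have hσb : σ ^ (j * N) * ENNReal.ofReal |b| ≤ 1 := by
    calc σ ^ (j * N) * ENNReal.ofReal |b|
        ≤ ENNReal.ofReal (Real.exp (-1)) ^ N * ENNReal.ofReal |b| := by rw [pow_mul]; gcongr
      _ = ENNReal.ofReal (Real.exp (-N) * |b|) := by
          rw [← ENNReal.ofReal_pow (Real.exp_pos _).le, ← ENNReal.ofReal_mul (by positivity),
            ← Real.exp_nat_mul]
          simp
      _ ≤ 1 := by
          rw [← ENNReal.ofReal_one]
          apply ENNReal.ofReal_le_ofReal
          calc Real.exp (-N) * |b| = Real.exp (-N) * Real.exp (Real.log |b|) := by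
                rw [Real.exp_log hb0]
            _ = Real.exp (-N + Real.log |b|) := (Real.exp_add _ _).symm
            _ ≤ 1 := Real.exp_le_one_iff.2 (by linarith)
  have hkQ : σ ^ k * (ENNReal.ofReal |b| * Q) * 2 ≤ 1 := by
    calc _ ≤ σ ^ (k₁ + j * N) * (ENNReal.ofReal |b| * Q) * 2 := by
          gcongr ?_ * _ * _
          exact pow_le_pow_right_of_le_one' hσ1.le (by omega)
      _ = (σ ^ k₁ * (2 * Q)) * (σ ^ (j * N) * ENNReal.ofReal |b|) := by rw [pow_add]; ring
      _ ≤ 1 * 1 := by gcongr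
      _ = 1 := one_mul 1
  have hkA : ρ ^ k * A' ≤ 1 := by
    refine le_trans ?_ hk₀
    gcongr ?_ * _
    exact pow_le_pow_of_le_one hρ0 hρ1.le (by omega)
  -- The bound `θ ≥ 1/2` allows the suprema to be compared with the reduced mass `θ m` rather than
  -- with `m`.
  have hθ2 : 1 ≤ 2 * ENNReal.ofReal θ := by
    calc (1 : ℝ≥0∞) = 2 * ENNReal.ofReal (1 / 2) := by
          rw [show (2 : ℝ≥0∞) = ENNReal.ofReal 2 by simp, ← ENNReal.ofReal_mul (by norm_num)]
          norm_num
      _ ≤ _ := by gcongr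
  refine ⟨n + k, by omega, ?_, fun Λ m hm hΛ => ?_⟩
  · rw [hk]
    push_cast
    have h1 : (j : ℝ) * N ≤ j * (2 * Real.log |b|) := by gcongr
    have h2 : ((n : ℝ) + k₀ + k₁ + 1) * 1 ≤ (n + k₀ + k₁ + 1) * Real.log |b| := by gcongr
    linarith
  · have h1 := Hc k b _ (by positivity) _ _ _ (by finiteness) (HQ b hb1 Λ m hm hΛ)
    simp only [twist_twist B.setting] at h1
    refine h1.mono ?_ le_rfl ?_
    · have : ρ ^ k * (A' * |b| ^ (α : ℝ)) ≤ 1 * |b| ^ (α : ℝ) := by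
        rw [← mul_assoc]; gcongr
      linarith
    · calc σ ^ k * (ENNReal.ofReal |b| * Q * m) + c * (ENNReal.ofReal θ * m)
          = σ ^ k * (ENNReal.ofReal |b| * Q) * (1 * m) + c * (ENNReal.ofReal θ * m) := by ring
        _ ≤ σ ^ k * (ENNReal.ofReal |b| * Q) * (2 * ENNReal.ofReal θ * m) +
            c * (ENNReal.ofReal θ * m) := by gcongr
        _ = (σ ^ k * (ENNReal.ofReal |b| * Q) * 2) * (ENNReal.ofReal θ * m) +
            c * (ENNReal.ofReal θ * m) := by ring
        _ ≤ c * (ENNReal.ofReal θ * m) + c * (ENNReal.ofReal θ * m) := by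
            gcongr
            exact hkQ.trans hc1
        _ = _ := by ring

/-- Exponential decay of the functionals given by atoms, at a rate which is inverse to `ln |b|`. -/
theorem UniformBounds.exists_decay (B : UniformBounds α f τ S R l D C a) :
    ∃ b₀ γ K : ℝ, 1 < b₀ ∧ 0 < γ ∧ 0 ≤ K ∧ ∀ b, b₀ ≤ |b| → ∀ (n : ℕ) I ω φ,
      IsAtom α a 1 I (fun _ => 1) ω → IsTest φ →
      ‖atomFunctional I (fun _ => 1) ω (twist f τ S b n φ)‖ ≤
        K * Real.exp (-(γ / Real.log |b|) * n) := by
  obtain ⟨A, hA, Z, hZ, θ, hθ0, hθ1, b₀, hb₀, L, hL, HL⟩ := B.exists_log_contraction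
  have ha := B.holder_nonneg
  refine ⟨b₀, -Real.log θ / L, θ⁻¹, hb₀, div_pos (neg_pos.2 (Real.log_neg hθ0 hθ1)) hL,
    by positivity, fun b hb n I ω φ hI hφ => ?_⟩
  obtain ⟨M, hM, hML, HM⟩ := HL b hb
  have hb1 : 1 < |b| := hb₀.trans_le hb
  have hlog : 0 < Real.log |b| := Real.log_pos hb1
  have hβ : 1 ≤ |b| ^ (α : ℝ) := Real.one_le_rpow hb1.le α.2
  have hvol : volume I ≤ 1 := (measure_mono hI.subset).trans (by simp)
  have hsup : atomSup I (fun _ => 1) ≤ 1 := iSup₂_le fun _ _ => by simp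
  have h0 : Decomposes α a (A * |b| ^ (α : ℝ)) (atomFunctional I (fun _ => 1) ω) 1 (Z * 1) := by
    refine (Decomposes.of_isAtom hI).mono (one_le_mul_of_one_le_of_one_le hA hβ) ?_ ?_
    · exact hI.atomMass_le.trans (mul_le_one' hvol hsup)
    · exact hsup.trans (by rwa [mul_one])
  have hp : ∀ p : ℕ, Decomposes α a (A * |b| ^ (α : ℝ))
      (fun φ => atomFunctional I (fun _ => 1) ω (twist f τ S b (p * M) φ))
      (ENNReal.ofReal θ ^ p) (Z * ENNReal.ofReal θ ^ p) := by
    intro p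
    induction p with
    | zero => simpa using h0.twist_zero B.setting b
    | succ p ih =>
      have h1 := HM _ _ (by finiteness) ih
      simp only [twist_twist B.setting] at h1
      rwa [← pow_succ', show p * M + M = (p + 1) * M by ring] at h1
  -- The remaining `n % M` steps are put into the test function, which stays in the unit disc;
  -- rounding `n / M` down costs the factor `θ⁻¹`.
  have h1 := (hp (n / M)).norm_le ha (by finiteness) (hφ.twist B.setting b (n % M))
  simp only [twist_twist B.setting] at h1
  rw [Nat.div_add_mod' n M, ENNReal.toReal_pow, ENNReal.toReal_ofReal hθ0.le] at h1
  refine h1.trans ?_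
  have hlt : (n : ℝ) / M < (n / M : ℕ) + 1 := by
    rw [div_lt_iff₀ (by exact_mod_cast hM)]
    exact_mod_cast Nat.lt_div_mul_add hM |>.trans_eq (by ring)
  have hle : (n : ℝ) / (L * Real.log |b|) ≤ (n : ℝ) / M := by gcongr
  have hκ : Real.log θ < 0 := Real.log_neg hθ0 hθ1
  calc θ ^ (n / M) = Real.exp (Real.log θ * (n / M : ℕ)) := by
        rw [mul_comm, Real.exp_nat_mul, Real.exp_log hθ0]
    _ ≤ Real.exp (-Real.log θ + Real.log θ * (n / (L * Real.log |b|))) := by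
        apply Real.exp_le_exp.2
        nlinarith
    _ = _ := by
        rw [Real.exp_add, Real.exp_neg, Real.exp_log hθ0]
        congr 2
        field_simp

end SkewProduct

/-! ### From atoms back to the transfer operator. -/

namespace SkewProduct

open Filter Topology

variable {α : ℝ≥0} {f τ : ℝ → ℝ} {S R : Set ℝ} {l D C a : ℝ}
variable {b G : ℝ} {O : Set ℝ} {g φ : ℝ → ℂ} {n : ℕ}

/-- The contribution of one inverse branch to the transfer operator. -/
noncomputable def branchTerm (f τ : ℝ → ℝ) (b : ℝ) (n : ℕ) (g : ℝ → ℂ) (O : Set ℝ) : ℝ → ℂ :=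
  (f^[n] '' O).indicator fun x =>
    Complex.exp (Complex.I * b * birkhoffSum f τ n (branch f n O x)) *
      g (branch f n O x) * (|deriv (branch f n O) x| : ℝ)

lemma UniformBounds.branchSup_nonneg (B : UniformBounds α f τ S R l D C a)
    (hO : O ∈ pieces f S n) : 0 ≤ branchSup f n O := by
  obtain ⟨x, hx⟩ := nonempty_of_mem_intervalsOf hO
  exact (abs_nonneg _).trans (B.abs_deriv_branch_le_branchSup hO (mem_image_of_mem _ hx))

lemma UniformBounds.norm_branchTerm_le (B : UniformBounds α f τ S R l D C a)
    (hg : ∀ x ∈ Ioo (0 : ℝ) 1, ‖g x‖ ≤ G) (hG : 0 ≤ G) (hO : O ∈ pieces f S n) (x : ℝ) :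
    ‖branchTerm f τ b n g O x‖ ≤ G * branchSup f n O := by
  have h0 := B.branchSup_nonneg hO
  by_cases hx : x ∈ f^[n] '' O
  · rw [branchTerm, indicator_of_mem hx, norm_mul, norm_mul, norm_exp_I_mul_mul, one_mul,
      Complex.norm_real, Real.norm_eq_abs, abs_abs]
    gcongr
    · exact hg _ (regularSet_subset n (subset_of_mem_pieces hO (branch_mem hx)))
    · exact B.abs_deriv_branch_le_branchSup hO hx
  · rw [branchTerm, indicator_of_notMem hx, norm_zero]
    positivity

lemma UniformBounds.aestronglyMeasurable_branchTerm (B : UniformBounds α f τ S R l D C a)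
    (hg : ContinuousOn g (Ioo (0 : ℝ) 1)) (hO : O ∈ pieces f S n) (μ : Measure ℝ) :
    AEStronglyMeasurable (branchTerm f τ b n g O) μ := by
  have hm : MeasurableSet (f^[n] '' O) := (B.setting.isOpen_image_piece hO).measurableSet
  refine (aestronglyMeasurable_indicator_iff hm).2 ?_
  refine AEStronglyMeasurable.mul (ContinuousOn.aestronglyMeasurable ?_ hm) ?_
  · have hbr : ContinuousOn (branch f n O) (f^[n] '' O) := fun x hx =>
      (B.setting.continuousAt_branch hO hx).continuousWithinAt
    have hbi : ContinuousOn (fun x => birkhoffSum f τ n (branch f n O x)) (f^[n] '' O) :=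
      fun x hx => (B.slope n O hO x hx).1.continuousAt.continuousWithinAt
    refine ContinuousOn.mul ?_ (hg.comp hbr fun x hx =>
      regularSet_subset n (subset_of_mem_pieces hO (branch_mem hx)))
    exact (continuousOn_const.mul (Complex.continuous_ofReal.comp_continuousOn hbi)).cexp
  · exact (Complex.measurable_ofReal.comp
      (measurable_deriv (branch f n O)).abs).aestronglyMeasurable

lemma UniformBounds.summable_branchSup (B : UniformBounds α f τ S R l D C a) (n : ℕ) :
    Summable fun O : pieces f S n => branchSup f n O := B.setting.summable n

/-- Summability of the branch suprema bounds the series uniformly, and measurability passes to the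
limit of its finite partial sums. -/
lemma UniformBounds.integrable_transfer (B : UniformBounds α f τ S R l D C a)
    (hg : ∀ x ∈ Ioo (0 : ℝ) 1, ‖g x‖ ≤ G) (hG : 0 ≤ G) (hgc : ContinuousOn g (Ioo (0 : ℝ) 1))
    (b : ℝ) (n : ℕ) (μ : Measure ℝ) [IsFiniteMeasure μ] :
    Integrable (transfer f τ S b n g) μ := by
  have : Countable (pieces f S n) := (B.setting.countable_pieces n).to_subtype
  have hs := (B.summable_branchSup n).mul_left G
  have hle : ∀ (O : pieces f S n) x, ‖branchTerm f τ b n g O x‖ ≤ G * branchSup f n O :=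
    fun O x => B.norm_branchTerm_le hg hG O.2 x
  refine Integrable.of_bound (C := ∑' O : pieces f S n, G * branchSup f n O) ?_
    (Eventually.of_forall fun x => tsum_of_norm_bounded hs.hasSum fun O => hle O x)
  refine aestronglyMeasurable_of_tendsto_ae atTop
    (f := fun (F : Finset (pieces f S n)) x => ∑ O ∈ F, branchTerm f τ b n g O x) (fun F => ?_)
    (Eventually.of_forall fun x => (Summable.of_norm_bounded hs fun O => hle O x).hasSum)
  exact Finset.aestronglyMeasurable_fun_sum F fun O _ =>
    B.aestronglyMeasurable_branchTerm hgc O.2 μ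

/-- The duality between the transfer operator and `twist`. -/
lemma UniformBounds.integral_transfer_mul (B : UniformBounds α f τ S R l D C a) {H : ℝ}
    (hA : IsAtom α a H (Ioo 0 1) (fun _ => 1) g) (b : ℝ) (n : ℕ) (hφ : IsTest φ) :
    ∫ x in Ico (0 : ℝ) 1, transfer f τ S b n g x * φ x =
      atomFunctional (Ioo 0 1) (fun _ => 1) g (twist f τ S b n φ) := by
  have : Countable (pieces f S n) := (B.setting.countable_pieces n).to_subtype
  have hle : ∀ (O : pieces f S n) x, ‖branchTerm f τ b n g O x * φ x‖ ≤ branchSup f n O := by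
    intro O x
    rw [norm_mul]
    have h0 := B.branchSup_nonneg O.2
    have h1 := B.norm_branchTerm_le (b := b) hA.norm_le_one zero_le_one O.2 x
    have h2 := hφ.2 x
    calc _ ≤ 1 * branchSup f n O * 1 := by gcongr
      _ = _ := by ring
  have hint : ∀ O : pieces f S n, IntegrableOn (fun x => branchTerm f τ b n g O x * φ x)
      (Ico (0 : ℝ) 1) := fun O =>
    Integrable.of_bound ((B.aestronglyMeasurable_branchTerm
      (hA.continuousOn_phase B.exponent_pos) O.2 _).mul hφ.1.aestronglyMeasurable) _
      (Eventually.of_forall (hle O))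
  have h1 := hasSum_integral_of_summable_integral_norm hint
    (Summable.of_nonneg_of_le (fun O => integral_nonneg fun x => norm_nonneg _) (fun O => by
      calc ∫ x in Ico (0 : ℝ) 1, ‖branchTerm f τ b n g O x * φ x‖
          ≤ ∫ x in Ico (0 : ℝ) 1, branchSup f n O :=
            integral_mono (hint O).norm (integrable_const _) (hle O)
        _ = branchSup f n O := by simp) (B.summable_branchSup n))
  simp only [tsum_mul_right] at h1
  refine h1.unique ?_
  refine (funext fun O : pieces f S n => ?_ : (fun O : pieces f S n => ∫ x in Ico (0 : ℝ) 1,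
    branchTerm f τ b n g O x * φ x) = fun O : pieces f S n => atomFunctional
      (f^[n] '' ((O : Set ℝ) ∩ Ioo 0 1)) (pushDensity f n O fun _ => 1)
      (pushPhase f τ b n O g) φ) ▸ B.hasSum_atomFunctional_push hA b n hφ
  have hsub := B.setting.image_subset O.2
  have hI : (O : Set ℝ) ∩ Ioo 0 1 = O :=
    inter_eq_left.2 ((subset_of_mem_pieces O.2).trans (regularSet_subset n))
  have hm : MeasurableSet (f^[n] '' (O : Set ℝ)) :=
    (B.setting.isOpen_image_piece O.2).measurableSet
  rw [hI, atomFunctional]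
  calc _ = ∫ x in f^[n] '' (O : Set ℝ), branchTerm f τ b n g O x * φ x :=
        setIntegral_eq_of_subset_of_forall_sdiff_eq_zero measurableSet_Ico
          (hsub.trans Ioo_subset_Ico_self) fun x hx => by
            rw [branchTerm, indicator_of_notMem hx.2, zero_mul]
    _ = _ := setIntegral_congr_fun hm fun x hx => by
        simp only [branchTerm, indicator_of_mem hx, pushDensity, pushPhase, one_mul]
        ring

/-- The test function is the conjugate phase of a measurable representative of `T`, with value `0 /
0 = 0` where that vanishes. -/
lemma exists_isTest_mul_eq_norm {μ : Measure ℝ} {T : ℝ → ℂ} (hT : AEStronglyMeasurable T μ) :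
    ∃ φ, IsTest φ ∧ ∀ᵐ x ∂μ, T x * φ x = (‖T x‖ : ℂ) := by
  set T' := hT.mk T
  have hm : Measurable T' := hT.stronglyMeasurable_mk.measurable
  refine ⟨fun x => (starRingEnd ℂ) (T' x) / (‖T' x‖ : ℂ), ⟨?_, fun x => ?_⟩, ?_⟩
  · exact (Complex.continuous_conj.measurable.comp hm).div
      (Complex.measurable_ofReal.comp hm.norm)
  · rw [norm_div, RCLike.norm_conj, Complex.norm_real, norm_norm]
    exact div_self_le_one _
  · filter_upwards [hT.ae_eq_mk] with x hx
    rw [hx]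
    change T' x * ((starRingEnd ℂ) (T' x) / (‖T' x‖ : ℂ)) = (‖T' x‖ : ℂ)
    by_cases h0 : T' x = 0
    · simp [h0]
    · have : (‖T' x‖ : ℂ) ≠ 0 := by simpa using h0
      rw [← mul_div_assoc, Complex.mul_conj, Complex.normSq_eq_norm_sq]
      field_simp
      push_cast
      ring

lemma enorm_le_holderNorm {x : ℝ} (hx : x ∈ Ico (0 : ℝ) 1) : ‖g x‖ₑ ≤ holderNorm α g :=
  (le_biSup (fun x => ‖g x‖ₑ) hx).trans le_add_self

lemma continuousOn_of_holderNorm_lt_top (hα : 0 < α) (hg : holderNorm α g < ∞) :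
    ContinuousOn g (Ico (0 : ℝ) 1) := by
  rw [continuousOn_iff_continuous_domRestrict]
  have h1 : eHolderNorm α ((Ico (0 : ℝ) 1).domRestrict g) < ∞ := le_self_add.trans_lt hg
  exact (eHolderNorm_lt_top.1 h1).holderWith.continuous hα

/-- The starting point of the iteration: `g` itself is the phase of an atom with constant density on
`(0,1)`. -/
lemma isAtom_of_holderNorm_le_one (ha : 0 ≤ a) (hg : holderNorm α g ≤ 1) :
    IsAtom α a 1 (Ioo 0 1) (fun _ => 1) g where
  ordConnected := ordConnected_Ioo
  subset := Subset.rfl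
  pos _ _ := one_pos
  le_exp_mul x _ y _ := by
    rw [mul_one]
    exact Real.one_le_exp (by positivity)
  norm_le_one x hx := by
    have h1 := (enorm_le_holderNorm (Ioo_subset_Ico_self hx)).trans hg
    rwa [← ofReal_norm, ENNReal.ofReal_le_one] at h1
  norm_sub_le x hx y hy := by
    have h1 : eHolderNorm α ((Ico (0 : ℝ) 1).domRestrict g) ≤ 1 := le_self_add.trans hg
    have hmem := eHolderNorm_lt_top.1 (h1.trans_lt ENNReal.one_lt_top)
    have h2 : nnHolderNorm α ((Ico (0 : ℝ) 1).domRestrict g) ≤ 1 := by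
      rw [← hmem.coe_nnHolderNorm_eq_eHolderNorm] at h1
      exact_mod_cast h1
    have h3 := hmem.holderWith.dist_le ⟨x, Ioo_subset_Ico_self hx⟩ ⟨y, Ioo_subset_Ico_self hy⟩
    rw [dist_eq_norm, Subtype.dist_eq, Real.dist_eq] at h3
    refine h3.trans ?_
    gcongr
    exact_mod_cast h2

end SkewProduct

theorem mainTheorem2 (α : ℝ≥0) (hα₀ : 0 < α) (hα₁ : α < 1) (f τ : ℝ → ℝ) (S R : Set ℝ)
    (h : SkewProduct.Setting α f τ S R) :
    ∃ b₀ γ₂ C : ℝ, 1 < b₀ ∧ 0 < γ₂ ∧ ∀ b : ℝ, b₀ ≤ |b| → ∀ n : ℕ,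
      (∀ g : ℝ → ℂ, SkewProduct.holderNorm α g < ∞ →
        MemLp (SkewProduct.transfer f τ S b n g) 1 (volume.restrict (Ico (0 : ℝ) 1))) ∧
      SkewProduct.mixedNorm α (SkewProduct.transfer f τ S b n) ≤
        ENNReal.ofReal (C * Real.exp (-(γ₂ / Real.log |b|) * n)) := by
  obtain ⟨l, D, C, a, B⟩ := h.exists_uniformBounds hα₀ hα₁.le
  obtain ⟨b₀, γ, K, hb₀, hγ, -, hK⟩ := B.exists_decay
  have hint : ∀ b n g, SkewProduct.holderNorm α g < ∞ →
      Integrable (SkewProduct.transfer f τ S b n g) (volume.restrict (Ico (0 : ℝ) 1)) := by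
    intro b n g hg
    refine B.integrable_transfer (G := (SkewProduct.holderNorm α g).toReal) (fun x hx => ?_)
      ENNReal.toReal_nonneg ((SkewProduct.continuousOn_of_holderNorm_lt_top hα₀ hg).mono
        Ioo_subset_Ico_self) b n _
    rw [← toReal_enorm]
    exact ENNReal.toReal_mono hg.ne (SkewProduct.enorm_le_holderNorm (Ioo_subset_Ico_self hx))
  refine ⟨b₀, γ, K, hb₀, hγ, fun b hb n => ⟨fun g hg => memLp_one_iff_integrable.2 (hint b n g hg),
    iSup₂_le fun g hg => ?_⟩⟩
  have hi := hint b n g (hg.trans_lt ENNReal.one_lt_top)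
  have hA := SkewProduct.isAtom_of_holderNorm_le_one B.holder_nonneg hg
  -- With this `φ` the dual pairing equals the `L^1` norm, so the decay of atom functionals bounds
  -- it directly.
  obtain ⟨φ, hφ, hφT⟩ := SkewProduct.exists_isTest_mul_eq_norm hi.aestronglyMeasurable
  have h1 := B.integral_transfer_mul hA b n hφ
  rw [integral_congr_ae hφT, integral_complex_ofReal] at h1
  have h2 := hK b hb n _ g φ hA hφ
  rw [← h1, Complex.norm_real, Real.norm_eq_abs] at h2
  rw [eLpNorm_one_eq_lintegral_enorm, ← ofReal_integral_norm_eq_lintegral_enorm hi]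
  exact ENNReal.ofReal_le_ofReal ((le_abs_self _).trans h2)
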